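/- Let $\eta$ be a random variable with values in $\{0,1,2,\dots\}$ such that $\mathbf P[\eta\ge 1]>0$ and $\mathbf E\eta<\infty$. For $d\ge 1$ and $p\in[0,1]$, consider the frog model with death on $\mathbb Z^d$ (nearest-neighbour graph, root $\mathbf 0$): independently over all sites $x$, there are initially $\eta(x)$ particles at $x$, where $\eta(x)$ has the law of $\eta$; to each particle are attached, independently of everything else, a simple random walk $(S_n)_{n\ge 0}$ on $\mathbb Z^d$ starting from the site of the particle and a lifetime $\Xi$ with $\mathbf P[\Xi=k]=(1-p)p^{k-1}$, $k=1,2,\dots$ (and $\Xi=\infty$ if $p=1$). At time $0$ the particles at $\mathbf 0$ are active and all others are sleeping. A particle activated at time $T$ is active at the times $T+n$ with $0\le n<\Xi$, is then at the site $S_n$, and activates all sleeping particles at the sites where it is; at time $T+\Xi$ it disappears. The process survives if at every time $n=0,1,2,\dots$ there is at least one active particle. Let $$p_c(\mathbb Z^d,\eta)=\inf\{p\in[0,1]:\ \mathbf P[\text{the process with parameter } p \text{ survives}]>0\}.$$ Then $$\lim_{d\to\infty}p_c(\mathbb Z^d,\eta)=\frac1{1+\mathbf E\eta}.$$ -/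

import Mathlib

open MeasureTheory ProbabilityTheory Filter Topology

noncomputable section

namespace Frog

/-- The sites of the lattice `ℤ^d`. -/
abbrev Site (d : ℕ) : Type := Fin d → ℤ

/-- The nearest neighbours of the origin of `ℤ^d`: the vectors of `ℓ¹`-norm one
(see `mem_unitSteps`). -/
def unitSteps (d : ℕ) : Finset (Site d) :=
  (Fintype.piFinset fun _ : Fin d => Finset.Icc (-1 : ℤ) 1).filter fun z => ∑ i, |z i| = 1

theorem mem_unitSteps {d : ℕ} {z : Site d} : z ∈ unitSteps d ↔ ∑ i, |z i| = 1 := by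
  simp only [unitSteps, Finset.mem_filter, Fintype.mem_piFinset, Finset.mem_Icc,
    and_iff_right_iff_imp]
  intro h i
  rw [← abs_le, ← h]
  exact Finset.single_le_sum (f := fun j => |z j|) (fun j _ => abs_nonneg _) (Finset.mem_univ i)

theorem unitSteps_nonempty {d : ℕ} (hd : 0 < d) : (unitSteps d).Nonempty := by
  refine ⟨Pi.single ⟨0, hd⟩ 1, mem_unitSteps.2 ?_⟩
  rw [Finset.sum_eq_single (⟨0, hd⟩ : Fin d)]
  · simp
  · intro j _ hj
    simp [Pi.single_eq_of_ne hj]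
  · simp

open Classical in
/-- The law of one step of simple random walk on `ℤ^d`: uniform on the `2d` neighbours of the
origin. (For `d = 0` there is no neighbour, and the walk does not move.) -/
def stepLaw (d : ℕ) : Measure (Site d) :=
  (if h : (unitSteps d).Nonempty then PMF.uniformOfFinset (unitSteps d) h
    else PMF.pure 0).toMeasure

instance (d : ℕ) : IsProbabilityMeasure (stepLaw d) := by
  unfold stepLaw; infer_instance

open Classical in
/-- The law of the lifetime `Ξ` of a particle: `P[Ξ = k] = (1 - p) p ^ (k - 1)` for
`k = 1, 2, …` if `p < 1`, and `Ξ = ∞` if `p = 1`. Mathlib's `geometricMeasure q` gives mass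
`(1 - q) ^ n * q` to `n = 0, 1, …`; here `q = 1 - p`, shifted by one. -/
def lifetimeLaw (p : unitInterval) : Measure ℕ∞ :=
  if p = 1 then Measure.dirac ⊤
  else (geometricMeasure (unitInterval.symm p)).map fun n : ℕ => ((n + 1 : ℕ) : ℕ∞)

instance (p : unitInterval) : IsProbabilityMeasure (lifetimeLaw p) := by
  unfold lifetimeLaw
  split_ifs
  · infer_instance
  · exact Measure.isProbabilityMeasure_map (by fun_prop)

/-- A realization of all the randomness of the frog model on `ℤ^d`: the numbers `η(x)` of
particles, the successive steps of the walk of each particle `(x, i)`, and the lifetime of each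
particle `(x, i)`. Particles at `x` are numbered `i = 0, 1, …`; those with `i < η(x)` exist. -/
abbrev Config (d : ℕ) : Type :=
  (Site d → ℕ) × (Site d × ℕ → ℕ → Site d) × (Site d × ℕ → ℕ∞)

/-- The law of the frog model on `ℤ^d` with survival parameter `p` and with `η` of law `ν`: all
the variables `η(x)`, all the steps and all the lifetimes are independent. -/
def frogLaw (d : ℕ) (p : unitInterval) (ν : Measure ℕ) [IsProbabilityMeasure ν] :
    Measure (Config d) :=
  (Measure.infinitePi fun _ : Site d => ν).prod
    ((Measure.infinitePi fun _ : Site d × ℕ => Measure.infinitePi fun _ : ℕ => stepLaw d).prod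
      (Measure.infinitePi fun _ : Site d × ℕ => lifetimeLaw p))

variable {d : ℕ}

/-- The initial number `η(x)` of particles at `x`. -/
def count (ω : Config d) (x : Site d) : ℕ := ω.1 x

/-- The position `S_n^x(i)`, `n` steps after activation, of the `i`-th particle from `x`. -/
def walk (ω : Config d) (x : Site d) (i n : ℕ) : Site d := x + ∑ k ∈ Finset.range n, ω.2.1 (x, i) k

/-- The lifetime `Ξ^x(i)` of the `i`-th particle from `x`. -/
def lifetime (ω : Config d) (x : Site d) (i : ℕ) : ℕ∞ := ω.2.2 (x, i)

/-- `t(x, y)`: the least `n` such that some particle from `x` is at `y`, still alive, `n` steps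
after activation; infinite if there is none. -/
def passageTime (ω : Config d) (x y : Site d) : ℕ∞ :=
  ⨅ (i : ℕ) (_ : i < count ω x) (n : ℕ) (_ : (n : ℕ∞) < lifetime ω x i ∧ walk ω x i n = y),
    (n : ℕ∞)

/-- `T(x)`: the moment when the particles at `x` are awakened, that is, the infimum of
`t(x_0, x_1) + ⋯ + t(x_{m-1}, x_m)` over the finite sequences `0 = x_0, x_1, …, x_m = x`. -/
def activationTime (ω : Config d) (x : Site d) : ℕ∞ :=
  ⨅ (m : ℕ) (s : ℕ → Site d) (_ : s 0 = 0 ∧ s m = x),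
    ∑ j ∈ Finset.range m, passageTime ω (s j) (s (j + 1))

/-- The `i`-th particle from `x` exists, has been activated by time `n`, and is still alive. -/
def IsActive (ω : Config d) (n : ℕ) (x : Site d) (i : ℕ) : Prop :=
  i < count ω x ∧ activationTime ω x ≤ n ∧ (n : ℕ∞) < activationTime ω x + lifetime ω x i

/-- At every instant of time there is at least one active particle. -/
def Survives (ω : Config d) : Prop := ∀ n : ℕ, ∃ x i, IsActive ω n x i

/-- The critical parameter `p_c(ℤ^d, η)`, where `ν` is the law of `η`. -/
def criticalParam (d : ℕ) (ν : Measure ℕ) [IsProbabilityMeasure ν] : ℝ :=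
  sInf {p : ℝ | ∃ hp : p ∈ Set.Icc (0 : ℝ) 1, 0 < frogLaw d ⟨p, hp⟩ ν {ω | Survives ω}}

end Frog

end

/-! Write m = Eη and draw an arrow x → y when some particle from x visits y during its life. A site
is activated exactly when a chain of arrows leads to it from the origin (`reachable_iff`), and when
all lifetimes are finite, survival means that infinitely many sites are activated. A particle lives
for more than n steps with probability p ^ n, so a site points on average to at most m p / (1 - p)
other sites, and this number is less than 1 exactly when p (1 + m) < 1. In high dimension walks
hardly ever collide, so the process resembles a branching process with that mean.

Lower bound, in every dimension. The data of different sites are independent. Along self-avoiding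
chains each arrow reads a fresh site, so the expected number of endpoints of chains of n arrows is
at most λ ^ n with λ = m p / (1 - p) (`tsum_avoidingPath_le`). For λ < 1 the sum over n is finite:
almost surely finitely many sites are activated, and the process dies out
(`frogLaw_survives_eq_zero`).

Upper bound, for fixed p between 1 / (1 + m) and 1. Two blocks of q coordinates, with q / d small,
define a map from ℤ^d to ℤ² by summing the coordinates of each block; its fibres are the layers.
Steps in the remaining coordinates stay in the layer. If only K particles per site and K such steps
per particle are used, the mean offspring inside a layer still exceeds 1. From M sites, the
exploration of a layer therefore grows geometrically for L generations, up to a Chebyshev error and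
collisions of probability O(1/d) (`measure_found_lt_le`); single steps then produce M sites in each
of the layers z + (1, 0) and z + (0, 1). Since K, L and M are chosen before d, a layer fails with
probability at most 128⁻⁴.

Distinct layers use disjoint sets of sites, so all layers of a finite set T fail with probability at
most ε ^ |T| if one fails with probability at most ε (`measure_forall_fails_le`). If only finitely
many layers are reached, a contour of some length n passes at least n / 4 failed layers
(`exists_contour`); by Peierls counting this has probability at most 1/4. Hence infinitely many
sites are reached with positive probability, and translation invariance moves the starting point to
the origin. -/

namespace MeasureTheory.Measure

open scoped ENNReal

/-! ### Independence and adaptedness in product measures -/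

section Glue

variable {ι : Type*} {X : ι → Type*} [∀ i, MeasurableSpace (X i)]

open Classical in
/-- The configuration equal to `q.1` on `S` and to `q.2` off `S`. -/
noncomputable def glue (S : Set ι) (q : (Π i, X i) × (Π i, X i)) : Π i, X i :=
  fun i => if i ∈ S then q.1 i else q.2 i

theorem measurable_glue (S : Set ι) : Measurable (glue (X := X) S) := by
  refine measurable_pi_lambda _ fun i => ?_
  by_cases h : i ∈ S
  · simp only [glue, h, if_true]; fun_prop
  · simp only [glue, h, if_false]; fun_prop

variable (P : (i : ι) → Measure (X i)) [∀ i, IsProbabilityMeasure (P i)]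

/-- Mixing two independent copies along S changes nothing, because both measures agree on boxes.
With two copies at hand, independence of events on disjoint coordinates becomes the product formula
for a rectangle. -/
theorem map_glue_infinitePi (S : Set ι) :
    ((infinitePi P).prod (infinitePi P)).map (glue S) = infinitePi P := by
  classical
  refine eq_infinitePi _ fun s t ht => ?_
  rw [map_apply (measurable_glue S) (MeasurableSet.pi s.countable_toSet fun i _ => ht i)]
  have : glue S ⁻¹' ((s : Set ι).pi t)
      = (((s.filter (· ∈ S) : Finset ι) : Set ι).pi t)
        ×ˢ (((s.filter (· ∉ S) : Finset ι) : Set ι).pi t) := by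
    ext q
    simp only [Set.mem_preimage, Set.mem_pi, Finset.mem_coe, glue, Set.mem_prod,
      Finset.mem_filter]
    constructor
    · intro h
      exact ⟨fun i hi => by simpa [hi.2] using h i hi.1, fun i hi => by simpa [hi.2] using h i hi.1⟩
    · rintro ⟨h1, h2⟩ i hi
      by_cases hS : i ∈ S
      · simpa [hS] using h1 i ⟨hi, hS⟩
      · simpa [hS] using h2 i ⟨hi, hS⟩
  rw [this, prod_prod, infinitePi_pi _ fun i _ => ht i, infinitePi_pi _ fun i _ => ht i,
    Finset.prod_filter_mul_prod_filter_not]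

/-- Events depending on disjoint sets of coordinates are independent. -/
theorem infinitePi_inter_of_dependsOn {A B : Set (Π i, X i)} (mA : MeasurableSet A)
    (mB : MeasurableSet B) {S T : Set ι} (hST : Disjoint S T)
    (hA : DependsOn (· ∈ A) S) (hB : DependsOn (· ∈ B) T) :
    infinitePi P (A ∩ B) = infinitePi P A * infinitePi P B := by
  -- On a glued configuration A reads only the first copy and B only the second.
  have hpre : glue S ⁻¹' (A ∩ B) = A ×ˢ B := by
    ext q
    have h1 : (glue S q ∈ A) = (q.1 ∈ A) := hA fun i hi => by simp [glue, hi]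
    have h2 : (glue S q ∈ B) = (q.2 ∈ B) := hB fun i hi => by
      have : i ∉ S := fun h => Set.disjoint_left.1 hST h hi
      simp [glue, this]
    simp only [Set.mem_preimage, Set.mem_inter_iff, Set.mem_prod, h1, h2]
  conv_lhs => rw [← map_glue_infinitePi P S]
  rw [map_apply (measurable_glue S) (mA.inter mB), hpre, prod_prod]

/-- If, given the value `c` of a discrete variable `g` on the event `Q`, the event `Bad c` involves
only coordinates that have not been looked at, then it has its unconditional probability. -/
theorem infinitePi_inter_adapted_le {T : Type*} [Countable T] {g : (Π i, X i) → T}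
    (hg : ∀ c, MeasurableSet {ω | g ω = c}) {Q : Set (Π i, X i)} (mQ : MeasurableSet Q)
    {Bad : T → Set (Π i, X i)} (mBad : ∀ c, MeasurableSet (Bad c)) (S U : T → Set ι) (δ : ℝ≥0∞)
    (h : ∀ c, (Q ∩ {ω | g ω = c}).Nonempty → Disjoint (S c) (U c) ∧
      DependsOn (· ∈ Q ∩ {ω | g ω = c}) (S c) ∧ DependsOn (· ∈ Bad c) (U c) ∧
      infinitePi P (Bad c) ≤ δ) :
    infinitePi P (Q ∩ {ω | ω ∈ Bad (g ω)}) ≤ δ * infinitePi P Q := by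
  have e1 : Q ∩ {ω | ω ∈ Bad (g ω)} = ⋃ c, (Q ∩ {ω | g ω = c}) ∩ Bad c := by
    ext ω; simp
  have e2 : Q = ⋃ c, (Q ∩ {ω | g ω = c}) := by
    ext ω; simp
  calc infinitePi P (Q ∩ {ω | ω ∈ Bad (g ω)})
      ≤ ∑' c, infinitePi P ((Q ∩ {ω | g ω = c}) ∩ Bad c) := by
        rw [e1]; exact measure_iUnion_le _
    _ ≤ ∑' c, δ * infinitePi P (Q ∩ {ω | g ω = c}) := by
        refine ENNReal.tsum_le_tsum fun c => ?_
        -- Values of g that do not occur on Q contribute nothing, so `h` is needed only for values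
        -- that do.
        rcases (Q ∩ {ω | g ω = c}).eq_empty_or_nonempty with h0 | h0
        · simp [h0]
        · obtain ⟨h1, h2, h3, h4⟩ := h c h0
          rw [infinitePi_inter_of_dependsOn P (mQ.inter (hg c)) (mBad c) h1 h2 h3, mul_comm]
          gcongr
    _ = δ * infinitePi P Q := by
        rw [ENNReal.tsum_mul_left]
        conv_rhs => rw [e2]
        rw [measure_iUnion _ fun c => mQ.inter (hg c)]
        intro c c' hcc
        refine Set.disjoint_left.2 fun ω h1 h2 => hcc (h1.2.symm.trans h2.2)

end Glue

section Zip

variable {ι : Type*} {X Y : ι → Type*} [∀ i, MeasurableSpace (X i)] [∀ i, MeasurableSpace (Y i)]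
  (P : (i : ι) → Measure (X i)) [∀ i, IsProbabilityMeasure (P i)]
  (Q : (i : ι) → Measure (Y i)) [∀ i, IsProbabilityMeasure (Q i)]

/-- A product of products is the product of the two product measures. -/
theorem infinitePi_prod_map_unzip :
    (infinitePi fun i => (P i).prod (Q i)).map (fun f => (fun i => (f i).1, fun i => (f i).2))
      = (infinitePi P).prod (infinitePi Q) := by
  classical
  have hm : Measurable fun f : (Π i, X i × Y i) => (fun i => (f i).1, fun i => (f i).2) := by
    fun_prop
  have : IsProbabilityMeasure ((infinitePi fun i => (P i).prod (Q i)).map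
    (fun f => (fun i => (f i).1, fun i => (f i).2))) := isProbabilityMeasure_map hm.aemeasurable
  symm
  refine prod_eq_generateFrom (C := squareCylinders fun i => {s : Set (X i) | MeasurableSet s})
    (D := squareCylinders fun i => {s : Set (Y i) | MeasurableSet s})
    generateFrom_squareCylinders generateFrom_squareCylinders
    (isPiSystem_squareCylinders (fun i => MeasurableSpace.isPiSystem_measurableSet)
      fun _ => MeasurableSet.univ)
    (isPiSystem_squareCylinders (fun i => MeasurableSpace.isPiSystem_measurableSet)
      fun _ => MeasurableSet.univ)
    ⟨fun _ => Set.univ, fun _ => ⟨∅, fun _ => Set.univ, fun _ _ => MeasurableSet.univ, by simp⟩,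
      fun _ => measure_lt_top _ _, Set.iUnion_const _⟩
    ⟨fun _ => Set.univ, fun _ => ⟨∅, fun _ => Set.univ, fun _ _ => MeasurableSet.univ, by simp⟩,
      fun _ => measure_lt_top _ _, Set.iUnion_const _⟩ ?_
  rintro _ ⟨s, t, ht, rfl⟩ _ ⟨s', t', ht', rfl⟩
  have ht : ∀ i, MeasurableSet (t i) := fun i => ht i (Set.mem_univ i)
  have ht' : ∀ i, MeasurableSet (t' i) := fun i => ht' i (Set.mem_univ i)
  rw [map_apply hm ((MeasurableSet.pi s.countable_toSet fun i _ => ht i).prod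
    (MeasurableSet.pi s'.countable_toSet fun i _ => ht' i))]
  have hpre : (fun f : (Π i, X i × Y i) => ((fun i => (f i).1 : Π i, X i), fun i => (f i).2)) ⁻¹'
      ((s : Set ι).pi t ×ˢ (s' : Set ι).pi t') = ((s ∪ s' : Finset ι) : Set ι).pi fun i =>
        (if i ∈ s then t i else Set.univ) ×ˢ (if i ∈ s' then t' i else Set.univ) := by
    ext f
    simp only [Set.mem_preimage, Set.mem_prod, Set.mem_pi, Finset.mem_coe, Finset.mem_union]
    constructor
    · rintro ⟨h1, h2⟩ i -
      constructor
      · split_ifs with h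
        exacts [h1 i h, trivial]
      · split_ifs with h
        exacts [h2 i h, trivial]
    · intro h
      exact ⟨fun i hi => by simpa [hi] using (h i (Or.inl hi)).1,
        fun i hi => by simpa [hi] using (h i (Or.inr hi)).2⟩
  rw [hpre, infinitePi_pi, infinitePi_pi _ fun i _ => ht i, infinitePi_pi _ fun i _ => ht' i]
  · simp only [prod_prod, Finset.prod_mul_distrib]
    congr 1
    · rw [← Finset.prod_subset (Finset.subset_union_left (s₁ := s) (s₂ := s'))]
      · exact Finset.prod_congr rfl fun i hi => by simp [hi]
      · intro i _ hi; simp [hi]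
    · rw [← Finset.prod_subset (Finset.subset_union_right (s₁ := s) (s₂ := s'))]
      · exact Finset.prod_congr rfl fun i hi => by simp [hi]
      · intro i _ hi; simp [hi]
  · intro i _
    refine MeasurableSet.prod ?_ ?_
    · split_ifs
      exacts [ht i, MeasurableSet.univ]
    · split_ifs
      exacts [ht' i, MeasurableSet.univ]

end Zip

end MeasureTheory.Measure

/-! ### Simple paths and a comparison of finite sums -/

/-- A vertex reachable from `a` is reached by a path without repetitions. -/
theorem Relation.ReflTransGen.exists_injOn_path {α : Type*} {R : α → α → Prop} {a : α} {T : Set α}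
    (h : ∃ b ∈ T, Relation.ReflTransGen R a b) :
    ∃ (n : ℕ) (f : ℕ → α), f 0 = a ∧ f n ∈ T ∧ (∀ i < n, R (f i) (f (i + 1))) ∧
      Set.InjOn f (Set.Iic n) := by
  classical
  have hex : ∃ (n : ℕ), ∃ f : ℕ → α, f 0 = a ∧ f n ∈ T ∧ ∀ i < n, R (f i) (f (i + 1)) := by
    obtain ⟨b, hb, hab⟩ := h
    have : ∀ c, Relation.ReflTransGen R a c →
        ∃ (n : ℕ), ∃ f : ℕ → α, f 0 = a ∧ f n = c ∧ ∀ i < n, R (f i) (f (i + 1)) := by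
      intro c hc
      induction hc with
      | refl => exact ⟨0, fun _ => a, rfl, rfl, by simp⟩
      | @tail x y _ hxy ih =>
        obtain ⟨n, f, h0, hn, hf⟩ := ih
        refine ⟨n + 1, fun i => if i ≤ n then f i else y, by simp [h0], by simp, ?_⟩
        intro i hi
        rcases Nat.lt_succ_iff_lt_or_eq.1 hi with hi | rfl
        · have h1 : i + 1 ≤ n := hi
          simpa [hi.le, h1] using hf i hi
        · simpa [hn] using hxy
    obtain ⟨n, f, h0, hn, hf⟩ := this b hab
    exact ⟨n, f, h0, hn ▸ hb, hf⟩
  obtain ⟨f, h0, hn, hf⟩ := Nat.find_spec hex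
  set n := Nat.find hex with hndef
  have key : ∀ i j, i < j → j ≤ n → f i ≠ f j := by
    intro i j hij hj heq
    -- The path has minimal length; cutting out the loop between two visits to the same vertex would
    -- shorten it.
    have : n - (j - i) < Nat.find hex := by omega
    refine Nat.find_min hex this ⟨fun t => if t ≤ i then f t else f (t + (j - i)), by simp [h0],
      ?_, ?_⟩
    · by_cases h1 : n - (j - i) ≤ i
      · have h2 : n = j := by omega
        have h3 : n - (j - i) = i := by omega
        simp only [h3, le_refl, if_true]
        rw [heq, ← h2]; exact hn
      · simp only [h1, if_false]
        have : n - (j - i) + (j - i) = n := by omega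
        rw [this]; exact hn
    · intro t ht
      rcases lt_trichotomy t i with h1 | h1 | h1
      · have h2 : t + 1 ≤ i := h1
        simpa [h1.le, h2] using hf t (by omega)
      · subst h1
        have h2 : t + 1 + (j - t) = j + 1 := by omega
        simp only [le_refl, if_true, heq, Nat.not_succ_le_self, if_false, h2]
        exact hf j (by omega)
      · have h2 : ¬ t ≤ i := by omega
        have h3 : ¬ t + 1 ≤ i := by omega
        have h4 : t + 1 + (j - i) = t + (j - i) + 1 := by omega
        simp only [h2, h3, if_false, h4]
        exact hf _ (by omega)
  refine ⟨n, f, h0, hn, hf, ?_⟩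
  intro i hi j hj hij
  by_contra hne
  rcases lt_or_gt_of_ne hne with h | h
  · exact key i j h hj hij
  · exact key j i h hi hij.symm

/-- Common terms cancel. It will express that no flow leaves a set closed under contour steps, R and
R' being the sets of tails of the edges that start, respectively end, in that set. -/
theorem Finset.sum_le_sum_of_sdiff {α : Type*} [DecidableEq α] {R R' : Finset α} {J : α → ℤ}
    (h1 : ∀ u ∈ R, u ∉ R' → J u ≤ 0) (h2 : ∀ u ∈ R', u ∉ R → 0 ≤ J u) :
    ∑ u ∈ R, J u ≤ ∑ u ∈ R', J u := by
  have := Finset.sum_sdiff_sub_sum_sdiff (s₁ := R') (s₂ := R) (f := J)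
  have a1 : ∑ u ∈ R \ R', J u ≤ 0 := Finset.sum_nonpos fun u hu => by
    rw [Finset.mem_sdiff] at hu; exact h1 u hu.1 hu.2
  have a2 : 0 ≤ ∑ u ∈ R' \ R, J u := Finset.sum_nonneg fun u hu => by
    rw [Finset.mem_sdiff] at hu; exact h2 u hu.1 hu.2
  linarith

namespace Frog

/-! ### Contours in the quadrant

The dual vertex `v = (a, b)` stands for the point `(a - 1/2, b - 1/2)`. Contours keep the set `W`
on their left-hand side. -/

/-- The four directions of a dual step: up, left, down, right. -/
def contourDir : Fin 4 → ℤ × ℤ := ![(0, 1), (-1, 0), (0, -1), (1, 0)]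

/-- A step of a contour of `W`. -/
inductive ContourStep (W : Set (ℤ × ℤ)) (v : ℤ × ℤ) : ℤ × ℤ → Prop
  | up : v - (1, 0) ∈ W → v ∉ W → ContourStep W v (v + (0, 1))
  | left : v - (1, 1) ∈ W → v - (1, 0) ∉ W → ContourStep W v (v - (1, 0))
  | down : v - (0, 1) ∈ W → v - (1, 1) ∉ W → ContourStep W v (v - (0, 1))
  | right : v ∈ W → v - (0, 1) ∉ W → 1 ≤ v.2 → ContourStep W v (v + (1, 0))

variable {W : Set (ℤ × ℤ)}

theorem ContourStep.nonneg (hpos : ∀ z ∈ W, 0 ≤ z.1 ∧ 0 ≤ z.2) {v v' : ℤ × ℤ}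
    (h : ContourStep W v v') (hv : 0 ≤ v.1 ∧ 0 ≤ v.2) : 0 ≤ v'.1 ∧ 0 ≤ v'.2 := by
  cases h with
  | up h1 h2 => have := hpos _ h1; simp at *; omega
  | left h1 h2 => have := hpos _ h1; simp at *; omega
  | down h1 h2 => have := hpos _ h1; simp at *; omega
  | right h1 h2 h3 => have := hpos _ h1; simp at *; omega

theorem reachable_contour_nonneg (hpos : ∀ z ∈ W, 0 ≤ z.1 ∧ 0 ≤ z.2) {s v : ℤ × ℤ}
    (hs : 0 ≤ s.1 ∧ 0 ≤ s.2) (h : Relation.ReflTransGen (ContourStep W) s v) :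
    0 ≤ v.1 ∧ 0 ≤ v.2 := by
  induction h with
  | refl => exact hs
  | tail _ hxy ih => exact hxy.nonneg hpos ih

/-- The endpoint of every step is a corner of a site of W, so only the start may lie away from W. -/
theorem finite_reachable_contour (hfin : W.Finite) (s : ℤ × ℤ) :
    {v | Relation.ReflTransGen (ContourStep W) s v}.Finite := by
  have : {v | Relation.ReflTransGen (ContourStep W) s v} ⊆ {s} ∪ ((fun z => z + (1, 1)) '' W ∪
      (fun z => z + (0, 1)) '' W ∪ W ∪ (fun z => z + (1, 0)) '' W) := by
    intro v hv
    rcases Relation.ReflTransGen.cases_tail hv with h | ⟨u, -, hu⟩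
    · exact Or.inl h
    · right
      cases hu with
      | up h1 h2 => exact Or.inl (Or.inl (Or.inl ⟨_, h1, by ext <;> simp⟩))
      | left h1 h2 => exact Or.inl (Or.inl (Or.inr ⟨_, h1, by ext <;> simp⟩))
      | down h1 h2 => exact Or.inl (Or.inr h1)
      | right h1 h2 h3 => exact Or.inr ⟨_, h1, rfl⟩
  refine Set.Finite.subset ?_ this
  exact (Set.finite_singleton s).union ((((hfin.image _).union (hfin.image _)).union hfin).union
    (hfin.image _))

/-- The contour that starts at the right end of the bottom row of `W` reaches the vertical axis:
the flow along the boundary of `W` has no other sink. -/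
theorem exists_reachable_axis (hfin : W.Finite) (hpos : ∀ z ∈ W, 0 ≤ z.1 ∧ 0 ≤ z.2)
    (hpred : ∀ z ∈ W, z ≠ 0 → z - (1, 0) ∈ W ∨ z - (0, 1) ∈ W) {s : ℤ × ℤ} (hs1 : 0 ≤ s.1)
    (hs2 : s.2 = 0) (hsW : s ∉ W) (hsW' : s - (1, 0) ∈ W) :
    ∃ v ∈ {v : ℤ × ℤ | v.1 = 0}, Relation.ReflTransGen (ContourStep W) s v := by
  classical
  by_contra hcon
  push Not at hcon
  set R := (finite_reachable_contour hfin s).toFinset with hR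
  have memR : ∀ v, v ∈ R ↔ Relation.ReflTransGen (ContourStep W) s v := by simp [hR]
  have hRpos : ∀ v ∈ R, 1 ≤ v.1 ∧ 0 ≤ v.2 := by
    intro v hv
    have h1 := reachable_contour_nonneg hpos ⟨hs1, hs2.ge⟩ ((memR v).1 hv)
    have h2 : v.1 ≠ 0 := fun h => hcon v h ((memR v).1 hv)
    omega
  have step : ∀ v ∈ R, ∀ v', ContourStep W v v' → v' ∈ R := fun v hv v' h =>
    (memR v').2 (((memR v).1 hv).tail h)
  let w : ℤ × ℤ → ℤ := fun z => if z ∈ W then 1 else 0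
  have w1 : ∀ z, z ∈ W → w z = 1 := fun z hz => if_pos hz
  have w0 : ∀ z, z ∉ W → w z = 0 := fun z hz => if_neg hz
  have wnn : ∀ z, 0 ≤ w z := fun z => by simp only [w]; split_ifs <;> simp
  have wle : ∀ z, w z ≤ 1 := fun z => by simp only [w]; split_ifs <;> simp
  -- `Ju v` and `Jr v` are the net flows through the edges from v upward and to the right: 1 if the
  -- contour may follow the edge in that direction, -1 if in the opposite one. The bottom side of
  -- the quadrant carries no flow, just as `ContourStep.right` excludes it.
  let Ju : ℤ × ℤ → ℤ := fun v => w (v - (1, 0)) - w v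
  let Jr : ℤ × ℤ → ℤ := fun v => if 1 ≤ v.2 then w v - w (v - (0, 1)) else 0
  -- The divergence vanishes identically in the rows b ≥ 1. In row 0 it is w (a - 1, 0) - w (a, 0),
  -- which is nonnegative because (a - 1, 0) is the only possible predecessor of (a, 0) when a ≥ 1;
  -- at s it equals 1.
  have hdiv : ∀ v ∈ R, 0 ≤ Ju v - Ju (v - (0, 1)) + (Jr v - Jr (v - (1, 0))) := by
    rintro ⟨a, b⟩ hv
    have hp := hRpos _ hv
    simp only at hp
    rcases hp.2.lt_or_eq with hb | hb
    · have hb' : 1 ≤ b := hb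
      simp only [Ju, Jr, Prod.mk_sub_mk, sub_zero, hb', if_true]
      linarith
    · subst hb
      have h1 : w (a, -1) = 0 := w0 _ fun h => by have := hpos _ h; simp at this
      have h2 : w (a - 1, -1) = 0 := w0 _ fun h => by have := hpos _ h; simp at this
      simp only [Ju, Jr, Prod.mk_sub_mk, sub_zero, zero_sub, h1, h2]
      norm_num
      by_cases haW : ((a, 0) : ℤ × ℤ) ∈ W
      · have : ((a, 0) : ℤ × ℤ) ≠ 0 := by
          intro h; rw [Prod.mk_eq_zero] at h; omega
        rcases hpred _ haW this with h | h
        · simp at h; rw [w1 _ haW, w1 _ h]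
        · have := hpos _ h; simp at this
      · rw [w0 _ haW]; exact wnn _
  have hsR : s ∈ R := (memR s).2 .refl
  have hdivs : 1 ≤ Ju s - Ju (s - (0, 1)) + (Jr s - Jr (s - (1, 0))) := by
    obtain ⟨a, b⟩ := s
    simp only at hs2
    subst hs2
    have h1 : w (a, -1) = 0 := w0 _ fun h => by have := hpos _ h; simp at this
    have h2 : w (a - 1, -1) = 0 := w0 _ fun h => by have := hpos _ h; simp at this
    have h3 := w0 _ hsW
    have h4 := w1 _ hsW'
    simp only [Prod.mk_sub_mk, sub_zero] at h4
    simp [Ju, Jr, h1, h2, h3, h4]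
  have hsum : 1 ≤ ∑ v ∈ R, (Ju v - Ju (v - (0, 1)) + (Jr v - Jr (v - (1, 0)))) :=
    hdivs.trans (Finset.single_le_sum hdiv hsR)
  rw [Finset.sum_add_distrib, Finset.sum_sub_distrib Ju, Finset.sum_sub_distrib Jr] at hsum
  have inj1 : Function.Injective fun v : ℤ × ℤ => v - (0, 1) := sub_left_injective
  have inj2 : Function.Injective fun v : ℤ × ℤ => v - (1, 0) := sub_left_injective
  have i1 : ∑ v ∈ R, Ju (v - (0, 1)) = ∑ u ∈ R.image (fun v => v - (0, 1)), Ju u := by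
    rw [Finset.sum_image fun x _ y _ h => inj1 h]
  have i2 : ∑ v ∈ R, Jr (v - (1, 0)) = ∑ u ∈ R.image (fun v => v - (1, 0)), Jr u := by
    rw [Finset.sum_image fun x _ y _ h => inj2 h]
  -- R is closed under steps, so no flow crosses its boundary outward and the total divergence over
  -- R is at most 0, against `hsum`.
  have c1 : ∑ v ∈ R, Ju v ≤ ∑ v ∈ R, Ju (v - (0, 1)) := by
    rw [i1]
    refine Finset.sum_le_sum_of_sdiff ?_ ?_
    · intro u hu hu'
      by_contra! hJ
      have a1 : u - (1, 0) ∈ W := by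
        by_contra h; simp only [Ju, w0 _ h] at hJ; linarith [wnn u]
      have a2 : u ∉ W := by
        intro h; simp only [Ju, w1 _ h] at hJ; linarith [wle (u - (1, 0))]
      exact hu' (Finset.mem_image.2 ⟨u + (0, 1), step u hu _ (.up a1 a2), by simp⟩)
    · intro u hu hu'
      by_contra! hJ
      obtain ⟨v, hv, rfl⟩ := Finset.mem_image.1 hu
      have a1 : v - (0, 1) ∈ W := by
        by_contra h; simp only [Ju, w0 _ h] at hJ; linarith [wnn (v - (0, 1) - (1, 0))]
      have a2 : v - (1, 1) ∉ W := by
        intro h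
        have h : v - (0, 1) - (1, 0) ∈ W := by convert h using 1; ext <;> simp
        simp only [Ju, w1 _ h] at hJ; linarith [wle (v - (0, 1))]
      exact hu' (step v hv _ (.down a1 a2))
  have c2 : ∑ v ∈ R, Jr v ≤ ∑ v ∈ R, Jr (v - (1, 0)) := by
    rw [i2]
    refine Finset.sum_le_sum_of_sdiff ?_ ?_
    · intro u hu hu'
      by_contra! hJ
      have a0 : 1 ≤ u.2 := by by_contra h; simp [Jr, h] at hJ
      simp only [Jr, a0, if_true] at hJ
      have a1 : u ∈ W := by
        by_contra h; rw [w0 _ h] at hJ; linarith [wnn (u - (0, 1))]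
      have a2 : u - (0, 1) ∉ W := by
        intro h; rw [w1 _ h] at hJ; linarith [wle u]
      exact hu' (Finset.mem_image.2 ⟨u + (1, 0), step u hu _ (.right a1 a2 a0), by simp⟩)
    · intro u hu hu'
      by_contra! hJ
      obtain ⟨v, hv, rfl⟩ := Finset.mem_image.1 hu
      have a0 : 1 ≤ (v - (1, 0)).2 := by by_contra h; simp only [Jr, h, if_false] at hJ; omega
      simp only [Jr, a0, if_true] at hJ
      have a1 : v - (1, 1) ∈ W := by
        by_contra h
        have h : v - (1, 0) - (0, 1) ∉ W := by convert h using 2; ext <;> simp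
        rw [w0 _ h] at hJ; linarith [wnn (v - (1, 0))]
      have a2 : v - (1, 0) ∉ W := by
        intro h; rw [w1 _ h] at hJ; linarith [wle (v - (1, 0) - (0, 1))]
      exact hu' (step v hv _ (.left a1 a2))
  linarith

/-- The `i`-th vertex of the dual path that starts at `(k + 1, 0)` and has directions `w`. -/
def contourVertex (k : ℕ) {n : ℕ} (w : Fin n → Fin 4) (i : ℕ) : ℤ × ℤ :=
  ((k : ℤ) + 1, 0) + ∑ j ∈ Finset.range i, if h : j < n then contourDir (w ⟨j, h⟩) else 0

/-- The sites on the left of the upward and leftward steps of a dual path. -/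
def contourExits (k : ℕ) {n : ℕ} (w : Fin n → Fin 4) : Finset (ℤ × ℤ) :=
  ((Finset.univ.filter fun i => w i = 0).image fun i : Fin n => contourVertex k w i - (1, 0)) ∪
  ((Finset.univ.filter fun i => w i = 1).image fun i : Fin n => contourVertex k w i - (1, 1))

/-- An upward or leftward step separates a site of W from its right or upper neighbour outside W. At
least half of the steps are of these kinds, and on a simple contour a site is counted at most once
for each kind, whence the factor 4. The bound k < n holds because the contour has to go from
abscissa k + 1 to 0; it limits the number of contours of length n to n * 4 ^ n. -/
theorem exists_contour (hfin : W.Finite) (h0 : (0 : ℤ × ℤ) ∈ W)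
    (hpos : ∀ z ∈ W, 0 ≤ z.1 ∧ 0 ≤ z.2)
    (hpred : ∀ z ∈ W, z ≠ 0 → z - (1, 0) ∈ W ∨ z - (0, 1) ∈ W) :
    ∃ n k : ℕ, k < n ∧ ∃ w : Fin n → Fin 4, n ≤ 4 * (contourExits k w).card ∧
      ∀ z ∈ contourExits k w, z ∈ W ∧ (z + (1, 0) ∉ W ∨ z + (0, 1) ∉ W) := by
  classical
  obtain ⟨k, hk, hk'⟩ : ∃ k : ℕ, (((k : ℤ), 0) : ℤ × ℤ) ∈ W ∧ (((k : ℤ) + 1, 0) : ℤ × ℤ) ∉ W := by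
    by_contra! hcon
    have hall : ∀ k : ℕ, (((k : ℤ), 0) : ℤ × ℤ) ∈ W := by
      intro k
      induction k with
      | zero => exact h0
      | succ k ih => push_cast; exact hcon k ih
    refine Set.infinite_of_injective_forall_mem (f := fun k : ℕ => (((k : ℤ), 0) : ℤ × ℤ)) ?_ hall
      hfin
    intro a b hab
    simpa using hab
  obtain ⟨n, f, hf0, hfn, hstep, hinj⟩ := Relation.ReflTransGen.exists_injOn_path
    (exists_reachable_axis hfin hpos hpred (s := ((k : ℤ) + 1, 0)) (by simp; omega) rfl hk'
      (by simpa using hk))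
  have hdir : ∀ i : Fin n, ∃ c : Fin 4, f (i + 1) = f i + contourDir c ∧
      (c = 0 → f i - (1, 0) ∈ W ∧ f i ∉ W) ∧ (c = 1 → f i - (1, 1) ∈ W ∧ f i - (1, 0) ∉ W) := by
    intro i
    have := hstep i i.2
    generalize f (i + 1) = y at this
    cases this with
    | up h1 h2 => exact ⟨0, rfl, fun _ => ⟨h1, h2⟩, by simp⟩
    | left h1 h2 => exact ⟨1, by ext <;> simp [contourDir, sub_eq_add_neg], by simp,
        fun _ => ⟨h1, h2⟩⟩
    | down h1 h2 => exact ⟨2, by ext <;> simp [contourDir, sub_eq_add_neg], by simp, by simp⟩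
    | right h1 h2 h3 => exact ⟨3, by ext <;> simp [contourDir], by simp, by simp⟩
  choose w hw hup hleft using hdir
  have hvert : ∀ i ≤ n, contourVertex k w i = f i := by
    intro i hi
    rw [contourVertex, ← hf0]
    have : ∑ j ∈ Finset.range i, (if h : j < n then contourDir (w ⟨j, h⟩) else 0)
        = ∑ j ∈ Finset.range i, (f (j + 1) - f j) := by
      refine Finset.sum_congr rfl fun j hj => ?_
      have hj : j < n := (Finset.mem_range.1 hj).trans_le hi
      rw [dif_pos hj, hw ⟨j, hj⟩]; simp
    rw [this, Finset.sum_range_sub]; simp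
  have htele : ∀ i ≤ n, f i = f 0 + ∑ j ∈ Finset.range i, (f (j + 1) - f j) := by
    intro i _; rw [Finset.sum_range_sub]; simp
  have hsteps : ∀ i : Fin n, (f (i + 1)).1 = (f i).1 + (contourDir (w i)).1 ∧
      (f (i + 1)).2 = (f i).2 + (contourDir (w i)).2 := fun i => by rw [hw i]; simp
  have hfn2 : 0 ≤ (f n).2 := by
    have : ∀ i ≤ n, 0 ≤ (f i).1 ∧ 0 ≤ (f i).2 := by
      intro i
      induction i with
      | zero => intro _; rw [hf0]; simp; omega
      | succ i ih => intro hi; exact (hstep i hi).nonneg hpos (ih (by omega))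
    exact (this n le_rfl).2
  have hkn : k < n := by
    have : ∀ i ≤ n, (k : ℤ) + 1 - i ≤ (f i).1 := by
      intro i
      induction i with
      | zero => intro _; rw [hf0]; simp
      | succ i ih =>
        intro hi
        have h1 := ih (by omega)
        have h2 := (hsteps ⟨i, hi⟩).1
        have h3 : ∀ c, -1 ≤ (contourDir c).1 := by decide
        have := h3 (w ⟨i, hi⟩)
        simp only at h2
        push_cast; omega
    have h1 := this n le_rfl
    have h2 : (f n).1 = 0 := hfn
    omega
  -- Upward and leftward steps raise (ordinate - abscissa) by 1, the others lower it by 1; from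
  -- start to end it increases, since it passes from -(k + 1) to a nonnegative value.
  have hplus : n ≤ 2 * (Finset.univ.filter fun i => w i = 0 ∨ w i = 1).card := by
    have hh : ∑ i : Fin n, ((contourDir (w i)).2 - (contourDir (w i)).1)
        = ((f n).2 - (f n).1) - ((f 0).2 - (f 0).1) := by
      rw [← Finset.sum_range_sub fun i => (f i).2 - (f i).1,
        Finset.sum_range (fun i => (f (i + 1)).2 - (f (i + 1)).1 - ((f i).2 - (f i).1))]
      refine Finset.sum_congr rfl fun i _ => ?_
      have := hsteps i
      omega
    have hle : ∀ i : Fin n, (contourDir (w i)).2 - (contourDir (w i)).1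
        = 2 * (if w i = 0 ∨ w i = 1 then 1 else 0) - 1 := by
      intro i
      have : ∀ c : Fin 4, (contourDir c).2 - (contourDir c).1
        = 2 * (if c = 0 ∨ c = 1 then 1 else 0) - 1 := by decide
      exact this _
    rw [Finset.sum_congr rfl fun i _ => hle i, Finset.sum_sub_distrib, ← Finset.mul_sum,
      Finset.sum_boole] at hh
    have h2 : (f n).1 = 0 := hfn
    rw [hf0] at hh
    simp only [Finset.sum_const, Finset.card_univ, Fintype.card_fin, nsmul_eq_mul, mul_one] at hh
    have : (n : ℤ) ≤ 2 * ((Finset.univ.filter fun i => w i = 0 ∨ w i = 1).card : ℤ) := by omega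
    exact_mod_cast this
  refine ⟨n, k, hkn, w, ?_, ?_⟩
  · have e1 : (Finset.univ.filter fun i => w i = 0).card ≤ (contourExits k w).card := by
      rw [← Finset.card_image_of_injOn (s := Finset.univ.filter fun i => w i = 0)
        (f := fun i : Fin n => contourVertex k w i - (1, 0))]
      · exact Finset.card_le_card Finset.subset_union_left
      · intro i _ j _ hij
        simp only [hvert i i.2.le, hvert j j.2.le, sub_left_inj] at hij
        exact Fin.ext (hinj i.2.le j.2.le hij)
    have e2 : (Finset.univ.filter fun i => w i = 1).card ≤ (contourExits k w).card := by
      rw [← Finset.card_image_of_injOn (s := Finset.univ.filter fun i => w i = 1)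
        (f := fun i : Fin n => contourVertex k w i - (1, 1))]
      · exact Finset.card_le_card Finset.subset_union_right
      · intro i _ j _ hij
        simp only [hvert i i.2.le, hvert j j.2.le, sub_left_inj] at hij
        exact Fin.ext (hinj i.2.le j.2.le hij)
    have e3 : (Finset.univ.filter fun i => w i = 0 ∨ w i = 1).card
        ≤ (Finset.univ.filter fun i => w i = 0).card
          + (Finset.univ.filter fun i => w i = 1).card := by
      rw [Finset.filter_or]; exact Finset.card_union_le _ _
    omega
  · intro z hz
    rw [contourExits, Finset.mem_union, Finset.mem_image, Finset.mem_image] at hz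
    rcases hz with ⟨i, hi, rfl⟩ | ⟨i, hi, rfl⟩
    · rw [hvert i i.2.le]
      have := hup i (Finset.mem_filter.1 hi).2
      exact ⟨this.1, Or.inl (by simpa using this.2)⟩
    · rw [hvert i i.2.le]
      have := hleft i (Finset.mem_filter.1 hi).2
      refine ⟨this.1, Or.inr ?_⟩
      have e : f i - (1, 1) + (0, 1) = f i - (1, 0) := by ext <;> simp
      rw [e]; exact this.2

end Frog

/-! ### Exploration of a single layer -/

namespace Frog

open Measure
open scoped ENNReal

/-- A map (to a discrete space) all of whose fibres are measurable. -/
def MeasFib {Ω β : Type*} [MeasurableSpace Ω] (f : Ω → β) : Prop :=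
  ∀ c, MeasurableSet {ω | f ω = c}

section MeasFib

variable {Ω β γ : Type*} [MeasurableSpace Ω]

theorem measFib_const (b : β) : MeasFib fun _ : Ω => b := fun _ => MeasurableSet.const _

theorem MeasFib.setOf [Countable β] {f : Ω → β} (hf : MeasFib f) (p : β → Prop) :
    MeasurableSet {ω | p (f ω)} := by
  have : {ω | p (f ω)} = ⋃ c ∈ {c | p c}, {ω | f ω = c} := by ext; simp
  rw [this]
  exact MeasurableSet.biUnion (Set.to_countable _) fun c _ => hf c

/-- Measurability of a map defined by cases on a discrete variable. -/
theorem MeasFib.setOf_bind [Countable β] {f : Ω → β} (hf : MeasFib f) {p : β → Ω → Prop}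
    (hp : ∀ b, MeasurableSet {ω | p b ω}) : MeasurableSet {ω | p (f ω) ω} := by
  have : {ω | p (f ω) ω} = ⋃ b, ({ω | f ω = b} ∩ {ω | p b ω}) := by ext; simp
  rw [this]
  exact MeasurableSet.iUnion fun b => (hf b).inter (hp b)

/-- An exploration reads coordinates selected by what has been read before; splitting over the
countably many values of the selection reduces to a fixed one. -/
theorem MeasFib.bind [Countable β] {f : Ω → β} (hf : MeasFib f) {F : β → Ω → γ}
    (hF : ∀ b, MeasFib (F b)) : MeasFib fun ω => F (f ω) ω :=
  fun c => hf.setOf_bind (p := fun b ω => F b ω = c) fun b => hF b c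

theorem MeasFib.comp [Countable β] {f : Ω → β} (hf : MeasFib f) (F : β → γ) :
    MeasFib fun ω => F (f ω) := fun c => hf.setOf fun b => F b = c

theorem MeasFib.ite {p : Ω → Prop} [DecidablePred p] (hp : MeasurableSet {ω | p ω}) {f g : Ω → β}
    (hf : MeasFib f) (hg : MeasFib g) : MeasFib fun ω => if p ω then f ω else g ω := by
  intro c
  have : {ω | (if p ω then f ω else g ω) = c}
      = ({ω | p ω} ∩ {ω | f ω = c}) ∪ ({ω | p ω}ᶜ ∩ {ω | g ω = c}) := by
    ext ω; by_cases h : p ω <;> simp [h]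
  rw [this]
  exact (hp.inter (hf c)).union (hp.compl.inter (hg c))

end MeasFib

/-- The rules of a layered exploration: from a site `x` with data `e` one discovers the sites
`child x e` of the same layer, and the sites `exit₁ x e`, `exit₂ x e` of the two following layers.
A layer is explored for `gens` generations, the `j`-th of which should have at least `size j`
sites. -/
structure BlockRule (S E : Type*) where
  child : S → E → Finset S
  exit₁ : S → E → Finset S
  exit₂ : S → E → Finset S
  gens : ℕ
  size : ℕ → ℕ

/-- All sites discovered from `B` by the rule `X`. -/
def discovered {S E : Type*} [DecidableEq S] (X : S → E → Finset S) (B : Finset S) (r : S → E) :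
    Finset S := B.biUnion fun x => X x (r x)

theorem discovered_congr {S E : Type*} [DecidableEq S] {X : S → E → Finset S} {B : Finset S}
    {r r' : S → E} (h : ∀ x ∈ B, r x = r' x) : discovered X B r = discovered X B r' :=
  Finset.biUnion_congr rfl fun x hx => by rw [h x hx]

theorem measFib_discovered {S E : Type*} [DecidableEq S] [Countable S] [MeasurableSpace E]
    {X : S → E → Finset S} (hX : ∀ x, MeasFib (X x)) (B : Finset S) :
    MeasFib (discovered X B) := by
  induction B using Finset.induction_on with
  | empty => exact measFib_const (Ω := S → E) (∅ : Finset S)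
  | insert a s ha ih =>
    have h1 : MeasFib fun r : S → E => X a (r a) := fun c =>
      (measurable_pi_apply (X := fun _ : S => E) a) (hX a c)
    have := ih.bind (F := fun t r => X a (r a) ∪ t) fun t => h1.comp fun u => u ∪ t
    refine fun c => ?_
    convert this c using 4
    simp [discovered, Finset.biUnion_insert]

open Classical in
/-- A subset with `M` elements. -/
noncomputable def pick {S : Type*} (M : ℕ) (B : Finset S) : Finset S :=
  if h : M ≤ B.card then (Finset.exists_subset_card_eq h).choose else B

theorem pick_subset {S : Type*} (M : ℕ) (B : Finset S) : pick M B ⊆ B := by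
  unfold pick
  split_ifs with h
  · exact (Finset.exists_subset_card_eq h).choose_spec.1
  · exact subset_rfl

theorem card_pick {S : Type*} {M : ℕ} {B : Finset S} (h : M ≤ B.card) : (pick M B).card = M := by
  unfold pick
  rw [dif_pos h]
  exact (Finset.exists_subset_card_eq h).choose_spec.2

namespace BlockRule

variable {S E : Type*} [DecidableEq S] (b : BlockRule S E)

/-- The exploration of a layer from `A`: the sites already used, and the current generation. -/
def explore (A : Finset S) (r : S → E) : ℕ → Finset S × Finset S
  | 0 => (∅, A)
  | j + 1 => ((explore A r j).1 ∪ (explore A r j).2,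
      discovered b.child (explore A r j).2 r \ ((explore A r j).1 ∪ (explore A r j).2))

/-- The exploration from `A` has grown as it should. -/
def Good (A : Finset S) (r : S → E) : Prop :=
  (∀ j ≤ b.gens, b.size j ≤ (b.explore A r j).2.card) ∧
  b.size 0 ≤ (discovered b.exit₁ (b.explore A r b.gens).2 r).card ∧
  b.size 0 ≤ (discovered b.exit₂ (b.explore A r b.gens).2 r).card

/-- One site leads directly to another. -/
def Leads (r : S → E) (x y : S) : Prop :=
  y ∈ b.child x (r x) ∨ y ∈ b.exit₁ x (r x) ∨ y ∈ b.exit₂ x (r x)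

theorem disjoint_explore (A : Finset S) (r : S → E) (j : ℕ) :
    Disjoint (b.explore A r j).1 (b.explore A r j).2 := by
  cases j with
  | zero => simp [explore]
  | succ j => exact Finset.disjoint_sdiff

/-- The first j generations are found by reading the used sites only. The data of the current
generation are still unread, so they are fresh given the past. -/
theorem explore_congr {A : Finset S} {r r' : S → E} {j : ℕ}
    (h : ∀ x ∈ (b.explore A r j).1, r x = r' x) :
    ∀ i ≤ j, b.explore A r i = b.explore A r' i := by
  induction j with
  | zero => intro i hi; obtain rfl : i = 0 := by omega
            rfl
  | succ j ih =>
    have h1 := ih fun x hx => h x (Finset.mem_union_left _ hx)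
    intro i hi
    rcases Nat.le_succ_iff.1 hi with hi | rfl
    · exact h1 i hi
    · have h2 := h1 j le_rfl
      have h3 : discovered b.child (b.explore A r j).2 r
          = discovered b.child (b.explore A r j).2 r' :=
        discovered_congr fun x hx => h x (Finset.mem_union_right _ hx)
      simp only [explore]
      rw [h3, h2]

/-- A deterministic bound that does not involve the dimension: it keeps the number of possible
collisions bounded while each has probability O(1/d). -/
theorem card_explore_le {c₀ : ℕ} (hc : ∀ x e, (b.child x e).card ≤ c₀) (A : Finset S) (r : S → E)
    (j : ℕ) : ((b.explore A r j).1 ∪ (b.explore A r j).2).card ≤ (1 + c₀) ^ j * A.card := by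
  induction j with
  | zero => simp [explore]
  | succ j ih =>
    have h1 : (discovered b.child (b.explore A r j).2 r).card ≤ (b.explore A r j).2.card * c₀ :=
      Finset.card_biUnion_le_card_mul _ _ _ fun x _ => hc x _
    have h2 : (b.explore A r j).2.card ≤ ((b.explore A r j).1 ∪ (b.explore A r j).2).card :=
      Finset.card_le_card Finset.subset_union_right
    simp only [explore, Finset.union_sdiff_self_eq_union]
    calc _ ≤ ((b.explore A r j).1 ∪ (b.explore A r j).2).card
          + (discovered b.child (b.explore A r j).2 r).card := Finset.card_union_le _ _
      _ ≤ ((b.explore A r j).1 ∪ (b.explore A r j).2).card * (1 + c₀) := by nlinarith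
      _ ≤ ((1 + c₀) ^ j * A.card) * (1 + c₀) := by gcongr
      _ = (1 + c₀) ^ (j + 1) * A.card := by ring

theorem explore_reachable {A : Finset S} {r : S → E} (j : ℕ) :
    ∀ x ∈ (b.explore A r j).2, ∃ a ∈ A, Relation.ReflTransGen (b.Leads r) a x := by
  induction j with
  | zero => exact fun x hx => ⟨x, hx, .refl⟩
  | succ j ih =>
    intro x hx
    obtain ⟨y, hy, hxy⟩ := Finset.mem_biUnion.1 (Finset.mem_sdiff.1 hx).1
    obtain ⟨a, ha, hay⟩ := ih y hy
    exact ⟨a, ha, hay.tail (Or.inl hxy)⟩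

section Layer

variable {φ : S → ℤ × ℤ}

theorem explore_layer (hC : ∀ x e, ∀ y ∈ b.child x e, φ y = φ x) {A : Finset S} {z : ℤ × ℤ}
    (hA : ∀ x ∈ A, φ x = z) (r : S → E) (j : ℕ) :
    (∀ x ∈ (b.explore A r j).1, φ x = z) ∧ ∀ x ∈ (b.explore A r j).2, φ x = z := by
  induction j with
  | zero => exact ⟨by simp [explore], hA⟩
  | succ j ih =>
    refine ⟨fun x hx => (Finset.mem_union.1 hx).elim (ih.1 x) (ih.2 x), fun x hx => ?_⟩
    obtain ⟨y, hy, hxy⟩ := Finset.mem_biUnion.1 (Finset.mem_sdiff.1 hx).1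
    rw [hC y _ x hxy, ih.2 y hy]

/-- Children stay in the layer of their parent, so the exploration never reads data of another
layer. -/
theorem explore_eq_of_layer (hC : ∀ x e, ∀ y ∈ b.child x e, φ y = φ x) {A : Finset S} {z : ℤ × ℤ}
    (hA : ∀ x ∈ A, φ x = z) {r r' : S → E} (h : ∀ x, φ x = z → r x = r' x) (j : ℕ) :
    b.explore A r j = b.explore A r' j :=
  b.explore_congr (fun x hx => h x ((b.explore_layer hC hA r j).1 x hx)) j le_rfl

theorem discovered_eq_of_layer (hC : ∀ x e, ∀ y ∈ b.child x e, φ y = φ x) {A : Finset S}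
    {z : ℤ × ℤ} (hA : ∀ x ∈ A, φ x = z) {r r' : S → E} (h : ∀ x, φ x = z → r x = r' x)
    (X : S → E → Finset S) (j : ℕ) :
    discovered X (b.explore A r j).2 r = discovered X (b.explore A r' j).2 r' := by
  rw [discovered_congr fun x hx => h x ((b.explore_layer hC hA r j).2 x hx),
    b.explore_eq_of_layer hC hA h]

theorem good_iff_of_layer (hC : ∀ x e, ∀ y ∈ b.child x e, φ y = φ x) {A : Finset S} {z : ℤ × ℤ}
    (hA : ∀ x ∈ A, φ x = z) {r r' : S → E} (h : ∀ x, φ x = z → r x = r' x) :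
    b.Good A r ↔ b.Good A r' := by
  unfold Good
  rw [b.discovered_eq_of_layer hC hA h, b.discovered_eq_of_layer hC hA h]
  simp only [b.explore_eq_of_layer hC hA h]

end Layer

section Measure

variable [Countable S] [MeasurableSpace E]

theorem measFib_explore (hC : ∀ x, MeasFib (b.child x)) (A : Finset S) (j : ℕ) :
    MeasFib fun r : S → E => b.explore A r j := by
  induction j with
  | zero => exact measFib_const _
  | succ j ih =>
    exact ih.bind (F := fun c r => (c.1 ∪ c.2, discovered b.child c.2 r \ (c.1 ∪ c.2))) fun c =>
      (measFib_discovered hC c.2).comp fun D => (c.1 ∪ c.2, D \ (c.1 ∪ c.2))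

theorem measFib_discovered_explore (hC : ∀ x, MeasFib (b.child x)) {X : S → E → Finset S}
    (hX : ∀ x, MeasFib (X x)) (A : Finset S) (j : ℕ) :
    MeasFib fun r : S → E => discovered X (b.explore A r j).2 r :=
  (b.measFib_explore hC A j).bind (F := fun c r => discovered X c.2 r) fun c =>
    measFib_discovered hX c.2

theorem measurableSet_good (hC : ∀ x, MeasFib (b.child x)) (h1 : ∀ x, MeasFib (b.exit₁ x))
    (h2 : ∀ x, MeasFib (b.exit₂ x)) (A : Finset S) : MeasurableSet {r | b.Good A r} := by
  have e : {r | b.Good A r} = (⋂ j ∈ {j | j ≤ b.gens}, {r | b.size j ≤ (b.explore A r j).2.card})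
      ∩ ({r | b.size 0 ≤ (discovered b.exit₁ (b.explore A r b.gens).2 r).card}
      ∩ {r | b.size 0 ≤ (discovered b.exit₂ (b.explore A r b.gens).2 r).card}) := by
    ext r; simp [Good]
  rw [e]
  refine MeasurableSet.inter (MeasurableSet.biInter (Set.to_countable _) fun j _ => ?_)
    (MeasurableSet.inter ?_ ?_)
  · exact (b.measFib_explore hC A j).setOf fun c => b.size j ≤ c.2.card
  · exact (b.measFib_discovered_explore hC h1 A _).setOf fun c => b.size 0 ≤ c.card
  · exact (b.measFib_discovered_explore hC h2 A _).setOf fun c => b.size 0 ≤ c.card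

variable (κ : Measure E) [IsProbabilityMeasure κ]

/-- A bad event concerning the current generation has its unconditional probability. -/
theorem measure_growth_and_bad_le (hC : ∀ x, MeasFib (b.child x)) {c₀ : ℕ}
    (hc : ∀ x e, (b.child x e).card ≤ c₀) {A : Finset S} (hA : A.card = b.size 0) {j : ℕ}
    (hj : j ≤ b.gens) {δ : ℝ≥0∞} {Bad : Finset S × Finset S → Set (S → E)}
    (mBad : ∀ c, MeasurableSet (Bad c)) (hdep : ∀ c, DependsOn (· ∈ Bad c) (c.2 : Set S))
    (hBad : ∀ V B : Finset S, Disjoint V B → b.size j ≤ B.card →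
      (V ∪ B).card ≤ (1 + c₀) ^ b.gens * b.size 0 → infinitePi (fun _ : S => κ) (Bad (V, B)) ≤ δ) :
    infinitePi (fun _ : S => κ) ({r | ∀ i ≤ j, b.size i ≤ (b.explore A r i).2.card}
      ∩ {r | r ∈ Bad (b.explore A r j)}) ≤ δ := by
  have mQ : MeasurableSet {r : S → E | ∀ i ≤ j, b.size i ≤ (b.explore A r i).2.card} := by
    have : {r : S → E | ∀ i ≤ j, b.size i ≤ (b.explore A r i).2.card}
        = ⋂ i ∈ {i | i ≤ j}, {r | b.size i ≤ (b.explore A r i).2.card} := by ext; simp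
    rw [this]
    exact MeasurableSet.biInter (Set.to_countable _) fun i _ =>
      (b.measFib_explore hC A i).setOf fun c => b.size i ≤ c.2.card
  refine (infinitePi_inter_adapted_le (fun _ : S => κ) (b.measFib_explore hC A j) mQ mBad
    (fun c => (c.1 : Set S)) (fun c => (c.2 : Set S)) δ ?_).trans ?_
  · rintro c ⟨r, hr, rfl⟩
    refine ⟨by exact_mod_cast b.disjoint_explore A r j, ?_, hdep _, ?_⟩
    -- Both the past growth and the event that the exploration is in the given state are determined
    -- by the used sites, which are disjoint from the current generation.
    · have key : ∀ x y : S → E, (∀ i ∈ (b.explore A r j).1, x i = y i) →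
          x ∈ {r | ∀ i ≤ j, b.size i ≤ (b.explore A r i).2.card} ∩
            {ω | b.explore A ω j = b.explore A r j} →
          y ∈ {r | ∀ i ≤ j, b.size i ≤ (b.explore A r i).2.card} ∩
            {ω | b.explore A ω j = b.explore A r j} := by
        rintro x y hxy ⟨h1, h2⟩
        have h2 : b.explore A x j = b.explore A r j := h2
        have h3 := b.explore_congr (A := A) (r := x) (r' := y) (j := j) (by rw [h2]; exact hxy)
        refine ⟨fun i hi => ?_, ?_⟩
        · rw [← h3 i hi]; exact h1 i hi
        · change b.explore A y j = _
          rw [← h3 j le_rfl, h2]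
      intro x y hxy
      exact propext ⟨key x y hxy, key y x fun i hi => (hxy i hi).symm⟩
    · refine hBad _ _ (b.disjoint_explore A r j) (hr j le_rfl) ?_
      refine (b.card_explore_le hc A r j).trans ?_
      rw [hA]
      gcongr
      omega
  · calc δ * _ ≤ δ * 1 := by gcongr; exact prob_le_one
      _ = δ := mul_one δ

/-- An exploration that fails does so at one of the `gens` growth steps or at one of the two exits,
after having grown as it should until then; each of these costs at most δ. -/
theorem measure_not_good_le (hC : ∀ x, MeasFib (b.child x)) (h1 : ∀ x, MeasFib (b.exit₁ x))
    (h2 : ∀ x, MeasFib (b.exit₂ x)) {c₀ : ℕ} (hc : ∀ x e, (b.child x e).card ≤ c₀) {δ : ℝ≥0∞}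
    (hgrow : ∀ j < b.gens, ∀ V B : Finset S, Disjoint V B → b.size j ≤ B.card →
      (V ∪ B).card ≤ (1 + c₀) ^ b.gens * b.size 0 → infinitePi (fun _ : S => κ)
        {r | (discovered b.child B r \ (V ∪ B)).card < b.size (j + 1)} ≤ δ)
    (hexit₁ : ∀ B : Finset S, b.size b.gens ≤ B.card → B.card ≤ (1 + c₀) ^ b.gens * b.size 0 →
      infinitePi (fun _ : S => κ) {r | (discovered b.exit₁ B r).card < b.size 0} ≤ δ)
    (hexit₂ : ∀ B : Finset S, b.size b.gens ≤ B.card → B.card ≤ (1 + c₀) ^ b.gens * b.size 0 →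
      infinitePi (fun _ : S => κ) {r | (discovered b.exit₂ B r).card < b.size 0} ≤ δ)
    {A : Finset S} (hA : A.card = b.size 0) :
    infinitePi (fun _ : S => κ) {r | ¬ b.Good A r} ≤ (b.gens + 2) * δ := by
  set μ := infinitePi fun _ : S => κ
  let G : ℕ → Set (S → E) := fun j => {r | ∀ i ≤ j, b.size i ≤ (b.explore A r i).2.card}
  let N : ℕ → Set (S → E) := fun j => G j ∩
    {r | r ∈ (fun c : Finset S × Finset S =>
      {r | (discovered b.child c.2 r \ (c.1 ∪ c.2)).card < b.size (j + 1)}) (b.explore A r j)}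
  let X : (S → E → Finset S) → Set (S → E) := fun e => G b.gens ∩
    {r | r ∈ (fun c : Finset S × Finset S =>
      {r | (discovered e c.2 r).card < b.size 0}) (b.explore A r b.gens)}
  have hN : ∀ j < b.gens, μ (N j) ≤ δ := fun j hj =>
    b.measure_growth_and_bad_le κ hC hc hA hj.le
      (fun c => (measFib_discovered hC c.2).setOf fun D => (D \ (c.1 ∪ c.2)).card < b.size (j + 1))
      (fun c r r' h => by simp only [Set.mem_ofPred_eq]; rw [discovered_congr h]) (hgrow j hj)
  have hX : ∀ e : S → E → Finset S, (∀ x, MeasFib (e x)) →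
      (∀ B : Finset S, b.size b.gens ≤ B.card → B.card ≤ (1 + c₀) ^ b.gens * b.size 0 →
      μ {r | (discovered e B r).card < b.size 0} ≤ δ) → μ (X e) ≤ δ := fun e he hb =>
    b.measure_growth_and_bad_le κ hC hc hA le_rfl
      (fun c => (measFib_discovered he c.2).setOf fun D => D.card < b.size 0)
      (fun c r r' h => by simp only [Set.mem_ofPred_eq]; rw [discovered_congr h])
      (fun V B _ h3 h4 => hb B h3 ((Finset.card_le_card Finset.subset_union_right).trans h4))
  have hsub : {r | ¬ b.Good A r} ⊆ (⋃ j ∈ Finset.range b.gens, N j) ∪ (X b.exit₁ ∪ X b.exit₂) := by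
    intro r hr
    by_contra hcon
    simp only [Set.mem_union, Set.mem_iUnion, Finset.mem_range, not_or, not_exists] at hcon
    obtain ⟨hc1, hc2, hc3⟩ := hcon
    have hG : ∀ j ≤ b.gens, r ∈ G j := by
      intro j
      induction j with
      | zero =>
        intro _ i hi
        obtain rfl : i = 0 := by omega
        exact hA.ge
      | succ j ih =>
        intro hj i hi
        have h3 := ih (by omega)
        rcases Nat.le_succ_iff.1 hi with hi | rfl
        · exact h3 i hi
        · by_contra h4
          exact hc1 j hj ⟨h3, not_le.1 h4⟩
    have hG' := hG _ le_rfl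
    refine hr ⟨hG', ?_, ?_⟩
    · by_contra h4; exact hc2 ⟨hG', not_le.1 h4⟩
    · by_contra h4; exact hc3 ⟨hG', not_le.1 h4⟩
  calc μ {r | ¬ b.Good A r} ≤ μ (⋃ j ∈ Finset.range b.gens, N j) + (μ (X b.exit₁) + μ (X b.exit₂)) :=
        (measure_mono hsub).trans ((measure_union_le _ _).trans (by gcongr; exact measure_union_le _ _))
    _ ≤ ∑ j ∈ Finset.range b.gens, δ + (δ + δ) := by
        gcongr
        · refine (measure_biUnion_finset_le _ _).trans (Finset.sum_le_sum fun j hj => ?_)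
          exact hN j (Finset.mem_range.1 hj)
        · exact hX _ h1 hexit₁
        · exact hX _ h2 hexit₂
    _ = (b.gens + 2) * δ := by
        rw [Finset.sum_const, Finset.card_range, nsmul_eq_mul]; ring

end Measure

end BlockRule

end Frog

/-! ### From layer to layer: oriented percolation and the Peierls argument -/

namespace Frog

open Measure
open scoped ENNReal

namespace BlockRule

variable {S E : Type*} [DecidableEq S] (b : BlockRule S E)

/-- The sites chosen for the next layer in the first direction. -/
noncomputable def out₁ (A : Finset S) (r : S → E) : Finset S :=
  pick (b.size 0) (discovered b.exit₁ (b.explore A r b.gens).2 r)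

/-- The sites chosen for the next layer in the second direction. -/
noncomputable def out₂ (A : Finset S) (r : S → E) : Finset S :=
  pick (b.size 0) (discovered b.exit₂ (b.explore A r b.gens).2 r)

open Classical in
/-- The sites from which the layer `z`, with `z.1 + z.2 = n`, is explored; no site if the layer
is not reached. -/
noncomputable def entry (A₀ : Finset S) : ℕ → ℤ × ℤ → (S → E) → Finset S
  | 0, z, _ => if z = 0 then A₀ else ∅
  | n + 1, z, r =>
    if (entry A₀ n (z - (1, 0)) r).Nonempty ∧ b.Good (entry A₀ n (z - (1, 0)) r) r
      then b.out₁ (entry A₀ n (z - (1, 0)) r) r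
    else if (entry A₀ n (z - (0, 1)) r).Nonempty ∧ b.Good (entry A₀ n (z - (0, 1)) r) r
      then b.out₂ (entry A₀ n (z - (0, 1)) r) r
    else ∅

/-- The layer `z` is reached, but its exploration fails. -/
def Fails (A₀ : Finset S) (z : ℤ × ℤ) (r : S → E) : Prop :=
  (b.entry A₀ (z.1 + z.2).toNat z r).Nonempty ∧ ¬ b.Good (b.entry A₀ (z.1 + z.2).toNat z r) r

/-- The set of layers that are reached. -/
def reached (A₀ : Finset S) (r : S → E) : Set (ℤ × ℤ) :=
  {z | (b.entry A₀ (z.1 + z.2).toNat z r).Nonempty}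

variable {b} {A₀ : Finset S} {φ : S → ℤ × ℤ}

theorem card_out₁ {A : Finset S} {r : S → E} (h : b.Good A r) : (b.out₁ A r).card = b.size 0 :=
  card_pick h.2.1

theorem card_out₂ {A : Finset S} {r : S → E} (h : b.Good A r) : (b.out₂ A r).card = b.size 0 :=
  card_pick h.2.2

theorem card_entry (hA₀ : A₀.card = b.size 0) {n : ℕ} {z : ℤ × ℤ} {r : S → E}
    (h : (b.entry A₀ n z r).Nonempty) : (b.entry A₀ n z r).card = b.size 0 := by
  cases n with
  | zero =>
    simp only [entry] at h ⊢
    split_ifs at h ⊢ with h1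
    · exact hA₀
    · simp at h
  | succ n =>
    simp only [entry] at h ⊢
    split_ifs at h ⊢ with h1 h2
    · exact card_out₁ h1.2
    · exact card_out₂ h2.2
    · simp at h

theorem nonneg_of_entry {n : ℕ} {z : ℤ × ℤ} {r : S → E} (h : (b.entry A₀ n z r).Nonempty) :
    0 ≤ z.1 ∧ 0 ≤ z.2 ∧ z.1 + z.2 = n := by
  induction n generalizing z with
  | zero =>
    simp only [entry] at h
    split_ifs at h with h1
    · simp [h1]
    · simp at h
  | succ n ih =>
    simp only [entry] at h
    split_ifs at h with h1 h2
    · have := ih h1.1; simp at this; push_cast; omega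
    · have := ih h2.1; simp at this; push_cast; omega
    · simp at h

theorem mem_reached_of_entry {n : ℕ} {z : ℤ × ℤ} {r : S → E} (h : (b.entry A₀ n z r).Nonempty) :
    z ∈ b.reached A₀ r := by
  have := (nonneg_of_entry h).2.2
  have e : (z.1 + z.2).toNat = n := by omega
  simpa [reached, e] using h

theorem entry_layer (hC : ∀ x e, ∀ y ∈ b.child x e, φ y = φ x)
    (h1 : ∀ x e, ∀ y ∈ b.exit₁ x e, φ y = φ x + (1, 0))
    (h2 : ∀ x e, ∀ y ∈ b.exit₂ x e, φ y = φ x + (0, 1)) (hφ : ∀ x ∈ A₀, φ x = 0) {n : ℕ}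
    {z : ℤ × ℤ} {r : S → E} : ∀ x ∈ b.entry A₀ n z r, φ x = z := by
  induction n generalizing z with
  | zero =>
    simp only [entry]
    split_ifs with h
    · rw [h]; exact hφ
    · simp
  | succ n ih =>
    simp only [entry]
    split_ifs with h h'
    · intro x hx
      obtain ⟨y, hy, hxy⟩ := Finset.mem_biUnion.1 (pick_subset _ _ hx)
      rw [h1 y _ x hxy, (b.explore_layer hC ih r _).2 y hy]; simp
    · intro x hx
      obtain ⟨y, hy, hxy⟩ := Finset.mem_biUnion.1 (pick_subset _ _ hx)
      rw [h2 y _ x hxy, (b.explore_layer hC ih r _).2 y hy]; simp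
    · simp

theorem entry_reachable {n : ℕ} {z : ℤ × ℤ} {r : S → E} :
    ∀ x ∈ b.entry A₀ n z r, ∃ a ∈ A₀, Relation.ReflTransGen (b.Leads r) a x := by
  induction n generalizing z with
  | zero =>
    simp only [entry]
    split_ifs with h
    · exact fun x hx => ⟨x, hx, .refl⟩
    · simp
  | succ n ih =>
    simp only [entry]
    split_ifs with h h'
    · intro x hx
      obtain ⟨y, hy, hxy⟩ := Finset.mem_biUnion.1 (pick_subset _ _ hx)
      obtain ⟨u, hu, huy⟩ := b.explore_reachable _ y hy
      obtain ⟨a, ha, hau⟩ := ih u hu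
      exact ⟨a, ha, (hau.trans huy).tail (Or.inr (Or.inl hxy))⟩
    · intro x hx
      obtain ⟨y, hy, hxy⟩ := Finset.mem_biUnion.1 (pick_subset _ _ hx)
      obtain ⟨u, hu, huy⟩ := b.explore_reachable _ y hy
      obtain ⟨a, ha, hau⟩ := ih u hu
      exact ⟨a, ha, (hau.trans huy).tail (Or.inr (Or.inr hxy))⟩
    · simp

theorem reached_pred {r : S → E} {z : ℤ × ℤ} (hz : z ∈ b.reached A₀ r) (h0 : z ≠ 0) :
    z - (1, 0) ∈ b.reached A₀ r ∨ z - (0, 1) ∈ b.reached A₀ r := by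
  have hz : (b.entry A₀ (z.1 + z.2).toNat z r).Nonempty := hz
  obtain ⟨n, hn⟩ : ∃ n, (z.1 + z.2).toNat = n := ⟨_, rfl⟩
  rw [hn] at hz
  cases n with
  | zero => simp [entry, h0] at hz
  | succ n =>
    simp only [entry] at hz
    split_ifs at hz with h1 h2
    · exact Or.inl (mem_reached_of_entry h1.1)
    · exact Or.inr (mem_reached_of_entry h2.1)
    · simp at hz

theorem fails_of_reached (hM : 0 < b.size 0) {r : S → E} {z : ℤ × ℤ} (hz : z ∈ b.reached A₀ r)
    (h : z + (1, 0) ∉ b.reached A₀ r ∨ z + (0, 1) ∉ b.reached A₀ r) : b.Fails A₀ z r := by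
  refine ⟨hz, fun hg => ?_⟩
  have hz : (b.entry A₀ (z.1 + z.2).toNat z r).Nonempty := hz
  set n := (z.1 + z.2).toNat
  rcases h with h | h
  · refine h (mem_reached_of_entry (n := n + 1) ?_)
    have e : z + (1, 0) - (1, 0) = z := by simp
    simp only [entry, e, hz, hg, true_and, if_true]
    rw [← Finset.card_pos, card_out₁ hg]; exact hM
  · refine h (mem_reached_of_entry (n := n + 1) ?_)
    have e : z + (0, 1) - (0, 1) = z := by simp
    simp only [entry, e, hz, hg, true_and, if_true]
    -- The layer z + (0, 1) may be entered from its other predecessor, which has priority; it is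
    -- reached in either case.
    split_ifs with h1
    · rw [← Finset.card_pos, card_out₁ h1.2]; exact hM
    · rw [← Finset.card_pos, card_out₂ hg]; exact hM

/-- The entry set of a layer is determined by the layers below it. -/
theorem entry_congr (hC : ∀ x e, ∀ y ∈ b.child x e, φ y = φ x)
    (h1 : ∀ x e, ∀ y ∈ b.exit₁ x e, φ y = φ x + (1, 0))
    (h2 : ∀ x e, ∀ y ∈ b.exit₂ x e, φ y = φ x + (0, 1)) (hφ : ∀ x ∈ A₀, φ x = 0) {n : ℕ}
    {z : ℤ × ℤ} {r r' : S → E} (h : ∀ x, (φ x).1 + (φ x).2 < n → r x = r' x) :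
    b.entry A₀ n z r = b.entry A₀ n z r' := by
  induction n generalizing z with
  | zero => simp [entry]
  | succ n ih =>
    have ih := fun z => ih (z := z) fun x hx => h x (by push_cast; omega)
    have hcon : ∀ w : ℤ × ℤ, (b.entry A₀ n w r').Nonempty → ∀ x, φ x = w → r x = r' x := by
      intro w hw x hx
      have := (nonneg_of_entry hw).2.2
      exact h x (by rw [hx, this]; push_cast; omega)
    have hgood : ∀ w : ℤ × ℤ, ((b.entry A₀ n w r).Nonempty ∧ b.Good (b.entry A₀ n w r) r) ↔
        ((b.entry A₀ n w r').Nonempty ∧ b.Good (b.entry A₀ n w r') r') := fun w => by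
      rw [ih w]
      exact and_congr_right fun hw =>
        b.good_iff_of_layer hC (entry_layer hC h1 h2 hφ) (hcon w hw)
    simp only [entry]
    by_cases h3 : (b.entry A₀ n (z - (1, 0)) r').Nonempty ∧ b.Good (b.entry A₀ n (z - (1, 0)) r') r'
    · rw [if_pos ((hgood _).2 h3), if_pos h3, out₁, out₁, ih,
        b.discovered_eq_of_layer hC (entry_layer hC h1 h2 hφ) (hcon _ h3.1)]
    rw [if_neg fun h => h3 ((hgood _).1 h), if_neg h3]
    by_cases h4 : (b.entry A₀ n (z - (0, 1)) r').Nonempty ∧ b.Good (b.entry A₀ n (z - (0, 1)) r') r'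
    · rw [if_pos ((hgood _).2 h4), if_pos h4, out₂, out₂, ih,
        b.discovered_eq_of_layer hC (entry_layer hC h1 h2 hφ) (hcon _ h4.1)]
    rw [if_neg fun h => h4 ((hgood _).1 h), if_neg h4]

/-- The entry set of z comes from strictly lower layers and its exploration stays in z, so other
layers of the same height play no role. -/
theorem fails_congr (hC : ∀ x e, ∀ y ∈ b.child x e, φ y = φ x)
    (h1 : ∀ x e, ∀ y ∈ b.exit₁ x e, φ y = φ x + (1, 0))
    (h2 : ∀ x e, ∀ y ∈ b.exit₂ x e, φ y = φ x + (0, 1)) (hφ : ∀ x ∈ A₀, φ x = 0)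
    {z : ℤ × ℤ} {r r' : S → E}
    (h : ∀ x, (φ x).1 + (φ x).2 < (z.1 + z.2).toNat ∨ φ x = z → r x = r' x) :
    b.Fails A₀ z r ↔ b.Fails A₀ z r' := by
  unfold Fails
  rw [entry_congr hC h1 h2 hφ fun x hx => h x (Or.inl hx),
    b.good_iff_of_layer hC (entry_layer hC h1 h2 hφ) fun x hx => h x (Or.inr hx)]

section Measure

variable [Countable S] [MeasurableSpace E]

theorem measFib_entry (mC : ∀ x, MeasFib (b.child x)) (m1 : ∀ x, MeasFib (b.exit₁ x))
    (m2 : ∀ x, MeasFib (b.exit₂ x)) (n : ℕ) (z : ℤ × ℤ) : MeasFib (b.entry A₀ n z) := by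
  induction n generalizing z with
  | zero => exact measFib_const (Ω := S → E) (if z = 0 then A₀ else ∅)
  | succ n ih =>
    have hg : ∀ w, MeasurableSet {r : S → E | (b.entry A₀ n w r).Nonempty ∧
        b.Good (b.entry A₀ n w r) r} := fun w =>
      (ih w).setOf_bind (p := fun A r => A.Nonempty ∧ b.Good A r) fun A =>
        (MeasurableSet.const A.Nonempty).inter (b.measurableSet_good mC m1 m2 A)
    have ho1 : ∀ w, MeasFib fun r : S → E => b.out₁ (b.entry A₀ n w r) r := fun w =>
      (ih w).bind (F := fun A r => b.out₁ A r) fun A =>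
        (b.measFib_discovered_explore mC m1 A _).comp _
    have ho2 : ∀ w, MeasFib fun r : S → E => b.out₂ (b.entry A₀ n w r) r := fun w =>
      (ih w).bind (F := fun A r => b.out₂ A r) fun A =>
        (b.measFib_discovered_explore mC m2 A _).comp _
    classical
    have := MeasFib.ite (hg (z - (1, 0))) (ho1 (z - (1, 0))) (MeasFib.ite (hg (z - (0, 1)))
      (ho2 (z - (0, 1))) (measFib_const (∅ : Finset S)))
    exact this

theorem measurableSet_fails (mC : ∀ x, MeasFib (b.child x)) (m1 : ∀ x, MeasFib (b.exit₁ x))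
    (m2 : ∀ x, MeasFib (b.exit₂ x)) (z : ℤ × ℤ) :
    MeasurableSet {r : S → E | b.Fails A₀ z r} :=
  (measFib_entry mC m1 m2 _ z).setOf_bind (p := fun A r => A.Nonempty ∧ ¬ b.Good A r) fun A =>
    (MeasurableSet.const A.Nonempty).inter (b.measurableSet_good mC m1 m2 A).compl

variable (κ : Measure E) [IsProbabilityMeasure κ]

/-- Layers are removed from T in decreasing order of z.1 + z.2. For a highest layer z, its entry set
and the failures of the other layers of T are determined off z, while the success of the exploration
from a given entry set is determined on z; conditionally z fails with probability at most ε. -/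
theorem measure_forall_fails_le (mC : ∀ x, MeasFib (b.child x)) (m1 : ∀ x, MeasFib (b.exit₁ x))
    (m2 : ∀ x, MeasFib (b.exit₂ x)) (hC : ∀ x e, ∀ y ∈ b.child x e, φ y = φ x)
    (h1 : ∀ x e, ∀ y ∈ b.exit₁ x e, φ y = φ x + (1, 0))
    (h2 : ∀ x e, ∀ y ∈ b.exit₂ x e, φ y = φ x + (0, 1)) (hφ : ∀ x ∈ A₀, φ x = 0)
    (hA₀ : A₀.card = b.size 0) {ε : ℝ≥0∞} (hε : ∀ A : Finset S, A.card = b.size 0 →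
      infinitePi (fun _ : S => κ) {r | ¬ b.Good A r} ≤ ε) (T : Finset (ℤ × ℤ)) :
    infinitePi (fun _ : S => κ) {r | ∀ z ∈ T, b.Fails A₀ z r} ≤ ε ^ T.card := by
  induction T using Finset.induction_on_max_value (fun z : ℤ × ℤ => z.1 + z.2) with
  | empty => simp
  | insert z T hz hmax ih =>
    -- A layer of negative height is never reached; this case is split off because `toNat` would
    -- truncate the height.
    rcases lt_or_ge (z.1 + z.2) 0 with hneg | hnn
    · have : {r : S → E | ∀ w ∈ insert z T, b.Fails A₀ w r} = ∅ := by
        refine Set.eq_empty_of_forall_notMem fun r hr => ?_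
        have := nonneg_of_entry (hr z (Finset.mem_insert_self z T)).1
        omega
      rw [this]; simp
    set n := (z.1 + z.2).toNat with hn
    have mQ : MeasurableSet {r : S → E | ∀ w ∈ T, b.Fails A₀ w r} := by
      have : {r : S → E | ∀ w ∈ T, b.Fails A₀ w r} = ⋂ w ∈ T, {r | b.Fails A₀ w r} := by
        ext; simp
      rw [this]
      exact MeasurableSet.biInter T.countable_toSet fun w _ => measurableSet_fails mC m1 m2 w
    have hset : {r : S → E | ∀ w ∈ insert z T, b.Fails A₀ w r} =
        {r | ∀ w ∈ T, b.Fails A₀ w r} ∩ {r | r ∈ (fun A : Finset S =>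
          {r | A.Nonempty ∧ ¬ b.Good A r}) (b.entry A₀ n z r)} := by
      ext r
      simp [Fails, hn, and_comm]
    rw [hset, Finset.card_insert_of_notMem hz, pow_succ']
    refine le_trans (infinitePi_inter_adapted_le (fun _ : S => κ) (measFib_entry mC m1 m2 n z) mQ
      (Bad := fun A => {r | A.Nonempty ∧ ¬ b.Good A r})
      (fun A => (MeasurableSet.const A.Nonempty).inter (b.measurableSet_good mC m1 m2 A).compl)
      (fun _ => {x | φ x ≠ z}) (fun _ => {x | φ x = z}) ε ?_) (by gcongr)
    rintro A ⟨r, hr, rfl⟩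
    refine ⟨Set.disjoint_left.2 fun x h3 h4 => h3 h4, ?_, ?_, ?_⟩
    · intro x y hxy
      have e1 : ∀ w ∈ T, b.Fails A₀ w x ↔ b.Fails A₀ w y := fun w hw => by
        refine fails_congr hC h1 h2 hφ fun u hu => hxy u fun huz => ?_
        rcases hu with hu | hu
        · have := hmax w hw
          rw [huz] at hu
          omega
        · exact hz (by rw [← huz, hu]; exact hw)
      have e2 : b.entry A₀ n z x = b.entry A₀ n z y :=
        entry_congr hC h1 h2 hφ fun u hu => hxy u fun huz => by rw [huz] at hu; omega
      simp only [Set.mem_inter_iff, Set.mem_ofPred_eq, e2]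
      exact propext (and_congr_left fun _ => forall₂_congr e1)
    · intro x y hxy
      simp only [Set.mem_ofPred_eq]
      rw [b.good_iff_of_layer hC (entry_layer hC h1 h2 hφ) hxy]
    · by_cases hne : (b.entry A₀ n z r).Nonempty
      · simpa [hne] using hε _ (card_entry hA₀ hne)
      · simp [hne]

/-- If the exploration of a layer from `size 0` sites fails with small probability, then infinitely
many sites can be reached with positive probability. -/
theorem exists_pos_infinite_reachable (mC : ∀ x, MeasFib (b.child x))
    (m1 : ∀ x, MeasFib (b.exit₁ x))
    (m2 : ∀ x, MeasFib (b.exit₂ x)) (hC : ∀ x e, ∀ y ∈ b.child x e, φ y = φ x)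
    (h1 : ∀ x e, ∀ y ∈ b.exit₁ x e, φ y = φ x + (1, 0))
    (h2 : ∀ x e, ∀ y ∈ b.exit₂ x e, φ y = φ x + (0, 1)) (hφ : ∀ x ∈ A₀, φ x = 0)
    (hA₀ : A₀.card = b.size 0) (hM : 0 < b.size 0)
    (hε : ∀ A : Finset S, A.card = b.size 0 →
      infinitePi (fun _ : S => κ) {r | ¬ b.Good A r} ≤ ((1 / 128 : ℝ≥0∞)) ^ 4) :
    ∃ a ∈ A₀, 0 < infinitePi (fun _ : S => κ)
      {r | {y | Relation.ReflTransGen (b.Leads r) a y}.Infinite} := by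
  set μ := infinitePi fun _ : S => κ
  -- All exits of the given dual path fail. The path is discarded when it has fewer than n / 4
  -- exits.
  let N : (n : ℕ) → Fin n → (Fin n → Fin 4) → Set (S → E) := fun n k w =>
    {r | n ≤ 4 * (contourExits k w).card ∧ ∀ z ∈ contourExits k w, b.Fails A₀ z r}
  have hN : ∀ n k w, μ (N n k w) ≤ (1 / 128 : ℝ≥0∞) ^ n := by
    intro n k w
    by_cases hn : n ≤ 4 * (contourExits k w).card
    · calc μ (N n k w) ≤ μ {r | ∀ z ∈ contourExits k w, b.Fails A₀ z r} :=
            measure_mono fun r hr => hr.2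
        _ ≤ ((1 / 128 : ℝ≥0∞) ^ 4) ^ (contourExits k w).card :=
            measure_forall_fails_le κ mC m1 m2 hC h1 h2 hφ hA₀ hε _
        _ = (1 / 128 : ℝ≥0∞) ^ (4 * (contourExits k w).card) := (pow_mul _ _ _).symm
        _ ≤ (1 / 128 : ℝ≥0∞) ^ n := pow_le_pow_right_of_le_one' (by
            rw [one_div]; exact ENNReal.inv_le_one.2 (by norm_num)) hn
    · simp [N, hn]
  have hfin : μ {r | (b.reached A₀ r).Finite} ≤ 1 / 4 := by
    have hsub : {r | (b.reached A₀ r).Finite} ⊆ ⋃ n, ⋃ k, ⋃ w, N n k w := by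
      intro r hr
      have h0 : (0 : ℤ × ℤ) ∈ b.reached A₀ r := by
        refine mem_reached_of_entry (n := 0) ?_
        simpa [entry, ← Finset.card_pos, hA₀] using hM
      obtain ⟨n, k, hk, w, hw, hz⟩ := exists_contour hr h0
        (fun z hz => ⟨(nonneg_of_entry hz).1, (nonneg_of_entry hz).2.1⟩)
        fun z hz hz0 => reached_pred hz hz0
      simp only [Set.mem_iUnion]
      exact ⟨n, ⟨k, hk⟩, w, hw, fun z hzz => fails_of_reached hM (hz z hzz).1 (hz z hzz).2⟩
    have hterm : ∀ n, μ (⋃ k, ⋃ w, N n k w) ≤ (1 / 8 : ℝ≥0∞) * (1 / 2) ^ n := by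
      intro n
      have hb : μ (⋃ k, ⋃ w, N n k w) ≤ n * (4 ^ n * (1 / 128 : ℝ≥0∞) ^ n) := by
        refine (measure_iUnion_le _).trans ?_
        rw [tsum_fintype]
        calc ∑ k, μ (⋃ w, N n k w) ≤ ∑ _k : Fin n, (4 ^ n * (1 / 128 : ℝ≥0∞) ^ n) := by
              refine Finset.sum_le_sum fun k _ => (measure_iUnion_le _).trans ?_
              rw [tsum_fintype]
              refine (Finset.sum_le_sum fun w _ => hN n k w).trans ?_
              simp
          _ = _ := by simp
      refine hb.trans ?_
      -- The factor n for the starting point is absorbed by 2 ^ n, and 2 * 4 / 128 = (1/8) * (1/2).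
      -- The case n = 0 is separate because there only the factor n makes the left side small.
      have hreal : (n : ℝ) * (4 ^ n * (1 / 128) ^ n) ≤ (1 / 8) * (1 / 2) ^ n := by
        rcases Nat.eq_zero_or_pos n with rfl | hn
        · norm_num
        · have h3 : (n : ℝ) ≤ 2 ^ n := by exact_mod_cast Nat.lt_two_pow_self.le
          have h4 : ((1 : ℝ) / 8) ^ n ≤ 1 / 8 := by
            calc ((1 : ℝ) / 8) ^ n ≤ (1 / 8) ^ 1 :=
                  pow_le_pow_of_le_one (by norm_num) (by norm_num) hn
              _ = 1 / 8 := pow_one _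
          calc (n : ℝ) * (4 ^ n * (1 / 128) ^ n) ≤ 2 ^ n * (4 ^ n * (1 / 128) ^ n) := by gcongr
            _ = (1 / 8) ^ n * (1 / 2) ^ n := by
                rw [← mul_pow, ← mul_pow, ← mul_pow]; norm_num
            _ ≤ (1 / 8) * (1 / 2) ^ n := by gcongr
      have := ENNReal.ofReal_le_ofReal hreal
      rw [ENNReal.ofReal_mul (by positivity), ENNReal.ofReal_mul (by positivity),
        ENNReal.ofReal_mul (by positivity), ENNReal.ofReal_pow (by positivity),
        ENNReal.ofReal_pow (by positivity), ENNReal.ofReal_pow (by positivity),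
        ENNReal.ofReal_div_of_pos (by positivity), ENNReal.ofReal_div_of_pos (by positivity),
        ENNReal.ofReal_div_of_pos (by positivity)] at this
      simpa using this
    calc μ {r | (b.reached A₀ r).Finite} ≤ ∑' n, μ (⋃ k, ⋃ w, N n k w) :=
          (measure_mono hsub).trans (measure_iUnion_le _)
      _ ≤ ∑' n, (1 / 8 : ℝ≥0∞) * (1 / 2) ^ n := ENNReal.tsum_le_tsum hterm
      _ = 1 / 8 * 2 := by
          rw [ENNReal.tsum_mul_left, ENNReal.tsum_geometric, one_div 2, ENNReal.one_sub_inv_two,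
            inv_inv]
      _ = 1 / 4 := by
          rw [← ENNReal.toReal_eq_toReal_iff' (by finiteness) (by finiteness)]
          norm_num
  by_contra! hcon
  -- Every reached layer contains a site reachable from A₀; finite clusters would therefore meet
  -- only finitely many layers.
  have hsub : {r | (b.reached A₀ r).Finite}ᶜ ⊆
      ⋃ a ∈ A₀, {r | {y | Relation.ReflTransGen (b.Leads r) a y}.Infinite} := by
    intro r hr
    by_contra hno
    simp only [Set.mem_iUnion, not_exists, Set.mem_ofPred_eq, Set.not_infinite] at hno
    refine hr (Set.Finite.subset ((Set.Finite.biUnion A₀.finite_toSet hno).image φ) ?_)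
    rintro z ⟨x, hx⟩
    obtain ⟨a, ha, hax⟩ := entry_reachable x hx
    exact ⟨x, Set.mem_biUnion ha hax, entry_layer hC h1 h2 hφ x hx⟩
  have hzero : μ {r | (b.reached A₀ r).Finite}ᶜ = 0 := by
    refine measure_mono_null hsub ((measure_biUnion_null_iff A₀.countable_toSet).2 fun a ha => ?_)
    exact le_zero_iff.1 (hcon a ha)
  have htot : (1 : ℝ≥0∞) ≤ 1 / 4 + 0 := by
    calc (1 : ℝ≥0∞) = μ Set.univ := measure_univ.symm
      _ ≤ μ {r | (b.reached A₀ r).Finite} + μ {r | (b.reached A₀ r).Finite}ᶜ := by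
          rw [← Set.union_compl_self {r | (b.reached A₀ r).Finite}]; exact measure_union_le _ _
      _ ≤ 1 / 4 + 0 := by rw [hzero]; gcongr
  rw [add_zero, one_div] at htot
  exact absurd htot (not_le.2 (ENNReal.inv_lt_one.2 (by norm_num)))

end Measure

end BlockRule

end Frog

/-! ### The model as an i.i.d. field; survival and infinite clusters -/

namespace Frog

open Measure
open scoped ENNReal

/-- The randomness attached to one site: the number of particles, their steps, their lifetimes. -/
abbrev SiteData (d : ℕ) : Type := ℕ × (ℕ → ℕ → Site d) × (ℕ → ℕ∞)

/-- The law of the randomness attached to one site. -/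
noncomputable def siteLaw (d : ℕ) (p : unitInterval) (ν : Measure ℕ) [IsProbabilityMeasure ν] :
    Measure (SiteData d) :=
  ν.prod ((infinitePi fun _ : ℕ => infinitePi fun _ : ℕ => stepLaw d).prod
    (infinitePi fun _ : ℕ => lifetimeLaw p))

instance (d : ℕ) (p : unitInterval) (ν : Measure ℕ) [IsProbabilityMeasure ν] :
    IsProbabilityMeasure (siteLaw d p ν) := by
  unfold siteLaw; infer_instance

/-- The configuration, sorted by sites. -/
def toField {d : ℕ} (ω : Config d) : Site d → SiteData d :=
  fun x => (ω.1 x, fun i => ω.2.1 (x, i), fun i => ω.2.2 (x, i))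

theorem measurable_toField {d : ℕ} : Measurable (toField (d := d)) := by
  unfold toField; fun_prop

/-- Regrouping a product of products by site is a bijection that preserves the measure, and
`toField` is its inverse. Afterwards everything concerns i.i.d. data indexed by the sites. -/
theorem map_toField (d : ℕ) (p : unitInterval) (ν : Measure ℕ) [IsProbabilityMeasure ν] :
    (frogLaw d p ν).map toField = infinitePi fun _ : Site d => siteLaw d p ν := by
  let A : Measure (ℕ → ℕ → Site d) := infinitePi fun _ : ℕ => infinitePi fun _ : ℕ => stepLaw d
  let B : Measure (ℕ → ℕ∞) := infinitePi fun _ : ℕ => lifetimeLaw p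
  have hA : (infinitePi fun _ : Site d => A).map (fun f (q : Site d × ℕ) => f q.1 q.2)
      = infinitePi fun _ : Site d × ℕ => infinitePi fun _ : ℕ => stepLaw d :=
    infinitePi_map_curry_symm fun (_ : Site d) (_ : ℕ) => infinitePi fun _ : ℕ => stepLaw d
  have hB : (infinitePi fun _ : Site d => B).map (fun f (q : Site d × ℕ) => f q.1 q.2)
      = infinitePi fun _ : Site d × ℕ => lifetimeLaw p :=
    infinitePi_map_curry_symm fun (_ : Site d) (_ : ℕ) => lifetimeLaw p
  have key : (infinitePi fun _ : Site d => siteLaw d p ν).map (fun f =>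
      ((fun x => (f x).1, (fun q => (f q.1).2.1 q.2, fun q => (f q.1).2.2 q.2)) : Config d))
      = frogLaw d p ν := by
    unfold frogLaw siteLaw
    rw [← hA, ← hB, map_prod_map _ _ (by fun_prop) (by fun_prop),
      ← infinitePi_prod_map_unzip (fun _ : Site d => A) (fun _ : Site d => B),
      map_map (by fun_prop) (by fun_prop)]
    conv_rhs => rw [← map_id (μ := infinitePi fun _ : Site d => ν)]
    rw [map_prod_map _ _ (by fun_prop) (by fun_prop),
      ← infinitePi_prod_map_unzip (fun _ : Site d => ν) (fun _ : Site d => A.prod B),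
      map_map (by fun_prop) (by fun_prop)]
    rfl
  rw [← key, map_map measurable_toField (by fun_prop)]
  exact map_id

/-- Some particle from `x`, with data `e`, visits `y` while alive. -/
def Visits {d : ℕ} (e : SiteData d) (x y : Site d) : Prop :=
  ∃ i < e.1, ∃ n : ℕ, (n : ℕ∞) < e.2.2 i ∧ x + ∑ k ∈ Finset.range n, e.2.1 i k = y

section Deterministic

variable {d : ℕ} {ω : Config d}

theorem passageTime_le {x y : Site d} {i n : ℕ} (hi : i < count ω x)
    (hn : (n : ℕ∞) < lifetime ω x i) (hy : walk ω x i n = y) : passageTime ω x y ≤ n :=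
  iInf₂_le_of_le i hi (iInf₂_le_of_le n ⟨hn, hy⟩ le_rfl)

theorem exists_of_passageTime_lt_top {x y : Site d} (h : passageTime ω x y < ⊤) :
    ∃ i n : ℕ, i < count ω x ∧ (n : ℕ∞) < lifetime ω x i ∧ walk ω x i n = y ∧
      passageTime ω x y = n := by
  -- A finite infimum in ℕ∞ lies strictly below itself plus 1, so some term lies below that too, and
  -- by integrality this term attains the infimum.
  have h1 : passageTime ω x y < passageTime ω x y + 1 := ENat.lt_add_one_iff h.ne |>.2 le_rfl
  conv_lhs at h1 => unfold passageTime
  simp only [iInf_lt_iff] at h1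
  obtain ⟨i, hi, n, hn, hlt⟩ := h1
  exact ⟨i, n, hi, hn.1, hn.2, le_antisymm (passageTime_le hi hn.1 hn.2)
    ((ENat.lt_add_one_iff h.ne).1 hlt)⟩

theorem visits_iff {x y : Site d} : Visits (toField ω x) x y ↔ passageTime ω x y < ⊤ := by
  constructor
  · rintro ⟨i, hi, n, hn, hy⟩
    exact (passageTime_le hi hn hy).trans_lt (ENat.natCast_lt_top n)
  · intro h
    obtain ⟨i, n, hi, hn, hy, -⟩ := exists_of_passageTime_lt_top h
    exact ⟨i, hi, n, hn, hy⟩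

theorem activationTime_le (s : ℕ → Site d) (h0 : s 0 = 0) (m : ℕ) :
    activationTime ω (s m) ≤ ∑ j ∈ Finset.range m, passageTime ω (s j) (s (j + 1)) :=
  iInf₂_le_of_le m s (iInf_le_of_le ⟨h0, rfl⟩ le_rfl)

theorem activationTime_zero : activationTime ω 0 = 0 :=
  le_antisymm (by simpa using activationTime_le (ω := ω) (fun _ => 0) rfl 0) zero_le

theorem exists_of_activationTime_lt_top {x : Site d} (h : activationTime ω x < ⊤) :
    ∃ (m : ℕ) (s : ℕ → Site d), s 0 = 0 ∧ s m = x ∧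
      ∑ j ∈ Finset.range m, passageTime ω (s j) (s (j + 1)) ≤ activationTime ω x := by
  have h1 : activationTime ω x < activationTime ω x + 1 := ENat.lt_add_one_iff h.ne |>.2 le_rfl
  conv_lhs at h1 => unfold activationTime
  simp only [iInf_lt_iff] at h1
  obtain ⟨m, s, hs, hlt⟩ := h1
  exact ⟨m, s, hs.1, hs.2, (ENat.lt_add_one_iff h.ne).1 hlt⟩

theorem activationTime_le_add {x y : Site d} :
    activationTime ω y ≤ activationTime ω x + passageTime ω x y := by
  by_cases hx : activationTime ω x < ⊤
  swap
  · rw [not_lt_top_iff.1 hx]; simp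
  obtain ⟨m, s, h0, hm, hs⟩ := exists_of_activationTime_lt_top hx
  have := activationTime_le (ω := ω) (fun j => if j ≤ m then s j else y) (by simp [h0]) (m + 1)
  simp only [add_le_iff_nonpos_right, nonpos_iff_eq_zero, one_ne_zero, if_false] at this
  refine this.trans ?_
  rw [Finset.sum_range_succ]
  simp only [le_refl, if_true, add_le_iff_nonpos_right, nonpos_iff_eq_zero, one_ne_zero, if_false,
    hm]
  gcongr
  refine le_trans (le_of_eq (Finset.sum_congr rfl fun j hj => ?_)) hs
  have hj : j < m := Finset.mem_range.1 hj
  simp [hj.le, Nat.succ_le_of_lt hj]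

/-- The particles at `x ≠ 0` are awakened by a particle that has been active before. -/
theorem exists_pred_of_chain {x : Site d} (hx : x ≠ 0) (s : ℕ → Site d) (h0 : s 0 = 0) (m : ℕ)
    (hm : s m = x) (hs : ∑ j ∈ Finset.range m, passageTime ω (s j) (s (j + 1)) < ⊤) :
    ∃ (x' : Site d) (i n : ℕ), i < count ω x' ∧ (n : ℕ∞) < lifetime ω x' i ∧ walk ω x' i n = x ∧
      1 ≤ n ∧ activationTime ω x' + n
        ≤ ∑ j ∈ Finset.range m, passageTime ω (s j) (s (j + 1)) := by
  induction m with
  | zero => exact absurd (hm.symm.trans h0) hx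
  | succ m ih =>
    rw [Finset.sum_range_succ] at hs ⊢
    have hs' := ENat.add_lt_top.1 hs
    -- If the chain was already at x, its last link is dropped; otherwise the last visit takes at
    -- least one step.
    by_cases hsm : s m = x
    · obtain ⟨x', i, n, h1, h2, h3, h4, h5⟩ := ih hsm hs'.1
      exact ⟨x', i, n, h1, h2, h3, h4, h5.trans le_self_add⟩
    · obtain ⟨i, n, h1, h2, h3, h4⟩ := exists_of_passageTime_lt_top hs'.2
      refine ⟨s m, i, n, h1, h2, h3.trans hm, ?_, ?_⟩
      · rcases Nat.eq_zero_or_pos n with rfl | h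
        · exact absurd (by simpa [walk, hm] using h3) hsm
        · exact h
      · rw [h4]; gcongr; exact activationTime_le s h0 m

theorem exists_pred {x : Site d} (hx : x ≠ 0) (h : activationTime ω x < ⊤) :
    ∃ (x' : Site d) (i n : ℕ), i < count ω x' ∧ (n : ℕ∞) < lifetime ω x' i ∧ walk ω x' i n = x ∧
      1 ≤ n ∧ activationTime ω x' + n ≤ activationTime ω x := by
  obtain ⟨m, s, h0, hm, hs⟩ := exists_of_activationTime_lt_top h
  obtain ⟨x', i, n, h1, h2, h3, h4, h5⟩ := exists_pred_of_chain hx s h0 m hm (hs.trans_lt h)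
  exact ⟨x', i, n, h1, h2, h3, h4, h5.trans hs⟩

/-- A finite sum of passage times is finite exactly when every link is a visit, so being activated
at some time is reachability in the visit graph. -/
theorem reachable_iff {y : Site d} :
    Relation.ReflTransGen (fun x y => Visits (toField ω x) x y) 0 y ↔ activationTime ω y < ⊤ := by
  constructor
  · intro h
    induction h with
    | refl => simp [activationTime_zero]
    | tail _ hxy ih =>
      exact activationTime_le_add.trans_lt (ENat.add_lt_top.2 ⟨ih, visits_iff.1 hxy⟩)
  · intro h
    obtain ⟨m, s, h0, hm, hs⟩ := exists_of_activationTime_lt_top h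
    have : ∀ m, ∑ j ∈ Finset.range m, passageTime ω (s j) (s (j + 1)) < ⊤ →
        Relation.ReflTransGen (fun x y => Visits (toField ω x) x y) 0 (s m) := by
      intro m
      induction m with
      | zero => intro _; rw [h0]
      | succ m ih =>
        intro hlt
        rw [Finset.sum_range_succ, ENat.add_lt_top] at hlt
        exact (ih hlt.1).tail (visits_iff.2 hlt.2)
    exact hm ▸ this m (hs.trans_lt h)

/-- By induction on N: apart from the origin, a site activated by time N is visited, within N steps,
by one of finitely many particles from a site activated by time N - 1. -/
theorem finite_activated (N : ℕ) : {x | activationTime ω x ≤ N}.Finite := by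
  have sub : ∀ N : ℕ, {x | activationTime ω x ≤ N} ⊆ {0} ∪ ⋃ x' ∈ {x' | activationTime ω x' + 1 ≤ N},
      ⋃ i ∈ Set.Iio (count ω x'), (walk ω x' i) '' Set.Iic N := by
    intro N x hx
    have hx : activationTime ω x ≤ N := hx
    by_cases h0 : x = 0
    · exact Or.inl h0
    · right
      obtain ⟨x', i, n, h1, h2, h3, h4, h5⟩ := exists_pred h0 (hx.trans_lt (ENat.natCast_lt_top N))
      simp only [Set.mem_iUnion]
      refine ⟨x', ?_, i, h1, n, ?_, h3⟩
      · have : ((1 : ℕ) : ℕ∞) ≤ n := by exact_mod_cast h4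
        exact le_trans (by gcongr; exact_mod_cast this) (h5.trans hx)
      · have : (n : ℕ∞) ≤ N := le_add_self.trans (h5.trans hx)
        exact_mod_cast this
  induction N with
  | zero =>
    refine Set.Finite.subset (Set.finite_singleton 0) ((sub 0).trans ?_)
    simp
  | succ N ih =>
    refine Set.Finite.subset ?_ (sub (N + 1))
    refine (Set.finite_singleton 0).union (Set.Finite.biUnion (ih.subset ?_) fun x' _ =>
      Set.Finite.biUnion (Set.finite_Iio _) fun i _ => (Set.finite_Iic _).image _)
    intro x hx
    have hx : activationTime ω x + 1 ≤ ((N + 1 : ℕ) : ℕ∞) := hx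
    push_cast at hx
    exact (ENat.add_le_add_iff_right (by simp)).1 hx

/-- Some site is activated after time N. For one with the smallest such activation time, the
particle that awakens it was activated by time N and is still alive afterwards, so it is active at
time N. -/
theorem survives_of_infinite (h : {x | activationTime ω x < ⊤}.Infinite) : Survives ω := by
  intro N
  have hne : {x | activationTime ω x < ⊤ ∧ (N : ℕ∞) < activationTime ω x}.Nonempty := by
    obtain ⟨x, hx, hx'⟩ := (h.sdiff (finite_activated (ω := ω) N)).nonempty
    exact ⟨x, hx, not_le.1 hx'⟩
  obtain ⟨x, ⟨hx1, hx2⟩, hmin⟩ :=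
    (InvImage.wf (activationTime ω) (wellFounded_lt (α := ℕ∞))).has_min _ hne
  have hx0 : x ≠ 0 := by
    rintro rfl
    rw [activationTime_zero] at hx2
    exact not_lt_zero hx2
  obtain ⟨x', i, n, h1, h2, h3, h4, h5⟩ := exists_pred hx0 hx1
  have hlt : activationTime ω x' < activationTime ω x := by
    have hfin : activationTime ω x' < ⊤ := lt_of_le_of_lt (le_self_add.trans h5) hx1
    refine lt_of_lt_of_le ?_ h5
    refine lt_of_lt_of_le ((ENat.lt_add_one_iff hfin.ne).2 le_rfl) ?_
    gcongr
    exact_mod_cast h4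
  have hle : activationTime ω x' ≤ N := by
    by_contra hcon
    exact hmin x' ⟨hlt.trans hx1, not_le.1 hcon⟩ hlt
  refine ⟨x', i, h1, hle, ?_⟩
  calc (N : ℕ∞) < activationTime ω x := hx2
    _ ≤ activationTime ω x' + passageTime ω x' x := activationTime_le_add
    _ ≤ activationTime ω x' + n := by gcongr; exact passageTime_le h1 h2 h3
    _ ≤ activationTime ω x' + lifetime ω x' i := by gcongr

/-- Finitely many activated sites carry finitely many particles, whose finite times of death are
bounded. An immortal particle would survive alone, hence `hlife`. -/
theorem infinite_of_survives (hlife : ∀ x i, lifetime ω x i < ⊤) (h : Survives ω) :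
    {x | activationTime ω x < ⊤}.Infinite := by
  intro hfin
  have hfin2 : (⋃ x ∈ {x | activationTime ω x < ⊤},
      (fun i => activationTime ω x + lifetime ω x i) '' Set.Iio (count ω x)).Finite :=
    Set.Finite.biUnion hfin fun x _ => (Set.finite_Iio _).image _
  obtain ⟨N, hN⟩ : ∃ N : ℕ, ∀ t ∈ (⋃ x ∈ {x | activationTime ω x < ⊤},
      (fun i => activationTime ω x + lifetime ω x i) '' Set.Iio (count ω x)), t ≤ (N : ℕ∞) := by
    have htop : ∀ t ∈ (⋃ x ∈ {x | activationTime ω x < ⊤},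
      (fun i => activationTime ω x + lifetime ω x i) '' Set.Iio (count ω x)), t ≠ ⊤ := by
      intro t ht
      simp only [Set.mem_iUnion] at ht
      obtain ⟨x, hx, i, -, rfl⟩ := ht
      exact (ENat.add_lt_top.2 ⟨hx, hlife x i⟩).ne
    obtain ⟨N, hN⟩ := (hfin2.image ENat.toNat).bddAbove
    refine ⟨N, fun t ht => ?_⟩
    have := hN ⟨t, ht, rfl⟩
    rw [← ENat.natCast_toNat (htop t ht)]
    exact_mod_cast this
  obtain ⟨x, i, h1, h2, h3⟩ := h N
  have hx : activationTime ω x < ⊤ := h2.trans_lt (ENat.natCast_lt_top N)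
  refine absurd (hN _ ?_) (not_le.2 h3)
  simp only [Set.mem_iUnion]
  exact ⟨x, hx, i, h1, rfl⟩

end Deterministic

end Frog

/-! ### Lifetimes, steps and the layers of the lattice -/

namespace Frog

open Measure
open scoped ENNReal

/-- Being alive n steps after activation means Ξ > n. The resulting p ^ n, valid for p = 1 as well,
is the only information about lifetimes that the estimates on walks use. -/
theorem lifetimeLaw_lt (p : unitInterval) (n : ℕ) :
    lifetimeLaw p {t | (n : ℕ∞) < t} = ENNReal.ofReal ((p : ℝ) ^ n) := by
  unfold lifetimeLaw
  split_ifs with h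
  · subst h
    simp
  · have hq : unitInterval.symm p ≠ 0 := fun h' => h (by
      have := congrArg unitInterval.symm h'; simpa using this)
    rw [map_apply (by fun_prop) (MeasurableSet.of_discrete)]
    have hset : (fun n : ℕ => ((n + 1 : ℕ) : ℕ∞)) ⁻¹' {t | (n : ℕ∞) < t}
        = ((Finset.range n : Finset ℕ) : Set ℕ)ᶜ := by
      ext k
      simp only [Set.mem_preimage, Set.mem_ofPred_eq, Finset.coe_range, Set.mem_compl_iff,
        Set.mem_Iio, not_lt]
      rw [Nat.cast_lt]; omega
    have hp : 1 - ((unitInterval.symm p : unitInterval) : ℝ) = p := by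
      simp [unitInterval.coe_symm_eq]
    have hreal : (geometricMeasure (unitInterval.symm p)).real ((Finset.range n : Finset ℕ) : Set ℕ)
        = 1 - (p : ℝ) ^ n := by
      rw [← sum_measureReal_singleton]
      simp only [geometricMeasure_real_singleton hq, hp]
      rw [← Finset.sum_mul, unitInterval.coe_symm_eq]
      linarith [mul_neg_geom_sum (p : ℝ) n, geom_sum_mul_neg (p : ℝ) n]
    rw [hset, ← ofReal_measureReal, probReal_compl_eq_one_sub (Finset.measurableSet _), hreal]
    simp

theorem lifetimeLaw_top {p : unitInterval} (hp : p ≠ 1) : lifetimeLaw p {⊤} = 0 := by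
  unfold lifetimeLaw
  rw [if_neg hp, map_apply (by fun_prop) (MeasurableSet.of_discrete)]
  have : (fun n : ℕ => ((n + 1 : ℕ) : ℕ∞)) ⁻¹' {⊤} = ∅ := by
    ext k
    simp only [Set.mem_preimage, Set.mem_singleton_iff, Set.mem_empty_iff_false, iff_false]
    exact ENat.natCast_ne_top _
  rw [this, measure_empty]

section Steps

variable {d : ℕ}

theorem unitSteps_eq_image :
    unitSteps d = ((Finset.univ : Finset (Fin d)) ×ˢ ({1, -1} : Finset ℤ)).image
      fun q => (Pi.single q.1 q.2 : Site d) := by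
  ext z
  rw [mem_unitSteps, Finset.mem_image]
  constructor
  · intro h
    obtain ⟨i, hi⟩ : ∃ i, z i ≠ 0 := by
      by_contra! hcon
      simp [hcon] at h
    have hsplit := Finset.add_sum_erase Finset.univ (fun j => |z j|) (Finset.mem_univ i)
    have hpos : 1 ≤ |z i| := Int.one_le_abs hi
    have hnn : 0 ≤ ∑ j ∈ Finset.univ.erase i, |z j| := Finset.sum_nonneg fun _ _ => abs_nonneg _
    have hzero : ∑ j ∈ Finset.univ.erase i, |z j| = 0 := by omega
    have hone : |z i| = 1 := by omega
    rw [Finset.sum_eq_zero_iff_of_nonneg fun _ _ => abs_nonneg _] at hzero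
    refine ⟨(i, z i), ?_, ?_⟩
    · simp only [Finset.mem_product, Finset.mem_univ, true_and, Finset.mem_insert,
        Finset.mem_singleton]
      rcases abs_choice (z i) with h1 | h1 <;> omega
    · funext j
      by_cases hj : j = i
      · subst hj; simp
      · have := hzero j (Finset.mem_erase.2 ⟨hj, Finset.mem_univ j⟩)
        simp [hj, abs_eq_zero.1 this]
  · rintro ⟨⟨i, s⟩, hs, rfl⟩
    rw [Finset.sum_eq_single i]
    · simp only [Finset.mem_product, Finset.mem_univ, true_and, Finset.mem_insert,
        Finset.mem_singleton] at hs
      rcases hs with h | h <;> simp [h]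
    · intro j _ hj; simp [hj]
    · simp

theorem single_injOn : Set.InjOn (fun q : Fin d × ℤ => (Pi.single q.1 q.2 : Site d))
    ((Finset.univ : Finset (Fin d)) ×ˢ ({1, -1} : Finset ℤ) : Finset (Fin d × ℤ)) := by
  rintro ⟨i, s⟩ hs ⟨j, t⟩ ht h
  simp only at h
  have hs0 : s ≠ 0 := by
    simp at hs; omega
  have hij : i = j := by
    by_contra hne
    have := congrFun h i
    rw [Pi.single_eq_same, Pi.single_eq_of_ne hne] at this
    exact hs0 this
  subst hij
  have := congrFun h i
  simp at this
  simp [this]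

theorem card_unitSteps : (unitSteps d).card = 2 * d := by
  rw [unitSteps_eq_image, Finset.card_image_of_injOn single_injOn, Finset.card_product]
  simp [mul_comm]

open Classical in
theorem stepLaw_apply (hd : 0 < d) (Z : Set (Site d)) :
    stepLaw d Z = (((unitSteps d).filter (· ∈ Z)).card : ℝ≥0∞) / (2 * d : ℕ) := by
  unfold stepLaw
  rw [dif_pos (unitSteps_nonempty hd), PMF.toMeasure_uniformOfFinset_apply _ _
    MeasurableSet.of_discrete, card_unitSteps]

theorem stepLaw_singleton_le (hd : 0 < d) (v : Site d) :
    stepLaw d {v} ≤ ((2 * d : ℕ) : ℝ≥0∞)⁻¹ := by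
  classical
  rw [stepLaw_apply hd, ENNReal.div_eq_inv_mul]
  calc _ ≤ ((2 * d : ℕ) : ℝ≥0∞)⁻¹ * 1 := by
        gcongr
        rw [Nat.cast_le_one]
        refine Finset.card_le_one.2 fun a ha b hb => ?_
        simp at ha hb
        rw [ha.2, hb.2]
    _ = _ := mul_one _

/-- The sum of the first `q` coordinates and the sum of the next `q` coordinates. -/
def layer (d q : ℕ) (x : Site d) : ℤ × ℤ :=
  (∑ i : Fin d, if (i : ℕ) < q then x i else 0,
    ∑ i : Fin d, if q ≤ (i : ℕ) ∧ (i : ℕ) < 2 * q then x i else 0)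

theorem layer_add (q : ℕ) (x y : Site d) : layer d q (x + y) = layer d q x + layer d q y := by
  ext
  · simp only [layer, Pi.add_apply, Prod.fst_add, ← Finset.sum_add_distrib]
    exact Finset.sum_congr rfl fun i _ => by split_ifs <;> simp
  · simp only [layer, Pi.add_apply, Prod.snd_add, ← Finset.sum_add_distrib]
    exact Finset.sum_congr rfl fun i _ => by split_ifs <;> simp

theorem layer_zero (q : ℕ) : layer d q 0 = 0 := by ext <;> simp [layer]

theorem layer_single (q : ℕ) (i : Fin d) (s : ℤ) : layer d q (Pi.single i s) =
    (if (i : ℕ) < q then s else 0, if q ≤ (i : ℕ) ∧ (i : ℕ) < 2 * q then s else 0) := by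
  simp only [layer]
  congr 1
  · rw [Finset.sum_eq_single i] <;> simp +contextual
  · rw [Finset.sum_eq_single i] <;> simp +contextual

theorem card_filter_fin (a b : ℕ) (hb : b ≤ d) :
    b - a ≤ (Finset.univ.filter fun i : Fin d => a ≤ (i : ℕ) ∧ (i : ℕ) < b).card := by
  have : (Finset.Ico a b).card ≤
      ((Finset.univ.filter fun i : Fin d => a ≤ (i : ℕ) ∧ (i : ℕ) < b).image Fin.val).card := by
    refine Finset.card_le_card fun j hj => ?_
    rw [Finset.mem_Ico] at hj
    exact Finset.mem_image.2 ⟨⟨j, hj.2.trans_le hb⟩, by simp [hj], rfl⟩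
  rw [Nat.card_Ico] at this
  exact this.trans Finset.card_image_le

theorem le_stepLaw (hd : 0 < d) {Z : Set (Site d)} {I : Finset (Fin d)} {T : Finset ℤ}
    (hT : T ⊆ {1, -1}) (h : ∀ i ∈ I, ∀ s ∈ T, (Pi.single i s : Site d) ∈ Z) :
    ((I.card * T.card : ℕ) : ℝ) / (2 * d) ≤ (stepLaw d).real Z := by
  classical
  have hsub : (I ×ˢ T).image (fun q => (Pi.single q.1 q.2 : Site d)) ⊆
      (unitSteps d).filter (· ∈ Z) := by
    intro z hz
    obtain ⟨⟨i, s⟩, hq, rfl⟩ := Finset.mem_image.1 hz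
    rw [Finset.mem_product] at hq
    refine Finset.mem_filter.2 ⟨?_, h i hq.1 s hq.2⟩
    rw [unitSteps_eq_image]
    exact Finset.mem_image_of_mem _ (Finset.mem_product.2 ⟨Finset.mem_univ _, hT hq.2⟩)
  have hcard := Finset.card_le_card hsub
  rw [Finset.card_image_of_injOn, Finset.card_product] at hcard
  · rw [measureReal_def, stepLaw_apply hd, ENNReal.toReal_div]
    simp only [ENNReal.toReal_natCast]
    push_cast
    gcongr
    exact_mod_cast hcard
  · exact single_injOn.mono (by
      intro q hq
      have hq := Finset.mem_product.1 hq
      exact Finset.mem_coe.2 (Finset.mem_product.2 ⟨Finset.mem_univ _, hT hq.2⟩))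

theorem le_stepLaw_neutral {q : ℕ} (hd : 0 < d) (hq : 2 * q ≤ d) :
    1 - 2 * q / d ≤ (stepLaw d).real {z | layer d q z = 0} := by
  have h1 := le_stepLaw hd (Z := {z | layer d q z = 0})
    (I := Finset.univ.filter fun i : Fin d => 2 * q ≤ (i : ℕ) ∧ (i : ℕ) < d) (T := {1, -1})
    subset_rfl (by
      intro i hi s _
      have hi := (Finset.mem_filter.1 hi).2
      have e1 : ¬ (i : ℕ) < q := by omega
      have e2 : ¬ (q ≤ (i : ℕ) ∧ (i : ℕ) < 2 * q) := by omega
      simp only [Set.mem_ofPred_eq, layer_single, e1, e2, if_false]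
      rfl)
  have h2 := card_filter_fin (d := d) (2 * q) d le_rfl
  refine le_trans ?_ h1
  have h3 : (({1, -1} : Finset ℤ)).card = 2 := rfl
  rw [h3]
  have hd' : (0 : ℝ) < d := by exact_mod_cast hd
  rw [le_div_iff₀ (by positivity)]
  have h4 : (d : ℝ) - 2 * q ≤
      ((Finset.univ.filter fun i : Fin d => 2 * q ≤ (i : ℕ) ∧ (i : ℕ) < d).card : ℝ) := by
    have : (d : ℝ) - 2 * q = ((d - 2 * q : ℕ) : ℝ) := by push_cast [Nat.cast_sub hq]; ring
    rw [this]; exact_mod_cast h2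
  push_cast
  have : (1 - 2 * (q : ℝ) / d) * (2 * d) = 2 * (d - 2 * q) := by field_simp
  rw [this]; linarith

theorem le_stepLaw_first {q : ℕ} (hd : 0 < d) (hq : 2 * q ≤ d) :
    (q : ℝ) / (2 * d) ≤ (stepLaw d).real {z | layer d q z = (1, 0)} := by
  have h1 := le_stepLaw hd (Z := {z | layer d q z = (1, 0)})
    (I := Finset.univ.filter fun i : Fin d => 0 ≤ (i : ℕ) ∧ (i : ℕ) < q) (T := {1})
    (by simp) (by
      intro i hi s hs
      have hi := (Finset.mem_filter.1 hi).2
      have e1 : (i : ℕ) < q := by omega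
      have e2 : ¬ (q ≤ (i : ℕ) ∧ (i : ℕ) < 2 * q) := by omega
      rw [Finset.mem_singleton.1 hs]
      simp only [Set.mem_ofPred_eq, layer_single, e1, e2, if_false, if_true])
  refine le_trans ?_ h1
  have h2 := card_filter_fin (d := d) 0 q (by omega)
  gcongr
  simpa using h2

theorem le_stepLaw_second {q : ℕ} (hd : 0 < d) (hq : 2 * q ≤ d) :
    (q : ℝ) / (2 * d) ≤ (stepLaw d).real {z | layer d q z = (0, 1)} := by
  have h1 := le_stepLaw hd (Z := {z | layer d q z = (0, 1)})
    (I := Finset.univ.filter fun i : Fin d => q ≤ (i : ℕ) ∧ (i : ℕ) < 2 * q) (T := {1})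
    (by simp) (by
      intro i hi s hs
      have hi := (Finset.mem_filter.1 hi).2
      have e1 : ¬ (i : ℕ) < q := by omega
      rw [Finset.mem_singleton.1 hs]
      simp only [Set.mem_ofPred_eq, layer_single, e1, hi, if_false, if_true, and_self])
  refine le_trans ?_ h1
  have h2 := card_filter_fin (d := d) q (2 * q) hq
  have h3 : q ≤ (Finset.univ.filter fun i : Fin d => q ≤ (i : ℕ) ∧ (i : ℕ) < 2 * q).card := by
    omega
  gcongr
  simpa using h3

end Steps

section Site

variable {d : ℕ}

/-- The displacement after `n` steps of the `i`-th particle. -/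
def displ (e : SiteData d) (i n : ℕ) : Site d := ∑ k ∈ Finset.range n, e.2.1 i k

theorem measurable_displ (i n : ℕ) : Measurable fun e : SiteData d => displ e i n := by
  unfold displ; fun_prop

/-- The `i`-th particle exists, lives for more than `n` steps, and takes its first `n` steps
in `Z`. -/
def Runs (Z : Set (Site d)) (e : SiteData d) (i n : ℕ) : Prop :=
  i < e.1 ∧ (n : ℕ∞) < e.2.2 i ∧ ∀ k < n, e.2.1 i k ∈ Z

theorem runs_eq_prod (Z : Set (Site d)) (i n : ℕ) : {e : SiteData d | Runs Z e i n} =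
    {m | i < m} ×ˢ ({f | ∀ k < n, f i k ∈ Z} ×ˢ {l | (n : ℕ∞) < l i}) := by
  ext e; simp [Runs]; tauto

theorem measurableSet_runs (Z : Set (Site d)) (i n : ℕ) :
    MeasurableSet {e : SiteData d | Runs Z e i n} := by
  rw [runs_eq_prod]
  refine MeasurableSet.prod .of_discrete (MeasurableSet.prod ?_ ?_)
  · have : {f : ℕ → ℕ → Site d | ∀ k < n, f i k ∈ Z} = ⋂ k ∈ {k | k < n}, {f | f i k ∈ Z} := by
      ext; simp
    rw [this]
    refine MeasurableSet.biInter (Set.to_countable _) fun k _ => ?_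
    have hm : Measurable fun f : ℕ → ℕ → Site d => f i k := by fun_prop
    exact hm (MeasurableSet.of_discrete (s := Z))
  · have hm : Measurable fun l : ℕ → ℕ∞ => l i := by fun_prop
    exact hm (MeasurableSet.of_discrete (s := {t | (n : ℕ∞) < t}))

variable (p : unitInterval) (ν : Measure ℕ) [IsProbabilityMeasure ν]

theorem siteLaw_runs (Z : Set (Site d)) (i n : ℕ) : siteLaw d p ν {e | Runs Z e i n} =
    ν {m | i < m} * (stepLaw d Z ^ n * ENNReal.ofReal ((p : ℝ) ^ n)) := by
  rw [runs_eq_prod, siteLaw, prod_prod, prod_prod]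
  congr 2
  · have h1 : {f : ℕ → ℕ → Site d | ∀ k < n, f i k ∈ Z} =
        (fun f => f i) ⁻¹' (((Finset.range n : Finset ℕ) : Set ℕ).pi fun _ => Z) := by
      ext; simp
    rw [h1, (measurePreserving_eval_infinitePi
      (fun _ : ℕ => infinitePi fun _ : ℕ => stepLaw d) i).measure_preimage
      (MeasurableSet.pi (Finset.countable_toSet _) fun _ _ => .of_discrete).nullMeasurableSet,
      infinitePi_pi _ fun _ _ => .of_discrete]
    simp
  · rw [← lifetimeLaw_lt]
    exact (measurePreserving_eval_infinitePi (fun _ : ℕ => lifetimeLaw p) i).measure_preimage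
      (MeasurableSet.of_discrete (s := {t | (n : ℕ∞) < t})).nullMeasurableSet

end Site

end Frog

/-! ### Chebyshev and collision estimates -/

namespace MeasureTheory.Measure

open scoped ENNReal

/-- A variable independent of `g` equals `g` with probability at most its largest atom. -/
theorem infinitePi_comp_eval_eq_le {ι : Type*} {X : ι → Type*} [∀ i, MeasurableSpace (X i)]
    (P : (i : ι) → Measure (X i)) [∀ i, IsProbabilityMeasure (P i)] {T : Type*} [Countable T]
    (u : ι) {F : X u → T} (mF : ∀ c, MeasurableSet {x | F x = c}) {g : (Π i, X i) → T}
    (hg : ∀ c, MeasurableSet {ω | g ω = c}) (hdep : DependsOn g {u}ᶜ) {δ : ℝ≥0∞}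
    (h : ∀ c, P u {x | F x = c} ≤ δ) : infinitePi P {ω | F (ω u) = g ω} ≤ δ := by
  have := infinitePi_inter_adapted_le P hg MeasurableSet.univ
    (Bad := fun c => {ω | F (ω u) = c}) (fun c => measurable_pi_apply u (mF c))
    (fun _ => {u}ᶜ) (fun _ => {u}) δ fun c _ => ⟨disjoint_compl_left, ?_, ?_, ?_⟩
  · simpa using this
  · intro x y hxy
    simp [hdep hxy]
  · intro x y hxy
    simp [hxy u rfl]
  · exact ((measurePreserving_eval_infinitePi P u).measure_preimage
      (mF c).nullMeasurableSet).trans_le (h c)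

/-- Chebyshev's inequality for a sum of independent copies of a bounded variable. -/
theorem infinitePi_sum_lt_le {S E : Type*} [MeasurableSpace E] (κ : Measure E)
    [IsProbabilityMeasure κ] {f : E → ℝ} (mf : Measurable f) {c : ℝ} (hf : ∀ e, 0 ≤ f e ∧ f e ≤ c)
    {a t : ℝ} (hta : t < a) (ha : a ≤ ∫ e, f e ∂κ) {B : Finset S} (hB : B.Nonempty) :
    infinitePi (fun _ : S => κ) {r | ∑ b ∈ B, f (r b) < t * B.card}
      ≤ ENNReal.ofReal (c ^ 2 / ((a - t) ^ 2 * B.card)) := by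
  set μ := infinitePi fun _ : S => κ
  have hBpos : (0 : ℝ) < B.card := by exact_mod_cast hB.card_pos
  have hmp := fun b : S => measurePreserving_eval_infinitePi (fun _ : S => κ) b
  have hmem : ∀ b : S, MemLp (fun r : S → E => f (r b)) 2 μ := fun b =>
    MemLp.of_bound (mf.comp (measurable_pi_apply b)).aestronglyMeasurable c
      (Eventually.of_forall fun r => by
        rw [Real.norm_eq_abs, abs_of_nonneg (hf _).1]; exact (hf _).2)
  have hint : ∀ b : S, ∫ r, f (r b) ∂μ = ∫ e, f e ∂κ := fun b => by
    rw [← (hmp b).map_eq, integral_map (hmp b).aemeasurable mf.aestronglyMeasurable]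
  have hmean : μ[∑ b ∈ B, fun r : S → E => f (r b)] = B.card * ∫ e, f e ∂κ := by
    have : (∑ b ∈ B, fun r : S → E => f (r b)) = fun r => ∑ b ∈ B, f (r b) := by ext; simp
    rw [this, integral_finsetSum _ fun b _ => (hmem b).integrable (by norm_num)]
    simp [hint]
  have hvar : variance (∑ b ∈ B, fun r : S → E => f (r b)) μ ≤ B.card * c ^ 2 := by
    rw [IndepFun.variance_sum fun b _ => hmem b]
    · calc ∑ b ∈ B, variance (fun r : S → E => f (r b)) μ ≤ ∑ _b ∈ B, c ^ 2 := by
            refine Finset.sum_le_sum fun b _ => ?_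
            have := variance_le_sq_of_bounded (μ := μ) (X := fun r : S → E => f (r b)) (a := 0)
              (b := c) (Eventually.of_forall fun r => ⟨(hf _).1, (hf _).2⟩)
              (mf.comp (measurable_pi_apply b)).aemeasurable
            refine this.trans ?_
            nlinarith [sq_nonneg c]
        _ = B.card * c ^ 2 := by simp
    · intro b _ b' _ hbb
      exact (iIndepFun_infinitePi (P := fun _ : S => κ) (X := fun _ => f) fun _ => mf).indepFun hbb
  have hpos : 0 < (a - t) * B.card := mul_pos (sub_pos.2 hta) hBpos
  have hch := meas_ge_le_variance_div_sq (memLp_finsetSum' B fun b _ => hmem b) hpos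
  refine (measure_mono ?_).trans (hch.trans (ENNReal.ofReal_le_ofReal ?_))
  · intro r hr
    have hr : ∑ b ∈ B, f (r b) < t * B.card := hr
    simp only [Set.mem_ofPred_eq]
    rw [hmean, Finset.sum_apply, abs_sub_comm]
    refine le_trans ?_ (le_abs_self _)
    nlinarith
  · calc _ ≤ (B.card * c ^ 2) / ((a - t) * B.card) ^ 2 := by gcongr
      _ = _ := by
        have : a - t ≠ 0 := (sub_pos.2 hta).ne'
        field_simp

end MeasureTheory.Measure

namespace Frog

open Measure
open scoped ENNReal

variable {d : ℕ}

section Collisions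

/-- Given the other steps, the last step has to take a prescribed value, and no atom of the step law
exceeds 1 / (2d). -/
theorem path_sum_eq_le (hd : 0 < d) {n : ℕ} (hn : 1 ≤ n) (v : Site d) :
    infinitePi (fun _ : ℕ => stepLaw d) {s | ∑ k ∈ Finset.range n, s k = v}
      ≤ ((2 * d : ℕ) : ℝ≥0∞)⁻¹ := by
  obtain ⟨n, rfl⟩ : ∃ m, n = m + 1 := ⟨n - 1, by omega⟩
  have hm : Measurable fun s : ℕ → Site d => v - ∑ k ∈ Finset.range n, s k := by fun_prop
  have := infinitePi_comp_eval_eq_le (fun _ : ℕ => stepLaw d) n (F := id)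
    (g := fun s => v - ∑ k ∈ Finset.range n, s k) (fun c => .of_discrete)
    (fun c => hm (measurableSet_singleton c))
    (fun x y hxy => by
      simp only
      rw [Finset.sum_congr rfl fun k hk => hxy k (by
        have := Finset.mem_range.1 hk
        simp; omega)])
    (fun c => stepLaw_singleton_le hd c)
  refine (measure_mono fun s hs => ?_).trans this
  have hs : ∑ k ∈ Finset.range (n + 1), s k = v := hs
  simp only [Set.mem_ofPred_eq, id]
  rw [← hs, Finset.sum_range_succ]; simp

/-- Returning at time m to the position at time n forces step n to be the opposite of the sum of the
later steps, which are independent of it. -/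
theorem path_sum_eq_sum_le (hd : 0 < d) {n m : ℕ} (hn : n < m) :
    infinitePi (fun _ : ℕ => stepLaw d)
      {s | ∑ k ∈ Finset.range n, s k = ∑ k ∈ Finset.range m, s k} ≤ ((2 * d : ℕ) : ℝ≥0∞)⁻¹ := by
  have hm : Measurable fun s : ℕ → Site d => - ∑ k ∈ Finset.Ico (n + 1) m, s k := by fun_prop
  have := infinitePi_comp_eval_eq_le (fun _ : ℕ => stepLaw d) n (F := id)
    (g := fun s => - ∑ k ∈ Finset.Ico (n + 1) m, s k) (fun c => .of_discrete)
    (fun c => hm (measurableSet_singleton c))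
    (fun x y hxy => by
      simp only
      rw [Finset.sum_congr rfl fun k hk => hxy k (by
        have := Finset.mem_Ico.1 hk
        simp; omega)])
    (fun c => stepLaw_singleton_le hd c)
  refine (measure_mono fun s hs => ?_).trans this
  have hs : ∑ k ∈ Finset.range n, s k = ∑ k ∈ Finset.range m, s k := hs
  simp only [Set.mem_ofPred_eq, id]
  rw [← Finset.sum_range_add_sum_Ico _ hn.le, Finset.sum_eq_sum_Ico_succ_bot hn] at hs
  rw [left_eq_add] at hs
  exact eq_neg_of_add_eq_zero_left hs

variable (p : unitInterval) (ν : Measure ℕ) [IsProbabilityMeasure ν]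

theorem siteLaw_steps {A : Set (ℕ → ℕ → Site d)} : siteLaw d p ν {e | e.2.1 ∈ A}
    = infinitePi (fun _ : ℕ => infinitePi fun _ : ℕ => stepLaw d) A := by
  have : {e : SiteData d | e.2.1 ∈ A} = Set.univ ×ˢ (A ×ˢ Set.univ) := by ext; simp
  rw [this, siteLaw, prod_prod, prod_prod]; simp

theorem particles_eval {i : ℕ} {A : Set (ℕ → Site d)} (mA : MeasurableSet A) :
    infinitePi (fun _ : ℕ => infinitePi fun _ : ℕ => stepLaw d) {f | f i ∈ A}
      = infinitePi (fun _ : ℕ => stepLaw d) A :=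
  (measurePreserving_eval_infinitePi (fun _ : ℕ => infinitePi fun _ : ℕ => stepLaw d)
    i).measure_preimage mA.nullMeasurableSet

theorem measurable_pathSum (n : ℕ) :
    Measurable fun s : ℕ → Site d => ∑ k ∈ Finset.range n, s k := by fun_prop

theorem siteLaw_displ_le (hd : 0 < d) {n : ℕ} (hn : 1 ≤ n) (i : ℕ) (v : Site d) :
    siteLaw d p ν {e | displ e i n = v} ≤ ((2 * d : ℕ) : ℝ≥0∞)⁻¹ := by
  refine le_trans (le_of_eq ?_) (path_sum_eq_le hd hn v)
  have hm : MeasurableSet {s : ℕ → Site d | ∑ k ∈ Finset.range n, s k = v} :=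
    measurable_pathSum n (measurableSet_singleton v)
  rw [← particles_eval (i := i) hm, ← siteLaw_steps p ν]
  rfl

theorem siteLaw_displ_eq_displ_le (hd : 0 < d) {i j n m : ℕ} (hn : 1 ≤ n)
    (hne : (i, n) ≠ (j, m)) :
    siteLaw d p ν {e | displ e i n = displ e j m} ≤ ((2 * d : ℕ) : ℝ≥0∞)⁻¹ := by
  by_cases hij : i = j
  · subst hij
    have key : ∀ n m : ℕ, n < m → siteLaw d p ν {e | displ e i n = displ e i m}
        ≤ ((2 * d : ℕ) : ℝ≥0∞)⁻¹ := by
      intro n m hnm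
      refine le_trans (le_of_eq ?_) (path_sum_eq_sum_le hd hnm)
      rw [← particles_eval (i := i) (measurableSet_eq_fun (measurable_pathSum n)
        (measurable_pathSum m)), ← siteLaw_steps p ν]
      rfl
    rcases lt_trichotomy n m with h | h | h
    · exact key n m h
    · exact absurd (by rw [h]) hne
    · have := key m n h
      simpa only [eq_comm] using this
  · have hmeas : Measurable fun f : ℕ → ℕ → Site d => ∑ k ∈ Finset.range m, f j k := by fun_prop
    have := infinitePi_comp_eval_eq_le (fun _ : ℕ => infinitePi fun _ : ℕ => stepLaw d) i
      (F := fun s => ∑ k ∈ Finset.range n, s k) (g := fun f => ∑ k ∈ Finset.range m, f j k)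
      (fun c => measurable_pathSum n (measurableSet_singleton c))
      (fun c => hmeas (measurableSet_singleton c))
      (fun x y hxy => by
        simp only
        rw [hxy j (by simpa using Ne.symm hij)])
      (fun c => path_sum_eq_le hd hn c)
    refine le_trans (le_of_eq ?_) this
    rw [← siteLaw_steps p ν]
    rfl

theorem field_pos_le (hd : 0 < d) {n : ℕ} (hn : 1 ≤ n) (i : ℕ) (x v : Site d) :
    infinitePi (fun _ : Site d => siteLaw d p ν) {r | x + displ (r x) i n = v}
      ≤ ((2 * d : ℕ) : ℝ≥0∞)⁻¹ := by
  have h := siteLaw_displ_le p ν hd hn i (v - x)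
  have hm : MeasurableSet {e : SiteData d | displ e i n = v - x} :=
    measurable_displ i n (measurableSet_singleton _)
  rw [← (measurePreserving_eval_infinitePi (fun _ : Site d => siteLaw d p ν) x).measure_preimage
    hm.nullMeasurableSet] at h
  refine (measure_mono fun r hr => ?_).trans h
  have hr : x + displ (r x) i n = v := hr
  simp [← hr]

/-- Two labels differ in the site, in the particle or only in the time. In each case some step,
independent of all the others involved, has to take a prescribed value. -/
theorem field_pos_eq_pos_le (hd : 0 < d) {x y : Site d} {i j n m : ℕ} (hn : 1 ≤ n)
    (hne : (x, i, n) ≠ (y, j, m)) :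
    infinitePi (fun _ : Site d => siteLaw d p ν)
      {r | x + displ (r x) i n = y + displ (r y) j m} ≤ ((2 * d : ℕ) : ℝ≥0∞)⁻¹ := by
  by_cases hxy : x = y
  · subst hxy
    have h := siteLaw_displ_eq_displ_le p ν hd hn (i := i) (j := j) (by simpa using hne)
    rw [← (measurePreserving_eval_infinitePi (fun _ : Site d => siteLaw d p ν) x).measure_preimage
      (measurableSet_eq_fun (measurable_displ i n) (measurable_displ j m)).nullMeasurableSet] at h
    refine (measure_mono fun r hr => ?_).trans h
    have hr : x + displ (r x) i n = x + displ (r x) j m := hr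
    simpa using hr
  · have hmeas : Measurable fun r : Site d → SiteData d => y + displ (r y) j m :=
      ((measurable_displ j m).comp (measurable_pi_apply y)).const_add y
    have hmeas' : Measurable fun e : SiteData d => x + displ e i n :=
      (measurable_displ i n).const_add x
    refine infinitePi_comp_eval_eq_le (fun _ : Site d => siteLaw d p ν) x
      (F := fun e => x + displ e i n) (g := fun r => y + displ (r y) j m)
      (fun c => hmeas' (measurableSet_singleton c)) (fun c => hmeas (measurableSet_singleton c))
      (fun r r' h => by
        simp only
        rw [h y (by simpa using Ne.symm hxy)])
      fun c => ?_
    refine le_trans (measure_mono fun e he => ?_) (siteLaw_displ_le p ν hd hn i (c - x))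
    have he : x + displ e i n = c := he
    simp [← he]

end Collisions

section Growth

open Classical in
/-- The sites visited at the times and by the particles in `I` that run inside `Z`. -/
noncomputable def found (Z : Set (Site d)) (I : Finset (ℕ × ℕ)) (x : Site d) (e : SiteData d) :
    Finset (Site d) :=
  (I.filter fun q => Runs Z e q.1 q.2).image fun q => x + displ e q.1 q.2

theorem card_found_le (Z : Set (Site d)) (I : Finset (ℕ × ℕ)) (x : Site d) (e : SiteData d) :
    (found Z I x e).card ≤ I.card :=
  by
  classical exact Finset.card_image_le.trans (Finset.card_filter_le _ _)

theorem measFib_found (Z : Set (Site d)) (I : Finset (ℕ × ℕ)) (x : Site d) :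
    MeasFib (found Z I x) := by
  classical
  induction I using Finset.induction_on with
  | empty => exact measFib_const (Ω := SiteData d) (∅ : Finset (Site d))
  | insert q I hq ih =>
    have hm : Measurable fun e : SiteData d => x + displ e q.1 q.2 :=
      (measurable_displ q.1 q.2).const_add x
    have h1 : MeasFib fun e : SiteData d => insert (x + displ e q.1 q.2) (found Z I x e) :=
      ih.bind (F := fun D e => insert (x + displ e q.1 q.2) D) fun D =>
        MeasFib.comp (f := fun e : SiteData d => x + displ e q.1 q.2)
          (fun c => hm (measurableSet_singleton c)) fun y => insert y D
    have := MeasFib.ite (measurableSet_runs Z q.1 q.2) h1 ih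
    intro c
    convert this c using 4 with e
    simp only [found, Finset.filter_insert]
    split_ifs <;> simp [Finset.image_insert]

theorem exists_runs_of_mem_found {Z : Set (Site d)} {I : Finset (ℕ × ℕ)} {x y : Site d}
    {e : SiteData d} (h : y ∈ found Z I x e) :
    ∃ q ∈ I, Runs Z e q.1 q.2 ∧ x + displ e q.1 q.2 = y := by
  classical
  obtain ⟨q, hq, rfl⟩ := Finset.mem_image.1 h
  exact ⟨q, (Finset.mem_filter.1 hq).1, (Finset.mem_filter.1 hq).2, rfl⟩

variable (p : unitInterval) (ν : Measure ℕ) [IsProbabilityMeasure ν]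

/-- The number of successful runs from B is a sum of i.i.d. variables bounded by |I| with mean at
least a, so Chebyshev keeps it above t |B|. Unless two positions coincide or one falls in V,
distinct runs find distinct new sites; the second term is a union bound over these collisions. -/
theorem measure_found_lt_le (hd : 0 < d) (Z : Set (Site d)) {I : Finset (ℕ × ℕ)}
    (hI : ∀ q ∈ I, 1 ≤ q.2) {a t : ℝ} (hta : t < a)
    (ha : a ≤ ∑ q ∈ I, (siteLaw d p ν).real {e | Runs Z e q.1 q.2}) (V : Finset (Site d))
    {B : Finset (Site d)} (hB : B.Nonempty) :
    infinitePi (fun _ : Site d => siteLaw d p ν)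
      {r | ((discovered (found Z I) B r \ V).card : ℝ) < t * B.card}
      ≤ ENNReal.ofReal ((I.card : ℝ) ^ 2 / ((a - t) ^ 2 * B.card)) +
        ((B.card * I.card) * (B.card * I.card + V.card) : ℕ) * ((2 * d : ℕ) : ℝ≥0∞)⁻¹ := by
  classical
  set μ := infinitePi fun _ : Site d => siteLaw d p ν
  set δ : ℝ≥0∞ := ((2 * d : ℕ) : ℝ≥0∞)⁻¹
  let f : SiteData d → ℝ := fun e => ((I.filter fun q => Runs Z e q.1 q.2).card : ℝ)
  have hfeq : f = fun e => ∑ q ∈ I, {e | Runs Z e q.1 q.2}.indicator (fun _ => (1 : ℝ)) e := by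
    funext e
    simp only [f, Finset.card_filter, Nat.cast_sum, Set.indicator_apply, Set.mem_ofPred_eq]
    exact Finset.sum_congr rfl fun q _ => by split_ifs <;> simp
  have mf : Measurable f := by
    rw [hfeq]
    exact Finset.measurable_fun_sum _ fun q _ =>
      measurable_const.indicator (measurableSet_runs Z q.1 q.2)
  have hint : a ≤ ∫ e, f e ∂(siteLaw d p ν) := by
    refine ha.trans (le_of_eq ?_)
    rw [hfeq, integral_finsetSum _ fun q _ => (integrable_const (1 : ℝ)).indicator
      (measurableSet_runs Z q.1 q.2)]
    refine Finset.sum_congr rfl fun q _ => ?_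
    rw [integral_indicator_const _ (measurableSet_runs Z q.1 q.2)]; simp
  have hcheb := infinitePi_sum_lt_le (S := Site d) (siteLaw d p ν) mf (c := I.card)
    (fun e => ⟨by positivity, Nat.cast_le.2 (Finset.card_filter_le _ _)⟩) hta hint hB
  let J := B ×ˢ I
  let pos : (Site d → SiteData d) → Site d × ℕ × ℕ → Site d := fun r u =>
    u.1 + displ (r u.1) u.2.1 u.2.2
  -- The walks are defined for all labels in J, so collisions are counted whether or not the
  -- particles exist and are alive; no conditioning on the runs is needed.
  let N₁ : Set (Site d → SiteData d) := ⋃ u ∈ J, ⋃ u' ∈ J.filter (u ≠ ·), {r | pos r u = pos r u'}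
  let N₂ : Set (Site d → SiteData d) := ⋃ u ∈ J, ⋃ v ∈ V, {r | pos r u = v}
  have hJcard : J.card = B.card * I.card := Finset.card_product _ _
  have hN₁ : μ N₁ ≤ (J.card * J.card : ℕ) * δ := by
    calc μ N₁ ≤ ∑ u ∈ J, ∑ u' ∈ J.filter (u ≠ ·), μ {r | pos r u = pos r u'} :=
          (measure_biUnion_finset_le _ _).trans (Finset.sum_le_sum fun u _ =>
            measure_biUnion_finset_le _ _)
      _ ≤ ∑ u ∈ J, ∑ u' ∈ J.filter (u ≠ ·), δ := by
          refine Finset.sum_le_sum fun u hu => Finset.sum_le_sum fun u' hu' => ?_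
          rw [Finset.mem_filter] at hu'
          exact field_pos_eq_pos_le p ν hd (hI _ (Finset.mem_product.1 hu).2) hu'.2
      _ ≤ ∑ u ∈ J, J.card * δ := by
          refine Finset.sum_le_sum fun u hu => ?_
          rw [Finset.sum_const, nsmul_eq_mul]
          gcongr
          exact Finset.filter_subset _ _
      _ = (J.card * J.card : ℕ) * δ := by
          rw [Finset.sum_const, nsmul_eq_mul]; push_cast; ring
  have hN₂ : μ N₂ ≤ (J.card * V.card : ℕ) * δ := by
    calc μ N₂ ≤ ∑ u ∈ J, ∑ v ∈ V, μ {r | pos r u = v} :=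
          (measure_biUnion_finset_le _ _).trans (Finset.sum_le_sum fun u _ =>
            measure_biUnion_finset_le _ _)
      _ ≤ ∑ u ∈ J, ∑ v ∈ V, δ := by
          refine Finset.sum_le_sum fun u hu => Finset.sum_le_sum fun v _ => ?_
          exact field_pos_le p ν hd (hI _ (Finset.mem_product.1 hu).2) _ _ _
      _ = (J.card * V.card : ℕ) * δ := by
          simp only [Finset.sum_const, nsmul_eq_mul]; push_cast; ring
  have hsub : {r | ((discovered (found Z I) B r \ V).card : ℝ) < t * B.card} ⊆
      {r | ∑ b ∈ B, f (r b) < t * B.card} ∪ (N₁ ∪ N₂) := by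
    intro r hr
    by_contra hcon
    simp only [Set.mem_union, not_or] at hcon
    obtain ⟨h1, h2, h3⟩ := hcon
    have hinj : ∀ u ∈ J, ∀ u' ∈ J, pos r u = pos r u' → u = u' := by
      intro u hu u' hu' h
      by_contra hne
      refine h2 (Set.mem_biUnion hu (Set.mem_biUnion (Finset.mem_filter.2 ⟨hu', hne⟩) h))
    have hV : ∀ u ∈ J, pos r u ∉ V := by
      intro u hu h
      exact h3 (Set.mem_biUnion hu (Set.mem_biUnion h rfl))
    let R := J.filter fun u => Runs Z (r u.1) u.2.1 u.2.2
    have hRsub : R.image (pos r) ⊆ discovered (found Z I) B r \ V := by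
      intro y hy
      obtain ⟨u, hu, rfl⟩ := Finset.mem_image.1 hy
      obtain ⟨huJ, hrun⟩ := Finset.mem_filter.1 hu
      refine Finset.mem_sdiff.2 ⟨?_, hV u huJ⟩
      have huB := Finset.mem_product.1 huJ
      refine Finset.mem_biUnion.2 ⟨u.1, huB.1, ?_⟩
      exact Finset.mem_image.2 ⟨u.2, Finset.mem_filter.2 ⟨huB.2, hrun⟩, rfl⟩
    have hRcard : (R.image (pos r)).card = R.card :=
      Finset.card_image_of_injOn fun u hu u' hu' h =>
        hinj u (Finset.mem_filter.1 hu).1 u' (Finset.mem_filter.1 hu').1 h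
    have hRsum : (R.card : ℝ) = ∑ b ∈ B, f (r b) := by
      simp only [R, J, f, Finset.card_filter, Finset.sum_product]
      push_cast
      rfl
    have hle : (R.card : ℝ) ≤ ((discovered (found Z I) B r \ V).card : ℝ) := by
      rw [← hRcard]; exact_mod_cast Finset.card_le_card hRsub
    have hr : ((discovered (found Z I) B r \ V).card : ℝ) < t * B.card := hr
    exact h1 (show ∑ b ∈ B, f (r b) < t * B.card by rw [← hRsum]; linarith)
  calc _ ≤ μ {r | ∑ b ∈ B, f (r b) < t * B.card} + (μ N₁ + μ N₂) :=
        (measure_mono hsub).trans ((measure_union_le _ _).trans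
          (by gcongr; exact measure_union_le _ _))
    _ ≤ ENNReal.ofReal ((I.card : ℝ) ^ 2 / ((a - t) ^ 2 * B.card)) +
        ((J.card * J.card : ℕ) * δ + (J.card * V.card : ℕ) * δ) := by gcongr
    _ = _ := by rw [hJcard]; push_cast; ring

end Growth

end Frog

/-! ### Measurability, translation invariance and truncation -/

namespace Frog

open Measure
open scoped ENNReal

variable {d : ℕ}

theorem measurableSet_reachable {Ω S : Type*} [MeasurableSpace Ω] [Countable S]
    {R : Ω → S → S → Prop} (hR : ∀ x y, MeasurableSet {r | R r x y}) (a y : S) :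
    MeasurableSet {r | Relation.ReflTransGen (R r) a y} := by
  let T : ℕ → S → Set Ω := fun n => Nat.rec (fun y => {_r | a = y})
    (fun _ t y => ⋃ x, t x ∩ {r | R r x y}) n
  have hT : ∀ n y, MeasurableSet (T n y) := by
    intro n
    induction n with
    | zero => exact fun y => MeasurableSet.const _
    | succ n ih => exact fun y => MeasurableSet.iUnion fun x => (ih x).inter (hR x y)
  have : {r | Relation.ReflTransGen (R r) a y} = ⋃ n, T n y := by
    ext r
    rw [Set.mem_iUnion]
    constructor
    · intro h
      change Relation.ReflTransGen (R r) a y at h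
      induction h with
      | refl => exact ⟨0, rfl⟩
      | @tail x y _ hxy ih =>
        obtain ⟨n, hn⟩ := ih
        exact ⟨n + 1, Set.mem_iUnion.2 ⟨x, hn, hxy⟩⟩
    · rintro ⟨n, hn⟩
      change Relation.ReflTransGen (R r) a y
      induction n generalizing y with
      | zero => cases (show a = y from hn); exact .refl
      | succ n ih =>
        obtain ⟨x, hx, hxy⟩ := Set.mem_iUnion.1 hn
        exact (ih x hx).tail hxy
  rw [this]
  exact MeasurableSet.iUnion fun n => hT n y

theorem measurableSet_infinite {Ω S : Type*} [MeasurableSpace Ω] [Countable S]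
    {P : Ω → S → Prop} (hP : ∀ y, MeasurableSet {r | P r y}) :
    MeasurableSet {r | {y | P r y}.Infinite} := by
  have : {r | {y | P r y}.Infinite} = ⋂ F : Finset S, ⋃ y ∈ {y | y ∉ F}, {r | P r y} := by
    ext r
    simp only [Set.mem_ofPred_eq, Set.mem_iInter, Set.mem_iUnion, exists_prop]
    constructor
    · intro h F
      obtain ⟨y, hy, hy'⟩ := h.exists_notMem_finset F
      exact ⟨y, hy', hy⟩
    · intro h hfin
      obtain ⟨y, hy, hy'⟩ := h hfin.toFinset
      exact hy (hfin.mem_toFinset.2 hy')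
  rw [this]
  exact MeasurableSet.iInter fun F => MeasurableSet.biUnion (Set.to_countable _) fun y _ => hP y

theorem visits_iff_runs {e : SiteData d} {x y : Site d} :
    Visits e x y ↔ ∃ i n, Runs Set.univ e i n ∧ x + displ e i n = y := by
  simp only [Visits, Runs, displ]
  constructor
  · rintro ⟨i, hi, n, hn, h⟩; exact ⟨i, n, ⟨hi, hn, by simp⟩, h⟩
  · rintro ⟨i, n, ⟨hi, hn, -⟩, h⟩; exact ⟨i, hi, n, hn, h⟩

theorem measurableSet_visits (x y : Site d) : MeasurableSet {e : SiteData d | Visits e x y} := by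
  have : {e : SiteData d | Visits e x y} = ⋃ i : ℕ, ⋃ n : ℕ,
      {e | Runs Set.univ e i n} ∩ {e | x + displ e i n = y} := by
    ext e; simp [visits_iff_runs]
  rw [this]
  refine MeasurableSet.iUnion fun i => MeasurableSet.iUnion fun n =>
    (measurableSet_runs _ i n).inter ?_
  exact ((measurable_displ i n).const_add x) (measurableSet_singleton y)

/-- The graph of direct visits. -/
def VisitRel (r : Site d → SiteData d) (x y : Site d) : Prop := Visits (r x) x y

theorem measurableSet_infinite_cluster (a : Site d) :
    MeasurableSet {r : Site d → SiteData d |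
      {y | Relation.ReflTransGen (VisitRel r) a y}.Infinite} := by
  refine measurableSet_infinite fun y => measurableSet_reachable (fun x z => ?_) a y
  exact (measurable_pi_apply (X := fun _ : Site d => SiteData d) x) (measurableSet_visits x z)

/-- The expectation as the sum of the tail probabilities. -/
theorem tsum_tail (ν : Measure ℕ) (hint : Integrable (fun n : ℕ => (n : ℝ)) ν) :
    ∑' i : ℕ, ν {m | i < m} = ENNReal.ofReal (∫ n : ℕ, (n : ℝ) ∂ν) := by
  rw [ofReal_integral_eq_lintegral_ofReal hint (Eventually.of_forall fun n => by positivity)]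
  have h1 : ∀ n : ℕ, ENNReal.ofReal (n : ℝ)
      = ∑' i : ℕ, {m : ℕ | i < m}.indicator (fun _ => (1 : ℝ≥0∞)) n := by
    intro n
    rw [tsum_eq_sum (s := Finset.range n)]
    · rw [Finset.sum_congr rfl fun i hi => Set.indicator_of_mem (by simpa using hi) _]
      simp
    · intro i hi
      exact Set.indicator_of_notMem (by simpa using hi) _
  simp only [h1]
  rw [lintegral_tsum fun i => Measurable.aemeasurable (Measurable.of_discrete)]
  refine tsum_congr fun i => ?_
  rw [lintegral_indicator (MeasurableSet.of_discrete)]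
  simp

variable (p : unitInterval) (ν : Measure ℕ) [IsProbabilityMeasure ν]

/-- The cluster of a site is a translate of the cluster of the origin. -/
theorem measure_infinite_cluster_le (a : Site d) :
    infinitePi (fun _ : Site d => siteLaw d p ν)
      {r | {y | Relation.ReflTransGen (VisitRel r) a y}.Infinite} ≤
    infinitePi (fun _ : Site d => siteLaw d p ν)
      {r | {y | Relation.ReflTransGen (VisitRel r) 0 y}.Infinite} := by
  let τ : (Site d → SiteData d) → (Site d → SiteData d) := fun r x => r (x + a)
  have hτ : (infinitePi fun _ : Site d => siteLaw d p ν).map τ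
      = infinitePi fun _ : Site d => siteLaw d p ν :=
    map_infinitePi_infinitePi_of_inj (P := fun _ : Site d => siteLaw d p ν)
      (f := fun x : Site d => x + a) (add_left_injective a)
  have mτ : Measurable τ := by fun_prop
  conv_rhs => rw [← hτ]
  refine le_trans (measure_mono ?_) (le_map_apply mτ.aemeasurable _)
  intro r hr
  have hrel : ∀ x y, VisitRel r (x + a) (y + a) → VisitRel (τ r) x y := by
    rintro x y ⟨i, hi, n, hn, h⟩
    refine ⟨i, hi, n, hn, ?_⟩
    rw [add_right_comm] at h
    exact add_right_cancel h
  have hreach : ∀ y, Relation.ReflTransGen (VisitRel r) a y →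
      Relation.ReflTransGen (VisitRel (τ r)) 0 (y - a) := by
    intro y h
    induction h with
    | refl => rw [sub_self]
    | @tail x y _ hxy ih => exact ih.tail (hrel _ _ (by simpa using hxy))
  refine Set.Infinite.mono (s := (fun y => y - a) '' {y | Relation.ReflTransGen (VisitRel r) a y})
    ?_ (Set.Infinite.image (sub_left_injective.injOn) hr)
  rintro _ ⟨y, hy, rfl⟩
  exact hreach y hy

/-- The block construction gives an infinite cluster from some site a of the initial set, not
necessarily the origin; translation invariance repairs this. -/
theorem frogLaw_survives_pos {a : Site d} (h : 0 < infinitePi (fun _ : Site d => siteLaw d p ν)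
      {r | {y | Relation.ReflTransGen (VisitRel r) a y}.Infinite}) :
    0 < frogLaw d p ν {ω | Survives ω} := by
  have h0 := h.trans_le (measure_infinite_cluster_le p ν a)
  rw [← map_toField, map_apply measurable_toField (measurableSet_infinite_cluster 0)] at h0
  refine h0.trans_le (measure_mono fun ω hω => survives_of_infinite ?_)
  have hω : {y | Relation.ReflTransGen (VisitRel (toField ω)) 0 y}.Infinite := hω
  refine hω.mono fun y hy => ?_
  exact reachable_iff.1 hy

theorem tendsto_tail (hint : Integrable (fun n : ℕ => (n : ℝ)) ν) :
    Tendsto (fun K => ∑ i ∈ Finset.range K, ν.real {m | i < m}) atTop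
      (𝓝 (∫ n : ℕ, (n : ℝ) ∂ν)) := by
  have h := tsum_tail ν hint
  have hs : HasSum (fun i => ν.real {m | i < m}) (∫ n : ℕ, (n : ℝ) ∂ν) := by
    have := ENNReal.hasSum_toReal (f := fun i : ℕ => ν {m | i < m}) (by rw [h]; simp)
    rw [← ENNReal.tsum_toReal_eq (fun i => measure_ne_top _ _), h,
      ENNReal.toReal_ofReal (integral_nonneg fun n => by positivity)] at this
    exact this
  exact hs.tendsto_sum_nat

theorem tendsto_geom {x : ℝ} (h0 : 0 ≤ x) (h1 : x < 1) :
    Tendsto (fun K => ∑ n ∈ Finset.Icc 1 K, x ^ n) atTop (𝓝 (x / (1 - x))) := by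
  have h := ((hasSum_geometric_of_lt_one h0 h1).mul_left x).tendsto_sum_nat
  rw [← div_eq_mul_inv] at h
  refine h.congr fun K => ?_
  rw [Finset.range_eq_Ico, ← Finset.Ico_add_one_right_eq_Icc,
    ← Finset.sum_Ico_add' (fun n => x ^ n) 0 K 1]
  simp [pow_succ']

/-- The condition x (1 + m) > 1 says that m x / (1 - x) > 1, and this is the limit of the products
of the truncated sums. -/
theorem exists_truncation (hint : Integrable (fun n : ℕ => (n : ℝ)) ν) {x : ℝ} (h0 : 0 ≤ x)
    (h1 : x < 1) (h : 1 < x * (1 + ∫ n : ℕ, (n : ℝ) ∂ν)) :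
    ∃ K : ℕ, 1 < (∑ i ∈ Finset.range K, ν.real {m | i < m}) * ∑ n ∈ Finset.Icc 1 K, x ^ n := by
  have hlim := (tendsto_tail ν hint).mul (tendsto_geom h0 h1)
  have : 1 < (∫ n : ℕ, (n : ℝ) ∂ν) * (x / (1 - x)) := by
    rw [← mul_div_assoc, lt_div_iff₀ (by linarith)]; linarith
  exact (hlim.eventually (lt_mem_nhds this)).exists

end Frog

/-! ### The block construction for frogs -/

namespace Frog

open Measure
open scoped ENNReal

variable {d : ℕ}

/-- Inside a layer, use the particles `i < K` for at most `K` neutral steps; between layers, use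
the first step of the first particle. -/
noncomputable def frogRule (d q K L : ℕ) (size : ℕ → ℕ) : BlockRule (Site d) (SiteData d) where
  child := found {z | layer d q z = 0} (Finset.range K ×ˢ Finset.Icc 1 K)
  exit₁ := found {z | layer d q z = (1, 0)} {(0, 1)}
  exit₂ := found {z | layer d q z = (0, 1)} {(0, 1)}
  gens := L
  size := size

theorem layer_sum (q : ℕ) (s : Finset ℕ) (f : ℕ → Site d) (h : ∀ k ∈ s, layer d q (f k) = 0) :
    layer d q (∑ k ∈ s, f k) = 0 := by
  classical
  induction s using Finset.induction_on with
  | empty => simp [layer_zero]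
  | insert a s ha ih =>
    rw [Finset.sum_insert ha, layer_add, h a (Finset.mem_insert_self a s),
      ih fun k hk => h k (Finset.mem_insert_of_mem hk), add_zero]

theorem layer_of_mem_found_neutral {q : ℕ} {I : Finset (ℕ × ℕ)} {x y : Site d} {e : SiteData d}
    (h : y ∈ found {z | layer d q z = 0} I x e) : layer d q y = layer d q x := by
  obtain ⟨u, -, hr, rfl⟩ := exists_runs_of_mem_found h
  rw [layer_add, displ, layer_sum, add_zero]
  exact fun k hk => hr.2.2 k (Finset.mem_range.1 hk)

theorem layer_of_mem_found_first {q : ℕ} {w : ℤ × ℤ} {x y : Site d} {e : SiteData d}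
    (h : y ∈ found {z | layer d q z = w} {(0, 1)} x e) : layer d q y = layer d q x + w := by
  obtain ⟨u, hu, hr, rfl⟩ := exists_runs_of_mem_found h
  rw [Finset.mem_singleton] at hu
  subst hu
  rw [layer_add, displ]
  have := hr.2.2 0 one_pos
  simp only [Finset.sum_range_one]
  rw [show layer d q (e.2.1 0 0) = w from this]

theorem visitRel_of_leads {q K L : ℕ} {size : ℕ → ℕ} {r : Site d → SiteData d} {x y : Site d}
    (h : (frogRule d q K L size).Leads r x y) : VisitRel r x y := by
  have key : ∀ {Z I}, y ∈ found Z I x (r x) → VisitRel r x y := by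
    intro Z I h
    obtain ⟨u, -, hr, h⟩ := exists_runs_of_mem_found h
    exact visits_iff_runs.2 ⟨u.1, u.2, ⟨hr.1, hr.2.1, fun _ _ => trivial⟩, h⟩
  rcases h with h | h | h
  exacts [key h, key h, key h]

theorem exists_finset_layer_zero {q : ℕ} (hq : 2 * q < d) (M : ℕ) :
    ∃ A : Finset (Site d), A.card = M ∧ ∀ x ∈ A, layer d q x = 0 := by
  classical
  -- Coordinate 2q belongs to neither block, so the multiples of its unit vector lie in layer 0.
  refine ⟨(Finset.range M).image fun k : ℕ => (Pi.single ⟨2 * q, hq⟩ (k : ℤ) : Site d), ?_, ?_⟩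
  · rw [Finset.card_image_of_injective, Finset.card_range]
    intro k l h
    have := congrFun h ⟨2 * q, hq⟩
    simpa using this
  · intro x hx
    obtain ⟨k, -, rfl⟩ := Finset.mem_image.1 hx
    have e1 : ¬ 2 * q < q := by omega
    rw [layer_single]
    simp [e1]

variable (p : unitInterval) (ν : Measure ℕ) [IsProbabilityMeasure ν]

theorem siteLaw_real_runs (Z : Set (Site d)) (i n : ℕ) : (siteLaw d p ν).real {e | Runs Z e i n} =
    ν.real {m | i < m} * ((stepLaw d).real Z ^ n * (p : ℝ) ^ n) := by
  rw [measureReal_def, siteLaw_runs, ENNReal.toReal_mul, ENNReal.toReal_mul, ENNReal.toReal_pow,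
    ENNReal.toReal_ofReal (pow_nonneg p.2.1 n)]
  rfl

/-- The numerical conditions under which the block construction works. -/
theorem frogLaw_survives_pos_of_bounds {q K L M : ℕ} {θ c δ : ℝ} (hM : 0 < M) (hθ : 0 < θ)
    (hc : 0 < c) (hq : 2 * q < d)
    (hchild : 1 + 2 * θ ≤ ∑ u ∈ Finset.range K ×ˢ Finset.Icc 1 K,
      (siteLaw d p ν).real {e | Runs {z | layer d q z = 0} e u.1 u.2})
    (hexit₁ : 2 * c ≤ (siteLaw d p ν).real {e | Runs {z | layer d q z = (1, 0)} e 0 1})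
    (hexit₂ : 2 * c ≤ (siteLaw d p ν).real {e | Runs {z | layer d q z = (0, 1)} e 0 1})
    (hL : 1 ≤ c * (1 + θ) ^ L)
    (hM₁ : ((K * K : ℕ) : ℝ) ^ 2 / (θ ^ 2 * M) ≤ δ) (hM₂ : 1 / (c ^ 2 * M) ≤ δ)
    (hcoll : (((1 + K * K) ^ L * M * (1 + K * K)) * ((1 + K * K) ^ L * M * (2 + K * K)) : ℕ)
      * ((2 * d : ℕ) : ℝ≥0∞)⁻¹ ≤ ENNReal.ofReal δ)
    (hLδ : (L + 2) * (2 * ENNReal.ofReal δ) ≤ (1 / 128 : ℝ≥0∞) ^ 4) :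
    0 < frogLaw d p ν {ω | Survives ω} := by
  have hd : 0 < d := by omega
  -- The mean offspring is at least 1 + 2θ; growth by 1 + θ per generation is demanded, which leaves
  -- θ as the margin for Chebyshev.
  let size : ℕ → ℕ := fun j => ⌈(1 + θ) ^ j * M⌉₊
  have hsize0 : size 0 = M := by simp [size]
  have hsizeM : ∀ j, M ≤ size j := fun j => by
    have h1 : (M : ℝ) ≤ (1 + θ) ^ j * M :=
      le_mul_of_one_le_left (by positivity) (one_le_pow₀ (by linarith))
    exact_mod_cast h1.trans (Nat.le_ceil _)
  have hMpos : (0 : ℝ) < M := by exact_mod_cast hM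
  set b := frogRule d q K L size with hb
  -- All sites ever used in one layer number at most `bound`, by `card_explore_le` with at most K *
  -- K children per site.
  set bound := (1 + K * K) ^ L * M with hbound
  have hcardI : (Finset.range K ×ˢ Finset.Icc 1 K).card = K * K := by
    simp [Finset.card_product]
  have collbound : ∀ x y : ℕ, x ≤ bound * (1 + K * K) → y ≤ bound * (2 + K * K) →
      ((x * y : ℕ) : ℝ≥0∞) * ((2 * d : ℕ) : ℝ≥0∞)⁻¹ ≤ ENNReal.ofReal δ := by
    intro x y hx hy
    refine le_trans ?_ hcoll
    gcongr
  have hchildM : ∀ x e, (b.child x e).card ≤ K * K := fun x e =>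
    hcardI ▸ card_found_le _ _ x e
  have mC : ∀ x, MeasFib (b.child x) := fun x => measFib_found _ _ x
  have m1 : ∀ x, MeasFib (b.exit₁ x) := fun x => measFib_found _ _ x
  have m2 : ∀ x, MeasFib (b.exit₂ x) := fun x => measFib_found _ _ x
  have hgrow : ∀ j < b.gens, ∀ V B : Finset (Site d), Disjoint V B → b.size j ≤ B.card →
      (V ∪ B).card ≤ (1 + K * K) ^ b.gens * b.size 0 →
      infinitePi (fun _ : Site d => siteLaw d p ν)
        {r | (discovered b.child B r \ (V ∪ B)).card < b.size (j + 1)} ≤ 2 * ENNReal.ofReal δ := by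
    intro j _ V B _ hBj hVB
    have hVB : (V ∪ B).card ≤ bound := by rw [hbound, ← hsize0]; exact hVB
    have hBM : M ≤ B.card := (hsizeM j).trans hBj
    have hBb : B.card ≤ bound := (Finset.card_le_card Finset.subset_union_right).trans hVB
    have hBne : B.Nonempty := Finset.card_pos.1 (hM.trans_le hBM)
    have hBj' : (1 + θ) ^ j * M ≤ B.card := Nat.ceil_le.1 hBj
    have key := measure_found_lt_le p ν hd {z | layer d q z = 0}
      (I := Finset.range K ×ˢ Finset.Icc 1 K)
      (fun u hu => (Finset.mem_Icc.1 (Finset.mem_product.1 hu).2).1) (t := 1 + θ)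
      (a := 1 + 2 * θ) (by linarith) hchild (V ∪ B) hBne
    refine (measure_mono fun r hr => ?_).trans (key.trans ?_)
    · have hr : (discovered b.child B r \ (V ∪ B)).card < ⌈(1 + θ) ^ (j + 1) * M⌉₊ := hr
      refine (Nat.lt_ceil.1 hr).trans_le ?_
      rw [pow_succ', mul_assoc]
      gcongr
    -- One δ pays for Chebyshev, by the choice of M, and one for the collisions, by the choice of d.
    · rw [two_mul (ENNReal.ofReal δ)]
      refine add_le_add (ENNReal.ofReal_le_ofReal ?_) ?_
      · refine le_trans ?_ hM₁
        rw [hcardI]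
        have e : 1 + 2 * θ - (1 + θ) = θ := by ring
        rw [e]
        gcongr
      · rw [hcardI]
        refine collbound _ _ ?_ ?_
        · calc B.card * (K * K) ≤ bound * (K * K) := by gcongr
            _ ≤ bound * (1 + K * K) := by gcongr; omega
        · calc B.card * (K * K) + (V ∪ B).card ≤ bound * (K * K) + bound := by gcongr
            _ ≤ bound * (2 + K * K) := by nlinarith
  have hexit : ∀ w : ℤ × ℤ, 2 * c ≤ (siteLaw d p ν).real {e | Runs {z | layer d q z = w} e 0 1} →
      ∀ B : Finset (Site d), b.size b.gens ≤ B.card → B.card ≤ (1 + K * K) ^ b.gens * b.size 0 →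
      infinitePi (fun _ : Site d => siteLaw d p ν)
        {r | (discovered (found {z | layer d q z = w} {(0, 1)}) B r).card < b.size 0}
        ≤ 2 * ENNReal.ofReal δ := by
    intro w hw B hBj hBb
    have hBb : B.card ≤ bound := by rw [hbound, ← hsize0]; exact hBb
    have hBM : M ≤ B.card := (hsizeM L).trans hBj
    have hBne : B.Nonempty := Finset.card_pos.1 (hM.trans_le hBM)
    have hBj' : (1 + θ) ^ L * M ≤ B.card := Nat.ceil_le.1 hBj
    have key := measure_found_lt_le p ν hd {z | layer d q z = w} (I := {(0, 1)})
      (fun u hu => by rw [Finset.mem_singleton.1 hu]) (t := c)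
      (a := 2 * c) (by linarith) (by simpa using hw) ∅ hBne
    refine (measure_mono fun r hr => ?_).trans (key.trans ?_)
    · have hr : (discovered (found {z | layer d q z = w} {(0, 1)}) B r).card < size 0 := hr
      rw [hsize0] at hr
      -- The last generation has at least (1 + θ) ^ L * M sites; by the choice of L a proportion c
      -- of them already amounts to M exits, while 2c are expected per site.
      have h1 : (M : ℝ) ≤ c * B.card := by
        calc (M : ℝ) = 1 * M := (one_mul _).symm
          _ ≤ (c * (1 + θ) ^ L) * M := by gcongr
          _ = c * ((1 + θ) ^ L * M) := by ring
          _ ≤ c * B.card := by gcongr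
      simp only [Set.mem_ofPred_eq, Finset.sdiff_empty]
      refine lt_of_lt_of_le ?_ h1
      exact_mod_cast hr
    · rw [two_mul (ENNReal.ofReal δ)]
      refine add_le_add (ENNReal.ofReal_le_ofReal ?_) ?_
      · refine le_trans ?_ hM₂
        have e : 2 * c - c = c := by ring
        rw [e]
        simp only [Finset.card_singleton, Nat.cast_one, one_pow]
        gcongr
      · refine collbound _ _ ?_ ?_
        · simp only [Finset.card_singleton, mul_one]
          nlinarith [Nat.zero_le (K * K)]
        · simp only [Finset.card_singleton, mul_one, Finset.card_empty, add_zero]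
          nlinarith [Nat.zero_le (K * K)]
  obtain ⟨A₀, hA₀, hφ⟩ := exists_finset_layer_zero hq M
  have hgood : ∀ A : Finset (Site d), A.card = b.size 0 →
      infinitePi (fun _ : Site d => siteLaw d p ν) {r | ¬ b.Good A r} ≤ (1 / 128 : ℝ≥0∞) ^ 4 :=
    fun A hA => (b.measure_not_good_le (siteLaw d p ν) mC m1 m2 hchildM hgrow (hexit _ hexit₁)
      (hexit _ hexit₂) hA).trans hLδ
  obtain ⟨a, -, ha⟩ := BlockRule.exists_pos_infinite_reachable (b := b) (A₀ := A₀)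
    (φ := layer d q) (siteLaw d p ν) mC m1 m2
    (fun x e y hy => layer_of_mem_found_neutral hy) (fun x e y hy => layer_of_mem_found_first hy)
    (fun x e y hy => layer_of_mem_found_first hy) hφ (hA₀.trans hsize0.symm)
    (show 0 < size 0 by rw [hsize0]; exact hM) hgood
  refine frogLaw_survives_pos p ν (a := a) (ha.trans_le (measure_mono fun r hr => ?_))
  exact Set.Infinite.mono (fun y hy => Relation.ReflTransGen.mono
    (fun x y h => visitRel_of_leads h) _ _ hy) hr

end Frog

/-! ### Survival above the threshold in high dimension -/

namespace Frog

open Measure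
open scoped ENNReal

theorem exists_pos_mul_ofReal_le (L : ℕ) :
    ∃ δ : ℝ, 0 < δ ∧ (L + 2) * (2 * ENNReal.ofReal δ) ≤ (1 / 128 : ℝ≥0∞) ^ 4 := by
  refine ⟨(1 / 128) ^ 4 / ((L + 2) * 2), by positivity, le_of_eq ?_⟩
  have h1 : ((L : ℝ≥0∞) + 2) = ENNReal.ofReal (L + 2) := by
    rw [ENNReal.ofReal_add (by positivity) (by norm_num)]; simp
  have h2 : (2 : ℝ≥0∞) = ENNReal.ofReal 2 := by simp
  have h3 : (1 / 128 : ℝ≥0∞) = ENNReal.ofReal (1 / 128) := by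
    rw [ENNReal.ofReal_div_of_pos (by norm_num)]; simp
  rw [h1, h3, ← ENNReal.ofReal_pow (by norm_num)]
  rw [h2]
  rw [← ENNReal.ofReal_mul (by norm_num), ← ENNReal.ofReal_mul (by positivity)]
  congr 1
  field_simp

theorem eventually_mul_inv_le (C : ℕ) {δ : ℝ} (hδ : 0 < δ) :
    ∀ᶠ d : ℕ in atTop, (C : ℝ≥0∞) * ((2 * d : ℕ) : ℝ≥0∞)⁻¹ ≤ ENNReal.ofReal δ := by
  have h1 : Tendsto (fun d : ℕ => 2 * d) atTop atTop :=
    tendsto_id.const_mul_atTop' (by norm_num)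
  have h2 := ENNReal.Tendsto.const_mul (a := (C : ℝ≥0∞))
    (ENNReal.tendsto_inv_nat_nhds_zero.comp h1) (Or.inr (ENNReal.natCast_ne_top C))
  rw [mul_zero] at h2
  exact (h2.eventually (gt_mem_nhds (ENNReal.ofReal_pos.2 hδ))).mono fun d hd => hd.le

theorem eventually_div_le (C : ℝ) {a δ : ℝ} (ha : 0 < a) (hδ : 0 < δ) :
    ∀ᶠ M : ℕ in atTop, C / (a * M) ≤ δ := by
  have h : Tendsto (fun M : ℕ => C / (a * M)) atTop (𝓝 0) :=
    tendsto_const_nhds.div_atTop (tendsto_natCast_atTop_atTop.const_mul_atTop ha)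
  exact (h.eventually (gt_mem_nhds hδ)).mono fun M hM => hM.le

/-- Above `1 / (1 + E η)` the process survives in high dimension. -/
theorem eventually_survives_pos (ν : Measure ℕ) [IsProbabilityMeasure ν]
    (hpos : 0 < ν {n : ℕ | 1 ≤ n}) (hint : Integrable (fun n : ℕ => (n : ℝ)) ν) (p : unitInterval)
    (h0 : 0 < (p : ℝ)) (h1 : (p : ℝ) < 1) (h : 1 < (p : ℝ) * (1 + ∫ n : ℕ, (n : ℝ) ∂ν)) :
    ∀ᶠ d : ℕ in atTop, 0 < frogLaw d p ν {ω | Survives ω} := by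
  obtain ⟨K, hK⟩ := exists_truncation ν hint h0.le h1 h
  set lam : ℝ := (∑ i ∈ Finset.range K, ν.real {m | i < m}) * ∑ n ∈ Finset.Icc 1 K, (p : ℝ) ^ n
    with hlam
  -- With blocks of size d / N a step is neutral with probability at least 1 - 2 / N; K neutral
  -- steps in a row must not spoil the mean. The condition N ≥ 3 leaves coordinates outside both
  -- blocks.
  obtain ⟨N, hN, hN3⟩ : ∃ N : ℕ, 1 < lam * (1 - 2 / (N : ℝ)) ^ K ∧ 3 ≤ N := by
    have ht : Tendsto (fun N : ℕ => lam * (1 - 2 / (N : ℝ)) ^ K) atTop (𝓝 (lam * (1 - 0) ^ K)) :=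
      ((tendsto_const_nhds.sub (tendsto_const_div_atTop_nhds_zero_nat 2)).pow K).const_mul lam
    exact ((ht.eventually (lt_mem_nhds (by simpa using hK))).and (eventually_ge_atTop 3)).exists
  have hNpos : (0 : ℝ) < N := by exact_mod_cast (by omega : 0 < N)
  have hs1 : 2 / (N : ℝ) ≤ 1 := by
    rw [div_le_one hNpos]; exact_mod_cast (by omega : 2 ≤ N)
  set s : ℝ := 1 - 2 / (N : ℝ) with hs
  have hs0 : 0 ≤ s := by rw [hs]; linarith
  have hs1 : s ≤ 1 := by rw [hs]; linarith [div_pos (two_pos : (0 : ℝ) < 2) hNpos]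
  obtain ⟨θ, hθ, hθeq⟩ : ∃ θ : ℝ, 0 < θ ∧ 1 + 2 * θ = lam * s ^ K :=
    ⟨(lam * s ^ K - 1) / 2, by linarith, by ring⟩
  have hν : 0 < ν.real {m | 0 < m} :=
    ENNReal.toReal_pos (by simpa [Nat.lt_iff_add_one_le] using hpos.ne') (measure_ne_top _ _)
  -- The product bounds below the probability that the first particle exists, steps into the given
  -- next layer and is then alive.
  obtain ⟨c, hc, hceq⟩ : ∃ c : ℝ, 0 < c ∧ 2 * c = ν.real {m | 0 < m} * (1 / (4 * N) * p) :=
    ⟨ν.real {m | 0 < m} * (1 / (4 * N) * p) / 2, by positivity, by ring⟩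
  obtain ⟨L, hL⟩ : ∃ L : ℕ, 1 / c < (1 + θ) ^ L := pow_unbounded_of_one_lt _ (by linarith)
  have hL : 1 ≤ c * (1 + θ) ^ L := by
    rw [div_lt_iff₀' hc] at hL; exact hL.le
  -- L growth steps and two exits, each failing with probability at most 2δ.
  obtain ⟨δ, hδ, hLδ⟩ := exists_pos_mul_ofReal_le L
  obtain ⟨M, ⟨hM₁, hM₂⟩, hM⟩ := (((eventually_div_le (((K * K : ℕ) : ℝ) ^ 2) (pow_pos hθ 2) hδ).and
    (eventually_div_le 1 (pow_pos hc 2) hδ)).and (eventually_gt_atTop 0)).exists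
  -- Only now is d taken large: K, N, L, M and δ are fixed, so the number of potential collisions is
  -- constant.
  filter_upwards [eventually_ge_atTop N, eventually_mul_inv_le
    (((1 + K * K) ^ L * M * (1 + K * K)) * ((1 + K * K) ^ L * M * (2 + K * K))) hδ] with d hdN hcoll
  have hd : 0 < d := by omega
  have hdpos : (0 : ℝ) < d := by exact_mod_cast hd
  set q := d / N with hq
  have hqN : N * q ≤ d := Nat.mul_div_le d N
  have hqN' : d < N * (q + 1) := Nat.lt_mul_div_succ d (by omega)
  have hq1 : 1 ≤ q := (Nat.one_le_div_iff (by omega)).2 hdN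
  have h2q : 2 * q < d := by nlinarith
  have hneutral : s ≤ (stepLaw d).real {z | layer d q z = 0} := by
    refine le_trans ?_ (le_stepLaw_neutral hd h2q.le)
    rw [hs, sub_le_sub_iff_left, div_le_div_iff₀ hdpos hNpos]
    have : (N : ℝ) * q ≤ d := by exact_mod_cast hqN
    nlinarith
  -- As q ≥ 1, d < N (q + 1) ≤ 2 N q.
  have hexit : 1 / (4 * (N : ℝ)) ≤ (q : ℝ) / (2 * d) := by
    rw [div_le_div_iff₀ (by positivity) (by positivity)]
    have : (d : ℝ) ≤ N * (2 * q) := by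
      exact_mod_cast hqN'.le.trans (Nat.mul_le_mul_left N (by omega))
    nlinarith
  refine frogLaw_survives_pos_of_bounds p ν hM hθ hc h2q ?_ ?_ ?_ hL hM₁ hM₂ hcoll hLδ
  · rw [hθeq, hlam, Finset.sum_mul_sum, Finset.sum_product, Finset.sum_mul]
    refine Finset.sum_le_sum fun i _ => ?_
    rw [Finset.sum_mul]
    refine Finset.sum_le_sum fun n hn => ?_
    rw [siteLaw_real_runs, mul_assoc, mul_comm ((p : ℝ) ^ n)]
    -- Runs have length n ≤ K and s ≤ 1, so s ^ K is a uniform loss that factors out of the sum.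
    have h3 : s ^ K ≤ (stepLaw d).real {z | layer d q z = 0} ^ n :=
      (pow_le_pow_of_le_one hs0 hs1 (Finset.mem_Icc.1 hn).2).trans (by gcongr)
    gcongr
  · rw [siteLaw_real_runs, hceq, pow_one, pow_one]
    have := hexit.trans (le_stepLaw_first hd h2q.le)
    gcongr
  · rw [siteLaw_real_runs, hceq, pow_one, pow_one]
    have := hexit.trans (le_stepLaw_second hd h2q.le)
    gcongr

end Frog

/-! ### Extinction below the threshold, in every dimension -/

namespace Frog

open Measure
open scoped ENNReal

variable {d : ℕ}

/-- There is a chain of `n` visits from `x` to `y` that neither revisits a site nor enters `S`. -/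
def AvoidingPath (r : Site d → SiteData d) : ℕ → Site d → Site d → Set (Site d) → Prop
  | 0, x, y, _ => x = y
  | n + 1, x, y, S => ∃ z, z ∉ insert x S ∧ VisitRel r x z ∧ AvoidingPath r n z y (insert x S)

theorem setOf_avoidingPath_succ (n : ℕ) (x y : Site d) (S : Set (Site d)) :
    {r | AvoidingPath r (n + 1) x y S} = ⋃ z : ((insert x S)ᶜ : Set (Site d)),
      {r | VisitRel r x z} ∩ {r | AvoidingPath r n z y (insert x S)} := by
  ext r
  simp [AvoidingPath, and_left_comm]

theorem measurableSet_visitRel (x y : Site d) :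
    MeasurableSet {r : Site d → SiteData d | VisitRel r x y} :=
  (measurable_pi_apply (X := fun _ : Site d => SiteData d) x) (measurableSet_visits x y)

theorem measurableSet_avoidingPath (n : ℕ) (x y : Site d) (S : Set (Site d)) :
    MeasurableSet {r | AvoidingPath r n x y S} := by
  induction n generalizing x S with
  | zero => exact MeasurableSet.const _
  | succ n ih =>
    rw [setOf_avoidingPath_succ]
    exact MeasurableSet.iUnion fun z => (measurableSet_visitRel x z).inter (ih _ _)

/-- Every site whose data are read, the start included, lies outside S. -/
theorem avoidingPath_congr {r r' : Site d → SiteData d} {n : ℕ} {x y : Site d} {S : Set (Site d)}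
    (hx : x ∉ S) (h : ∀ z ∉ S, r z = r' z) (hr : AvoidingPath r n x y S) :
    AvoidingPath r' n x y S := by
  induction n generalizing x S with
  | zero => exact hr
  | succ n ih =>
    obtain ⟨z, hz, hv, hr⟩ := hr
    refine ⟨z, hz, ?_, ih hz (fun w hw => h w fun hS => hw (Set.mem_insert_of_mem x hS)) hr⟩
    rw [VisitRel, ← h x hx]
    exact hv

theorem dependsOn_avoidingPath (n : ℕ) {x : Site d} (y : Site d) {S : Set (Site d)} (hx : x ∉ S) :
    DependsOn (· ∈ {r | AvoidingPath r n x y S}) Sᶜ := by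
  intro r r' h
  exact propext ⟨avoidingPath_congr hx fun z hz => h z hz,
    avoidingPath_congr hx fun z hz => (h z hz).symm⟩

theorem dependsOn_visitRel (x y : Site d) :
    DependsOn (· ∈ {r : Site d → SiteData d | VisitRel r x y}) {x} := by
  intro r r' h
  change VisitRel r x y = VisitRel r' x y
  rw [VisitRel, VisitRel, h x rfl]

theorem exists_avoidingPath {r : Site d → SiteData d} {x y : Site d}
    (h : Relation.ReflTransGen (VisitRel r) x y) : ∃ n, AvoidingPath r n x y ∅ := by
  obtain ⟨n, f, h0, hn, hf, hinj⟩ :=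
    Relation.ReflTransGen.exists_injOn_path (R := VisitRel r) (a := x) (T := {y}) ⟨y, rfl, h⟩
  -- After k steps of a simple path the forbidden set consists of the first k vertices.
  have key : ∀ m k, k + m = n → AvoidingPath r m (f k) y (f '' Set.Iio k) := by
    intro m
    induction m with
    | zero => rintro k rfl; exact hn
    | succ m ih =>
      intro k hk
      have hins : insert (f k) (f '' Set.Iio k) = f '' Set.Iio (k + 1) := by
        rw [← Set.image_insert_eq]
        congr 1
        ext j; simp
      refine ⟨f (k + 1), ?_, hf k (by omega), ?_⟩
      · rw [hins]
        rintro ⟨j, hj, hjk⟩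
        have hj : j < k + 1 := hj
        have := hinj (show j ≤ n by omega) (show k + 1 ≤ n by omega) hjk
        omega
      · rw [hins]; exact ih (k + 1) (by omega)
  have := key n 0 (zero_add n)
  rw [h0] at this
  exact ⟨n, by simpa using this⟩

variable (p : unitInterval) (ν : Measure ℕ) [IsProbabilityMeasure ν]

/-- The expected number of sites other than `x` visited from `x`. -/
theorem tsum_visits_le (hint : Integrable (fun n : ℕ => (n : ℝ)) ν) (hp : (p : ℝ) < 1)
    (x : Site d) : ∑' y, siteLaw d p ν {e | x ≠ y ∧ Visits e x y} ≤
      ENNReal.ofReal ((∫ n : ℕ, (n : ℝ) ∂ν) * (p / (1 - p))) := by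
  have hsub : ∀ y, siteLaw d p ν {e | x ≠ y ∧ Visits e x y} ≤ ∑' (i : ℕ) (n : ℕ),
      siteLaw d p ν ({e | Runs Set.univ e i (n + 1)} ∩ {e | x + displ e i (n + 1) = y}) := by
    intro y
    refine le_trans (measure_mono ?_) ((measure_iUnion_le _).trans
      (ENNReal.tsum_le_tsum fun i => measure_iUnion_le _))
    rintro e ⟨hxy, hv⟩
    obtain ⟨i, n, hr, hy⟩ := visits_iff_runs.1 hv
    -- At time 0 the particle is at x itself; hence the sum over n + 1, which gives p / (1 - p)
    -- rather than 1 / (1 - p).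
    obtain _ | n := n
    · exact absurd (by simpa [displ] using hy) hxy
    · exact Set.mem_iUnion.2 ⟨i, Set.mem_iUnion.2 ⟨n, hr, hy⟩⟩
  have hrun : ∀ i n : ℕ, ∑' y, siteLaw d p ν
      ({e | Runs Set.univ e i (n + 1)} ∩ {e | x + displ e i (n + 1) = y}) ≤
      ν {m | i < m} * ENNReal.ofReal ((p : ℝ) ^ (n + 1)) := by
    intro i n
    -- At each time a particle is at one site only, so the sum over y is at most the probability of
    -- being alive.
    have h := tsum_meas_le_meas_iUnion_of_disjoint (siteLaw d p ν)
      (As := fun y => {e | Runs Set.univ e i (n + 1)} ∩ {e | x + displ e i (n + 1) = y})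
      (fun y => (measurableSet_runs _ i (n + 1)).inter
        (((measurable_displ i (n + 1)).const_add x) (measurableSet_singleton y)))
      (fun y z hyz => Set.disjoint_left.2 fun e hy hz => hyz (hy.2.symm.trans hz.2))
    refine h.trans ((measure_mono (Set.iUnion_subset fun y => Set.inter_subset_left)).trans ?_)
    rw [siteLaw_runs]
    simp
  have hgeom : ∑' n : ℕ, ENNReal.ofReal ((p : ℝ) ^ (n + 1)) = ENNReal.ofReal (p / (1 - p)) := by
    have hs := (hasSum_geometric_of_lt_one p.2.1 hp).mul_left (p : ℝ)
    simp only [← pow_succ', ← div_eq_mul_inv] at hs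
    rw [← hs.tsum_eq, ENNReal.ofReal_tsum_of_nonneg (fun n => pow_nonneg p.2.1 _) hs.summable]
  calc ∑' y, siteLaw d p ν {e | x ≠ y ∧ Visits e x y}
      ≤ ∑' y, ∑' (i : ℕ) (n : ℕ), siteLaw d p ν
        ({e | Runs Set.univ e i (n + 1)} ∩ {e | x + displ e i (n + 1) = y}) :=
        ENNReal.tsum_le_tsum hsub
    _ = ∑' (i : ℕ) (n : ℕ) (y : Site d), siteLaw d p ν
        ({e | Runs Set.univ e i (n + 1)} ∩ {e | x + displ e i (n + 1) = y}) := by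
        rw [ENNReal.tsum_comm]
        exact tsum_congr fun i => ENNReal.tsum_comm
    _ ≤ ∑' (i : ℕ) (n : ℕ), ν {m | i < m} * ENNReal.ofReal ((p : ℝ) ^ (n + 1)) :=
        ENNReal.tsum_le_tsum fun i => ENNReal.tsum_le_tsum fun n => hrun i n
    _ = ENNReal.ofReal ((∫ n : ℕ, (n : ℝ) ∂ν) * (p / (1 - p))) := by
        simp_rw [ENNReal.tsum_mul_left]
        rw [ENNReal.tsum_mul_right, tsum_tail ν hint, hgeom, ← ENNReal.ofReal_mul]
        exact integral_nonneg fun n => by positivity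

/-- The first visit reads the data of x alone and the rest of the path reads only sites outside
`insert x S`, so the two are independent. Summing over the endpoint and then over the first visited
site gives one factor `lam` per step, uniformly in S. -/
theorem tsum_avoidingPath_le {lam : ℝ≥0∞}
    (h : ∀ x : Site d, ∑' y, siteLaw d p ν {e | x ≠ y ∧ Visits e x y} ≤ lam) (n : ℕ) {x : Site d}
    {S : Set (Site d)} (hx : x ∉ S) :
    ∑' y, infinitePi (fun _ : Site d => siteLaw d p ν) {r | AvoidingPath r n x y S} ≤ lam ^ n := by
  induction n generalizing x S with
  | zero =>
    rw [tsum_eq_single x fun y hy => by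
      simp [AvoidingPath, Ne.symm hy]]
    exact (prob_le_one (μ := infinitePi (fun _ : Site d => siteLaw d p ν))).trans_eq
      (pow_zero lam).symm
  | succ n ih =>
    set μ := infinitePi (fun _ : Site d => siteLaw d p ν) with hμ
    have hvis : ∀ z : ((insert x S)ᶜ : Set (Site d)),
        μ {r | VisitRel r x z} = siteLaw d p ν {e | x ≠ z ∧ Visits e x z} := by
      intro z
      have hxz : x ≠ z := fun h => z.2 (h ▸ Set.mem_insert x S)
      have h1 := (measurePreserving_eval_infinitePi (fun _ : Site d => siteLaw d p ν)
        x).measure_preimage (measurableSet_visits x z).nullMeasurableSet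
      have h2 : {e : SiteData d | x ≠ z ∧ Visits e x z} = {e | Visits e x z} := by
        ext e; simp [hxz]
      rw [h2, ← h1]
      rfl
    have hstep : ∀ y, μ {r | AvoidingPath r (n + 1) x y S} ≤
        ∑' z : ((insert x S)ᶜ : Set (Site d)), siteLaw d p ν {e | x ≠ z ∧ Visits e x z} *
          μ {r | AvoidingPath r n z y (insert x S)} := by
      intro y
      rw [setOf_avoidingPath_succ]
      refine (measure_iUnion_le _).trans (ENNReal.tsum_le_tsum fun z => le_of_eq ?_)
      rw [hμ, infinitePi_inter_of_dependsOn (fun _ : Site d => siteLaw d p ν)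
        (measurableSet_visitRel x z) (measurableSet_avoidingPath n z y _) (S := {x})
        (T := (insert x S)ᶜ) (by simp) (dependsOn_visitRel x z)
        (dependsOn_avoidingPath n y (show (z : Site d) ∉ insert x S from z.2)),
        ← hμ, hvis z]
    calc ∑' y, μ {r | AvoidingPath r (n + 1) x y S}
        ≤ ∑' y, ∑' z : ((insert x S)ᶜ : Set (Site d)),
          siteLaw d p ν {e | x ≠ z ∧ Visits e x z} *
            μ {r | AvoidingPath r n z y (insert x S)} := ENNReal.tsum_le_tsum hstep
      _ = ∑' z : ((insert x S)ᶜ : Set (Site d)), siteLaw d p ν {e | x ≠ z ∧ Visits e x z} *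
            ∑' y, μ {r | AvoidingPath r n z y (insert x S)} := by
          rw [ENNReal.tsum_comm]
          simp_rw [ENNReal.tsum_mul_left]
      _ ≤ ∑' z : ((insert x S)ᶜ : Set (Site d)),
            siteLaw d p ν {e | x ≠ z ∧ Visits e x z} * lam ^ n :=
          ENNReal.tsum_le_tsum fun z => by gcongr; exact ih z.2
      _ = (∑' z : ((insert x S)ᶜ : Set (Site d)),
            siteLaw d p ν {e | x ≠ z ∧ Visits e x z}) * lam ^ n := ENNReal.tsum_mul_right
      _ ≤ lam * lam ^ n := by
          gcongr
          exact (ENNReal.tsum_comp_le_tsum_of_injective Subtype.val_injective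
            fun z => siteLaw d p ν {e | x ≠ z ∧ Visits e x z}).trans (h x)
      _ = lam ^ (n + 1) := (pow_succ' lam n).symm

theorem ae_lifetime_lt_top (hp : p ≠ 1) :
    ∀ᵐ ω ∂frogLaw d p ν, ∀ x i, lifetime ω x i < ⊤ := by
  have h : ∀ q : Site d × ℕ, ∀ᵐ ω ∂frogLaw d p ν, ω.2.2 q < ⊤ := by
    intro q
    have h1 : MeasurePreserving (fun ω : Config d => ω.2.2 q) (frogLaw d p ν) (lifetimeLaw p) :=
      (measurePreserving_eval_infinitePi (fun _ : Site d × ℕ => lifetimeLaw p) q).comp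
        (measurePreserving_snd.comp measurePreserving_snd)
    refine h1.quasiMeasurePreserving.ae (p := fun t => t < ⊤) ?_
    rw [ae_iff]
    simpa using lifetimeLaw_top hp
  have h2 := ae_all_iff.2 h
  filter_upwards [h2] with ω hω x i using hω (x, i)

/-- Below `1 / (1 + E η)` the process dies out. -/
theorem frogLaw_survives_eq_zero (hint : Integrable (fun n : ℕ => (n : ℝ)) ν)
    (h : (p : ℝ) * (1 + ∫ n : ℕ, (n : ℝ) ∂ν) < 1) : frogLaw d p ν {ω | Survives ω} = 0 := by
  have hm : 0 ≤ ∫ n : ℕ, (n : ℝ) ∂ν := integral_nonneg fun n => by positivity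
  have hp : (p : ℝ) < 1 := by nlinarith [p.2.1]
  have hp1 : p ≠ 1 := fun h => by simp [h] at hp
  set lam := ENNReal.ofReal ((∫ n : ℕ, (n : ℝ) ∂ν) * (p / (1 - p))) with hlam
  have hlam1 : lam < 1 := by
    rw [hlam, ENNReal.ofReal_lt_one, ← mul_div_assoc, div_lt_one (by linarith)]
    linarith
  set μ := infinitePi (fun _ : Site d => siteLaw d p ν) with hμ
  -- The expected number of activated sites is at most the geometric series of `lam` < 1.
  have hsum : ∑' y : Site d, μ {r | ∃ n, AvoidingPath r n 0 y ∅} ≠ ⊤ := by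
    refine ne_top_of_le_ne_top (b := (1 - lam)⁻¹) (by simpa [tsub_eq_zero_iff_le] using hlam1) ?_
    calc ∑' y : Site d, μ {r | ∃ n, AvoidingPath r n 0 y ∅}
        ≤ ∑' (y : Site d) (n : ℕ), μ {r | AvoidingPath r n 0 y ∅} := by
          refine ENNReal.tsum_le_tsum fun y => le_trans (measure_mono ?_) (measure_iUnion_le _)
          exact fun r ⟨n, hn⟩ => Set.mem_iUnion.2 ⟨n, hn⟩
      _ = ∑' (n : ℕ) (y : Site d), μ {r | AvoidingPath r n 0 y ∅} := ENNReal.tsum_comm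
      _ ≤ ∑' n : ℕ, lam ^ n := ENNReal.tsum_le_tsum fun n =>
          tsum_avoidingPath_le p ν (tsum_visits_le p ν hint hp) n (Set.notMem_empty 0)
      _ = (1 - lam)⁻¹ := ENNReal.tsum_geometric lam
  have hfin : ∀ᵐ r ∂μ, {y : Site d | ∃ n, AvoidingPath r n 0 y ∅}.Finite :=
    ae_finite_setOfPred_mem hsum
  rw [hμ, ← map_toField] at hfin
  have hfin := ae_of_ae_map measurable_toField.aemeasurable hfin
  have hae : ∀ᵐ ω ∂frogLaw d p ν, ¬ Survives ω := by
    filter_upwards [hfin, ae_lifetime_lt_top (d := d) p ν hp1] with ω h1 h2 hs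
    refine infinite_of_survives h2 hs (h1.subset fun y hy => ?_)
    exact exists_avoidingPath (reachable_iff.2 hy)
  rw [ae_iff] at hae
  simpa using hae

/-- Nonemptiness is required because the infimum of the empty set of reals is 0 by convention. -/
theorem le_criticalParam (hint : Integrable (fun n : ℕ => (n : ℝ)) ν)
    (hne : {p : ℝ | ∃ hp : p ∈ Set.Icc (0 : ℝ) 1,
      0 < frogLaw d ⟨p, hp⟩ ν {ω | Survives ω}}.Nonempty) :
    1 / (1 + ∫ n : ℕ, (n : ℝ) ∂ν) ≤ criticalParam d ν := by
  have hm : 0 ≤ ∫ n : ℕ, (n : ℝ) ∂ν := integral_nonneg fun n => by positivity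
  refine le_csInf hne ?_
  rintro x ⟨hx, hs⟩
  by_contra hlt
  rw [not_le, lt_div_iff₀ (by positivity)] at hlt
  exact hs.ne' (frogLaw_survives_eq_zero ⟨x, hx⟩ ν hint hlt)

theorem criticalParam_le {p : unitInterval} (h : 0 < frogLaw d p ν {ω | Survives ω}) :
    criticalParam d ν ≤ p :=
  csInf_le ⟨0, fun _ hx => hx.1.1⟩ ⟨p.2, h⟩

end Frog

/-! ### Conclusion -/

theorem theorem2p8 (ν : Measure ℕ) [IsProbabilityMeasure ν]
    (hpos : 0 < ν {n : ℕ | 1 ≤ n})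
    (hint : Integrable (fun n : ℕ => (n : ℝ)) ν) :
    Tendsto (fun d : ℕ => Frog.criticalParam d ν) atTop
      (𝓝 (1 / (1 + ∫ n : ℕ, (n : ℝ) ∂ν))) := by
  set m := ∫ n : ℕ, (n : ℝ) ∂ν with hm
  -- Since η is not almost surely 0, the threshold lies strictly below 1, which leaves room for
  -- parameters x between them.
  have hm0 : 0 < m := by
    have hnn : 0 ≤ m := integral_nonneg fun n => by positivity
    refine hnn.lt_of_ne' fun h0 => ?_
    have h1 := (integral_eq_zero_iff_of_nonneg (fun n => by positivity) hint).1 h0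
    rw [Filter.EventuallyEq, ae_iff] at h1
    refine hpos.ne' (measure_mono_null (fun n hn => ?_) h1)
    have hn : 1 ≤ n := hn
    simp only [Pi.zero_apply, Nat.cast_eq_zero, Set.mem_ofPred_eq]
    omega
  have hlt1 : 1 / (1 + m) < 1 := by rw [div_lt_one (by positivity)]; linarith
  have hpos1 : 0 < 1 / (1 + m) := by positivity
  -- Survival at x bounds the critical parameter from above and also makes the set of surviving
  -- parameters nonempty, as the lower bound requires.
  have key : ∀ x : ℝ, 1 / (1 + m) < x → x < 1 → ∀ᶠ d : ℕ in atTop,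
      1 / (1 + m) ≤ Frog.criticalParam d ν ∧ Frog.criticalParam d ν ≤ x := by
    intro x hx hx1
    have hx0 := hpos1.trans hx
    have hxI : x ∈ unitInterval := ⟨hx0.le, hx1.le⟩
    filter_upwards [Frog.eventually_survives_pos ν hpos hint ⟨x, hxI⟩ hx0 hx1
      ((div_lt_iff₀ (by positivity)).1 hx)] with d hd
    exact ⟨Frog.le_criticalParam ν hint ⟨x, hxI, hd⟩, Frog.criticalParam_le ν hd⟩
  rw [tendsto_order]
  constructor
  · intro a ha
    obtain ⟨x, hx, hx1⟩ := exists_between hlt1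
    exact (key x hx hx1).mono fun d hd => ha.trans_le hd.1
  · intro a ha
    obtain ⟨x, hx, hxa⟩ := exists_between (lt_min ha hlt1)
    exact (key x hx (hxa.trans_le (min_le_right _ _))).mono fun d hd =>
      hd.2.trans_lt (hxa.trans_le (min_le_left _ _))
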